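/- Let $k$ be a commutative unital ring. A $\Sigma$-module is a collection $E=\{E(n)\}_{n\ge 0}$ of right $k[\Sigma_n]$-modules; it is extended to finite sets $S$ with $n$ elements by $E(S):=E(n)\times_{\Sigma_n}\{\text{bijections } [n]\cong S\}$, where $[n]=\{1,\dots,n\}$. For $n\ge 0$ let $\mathtt{Tree}_n$ be the category of finite rooted (non-planar) trees with at least one internal vertex and with leaves labeled bijectively by $[n]$, and their isomorphisms; let $\mathtt{UTree}_n$ be the same category with the exceptional tree (one leg, which is both root and leaf, and no internal vertex) also allowed; it differs from $\mathtt{Tree}_n$ only for $n=1$. For a tree $T$ put $E(T):=\bigotimes_{v} E(\mathrm{in}(v))$, the tensor product over the internal vertices $v$ of $T$, where $\mathrm{in}(v)$ is the set of input edges of $v$. Put $$\Psi(E)(n):=\operatorname*{colim}_{T\in \mathtt{Tree}_n}E(T),\qquad \Gamma(E)(n):=\operatorname*{colim}_{T\in \mathtt{UTree}_n}E(T),$$ with the symmetric groups re-labeling the leaves. These are endofunctors of the category $\Sigma\text{-mod}$ of $\Sigma$-modules over $k$. A non-unital operad is a $\Sigma$-module $S$ with $k$-linear maps $\circ_i:S(m)\otimes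 S(n)\to S(m+n-1)$, $1\le i\le m$, $n\ge 0$, such that for $f\in S(a)$, $g\in S(b)$, $h\in S(c)$ and $1\le j\le a$ $$(f\circ_j g)\circ_i h=\begin{cases}(f\circ_i h)\circ_{j+c-1}g, & 1\le i<j,\\ f\circ_j(g\circ_{i-j+1}h), & j\le i<b+j,\\ (f\circ_{i-b+1}h)\circ_j g, & j+b\le i\le a+b-1,\end{cases}$$ and $(f\tau)\circ_i(g\sigma)=(f\circ_{\tau(i)}g)(\tau\circ_i\sigma)$ for $f\in S(m)$, $g\in S(n)$, $\tau\in\Sigma_m$, $\sigma\in\Sigma_n$, where $\tau\circ_i\sigma\in\Sigma_{m+n-1}$ is given by inserting $\sigma$ at the $i$-th place of $\tau$. An operad is a non-unital operad with an element $e\in S(1)$ such that $f\circ_i e=f$ and $e\circ_1 g=g$ for all $f\in S(m)$, $1\le i\le m$, and all $g\in S(n)$, $n\ge 0$. Morphisms are the morphisms of $\Sigma$-modules that commute with all $\circ_i$ and, for operads, preserve $e$; the categories are denoted $\psi\mathtt{Oper}$ and $\mathtt{Oper}$. **Theorem.** The functor $\Psi$, with the unit that sends an element of $E(n)$ to the correspondingly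 decorated $n$-corolla and the multiplication $\Psi\Psi(E)\to\Psi(E)$ that erases the braces (a tree whose vertices are decorated by decorated trees is sent to the decorated tree obtained by substituting the latter for the vertices), is a monad on $\Sigma\text{-mod}$; likewise for $\Gamma$. A $\Psi$-algebra structure on a $\Sigma$-module is the same as the structure of a non-unital operad, and a $\Gamma$-algebra structure is the same as the structure of an operad: there are isomorphisms of categories $$\mathtt{Alg}_\Psi(\Sigma\text{-mod})\cong\psi\mathtt{Oper}\qquad\text{and}\qquad \mathtt{Alg}_\Gamma(\Sigma\text{-mod})\cong\mathtt{Oper}$$ that commute with the forgetful functors to $\Sigma\text{-mod}$. -/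

import Mathlib

open CategoryTheory CategoryTheory.Limits
open scoped TensorProduct

universe u

namespace TreeOperads

/-! ### Sigma-modules -/

/-- A `Σ`-module over `k`: a collection `E(n)`, `n ≥ 0`, of right `k[Σ_n]`-modules.
`act σ x` is `x · σ`; the product in `Equiv.Perm` is composition, `(σ * τ) i = σ (τ i)`. -/
structure SigmaMod (k : Type u) [CommRing k] where
  obj : ℕ → Type u
  [addCommGroup : ∀ n, AddCommGroup (obj n)]
  [module : ∀ n, Module k (obj n)]
  act : ∀ {n : ℕ}, Equiv.Perm (Fin n) → obj n →ₗ[k] obj n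
  act_one : ∀ {n : ℕ} (x : obj n), act 1 x = x
  act_mul : ∀ {n : ℕ} (σ τ : Equiv.Perm (Fin n)) (x : obj n), act (σ * τ) x = act τ (act σ x)

attribute [instance] SigmaMod.addCommGroup SigmaMod.module

section
variable {k : Type u} [CommRing k]

/-- Morphisms of `Σ`-modules: sequences of equivariant linear maps. -/
@[ext]
structure SigmaMod.Hom (E F : SigmaMod k) where
  app : ∀ n : ℕ, E.obj n →ₗ[k] F.obj n
  app_act : ∀ {n : ℕ} (σ : Equiv.Perm (Fin n)) (x : E.obj n),
    app n (E.act σ x) = F.act σ (app n x)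

instance : Category (SigmaMod k) where
  Hom E F := SigmaMod.Hom E F
  id E := ⟨fun _ => LinearMap.id, fun _ _ => rfl⟩
  comp f g := ⟨fun n => g.app n ∘ₗ f.app n, fun σ x => by simp [f.app_act, g.app_act]⟩

@[ext]
theorem SigmaMod.hom_ext {E F : SigmaMod k} {f g : E ⟶ F}
    (h : ∀ n, f.app n = g.app n) : f = g :=
  SigmaMod.Hom.ext (funext h)

/-- The value `E(S)` of a `Σ`-module at a finite set `S`, that is `E(n) ×_{Σ_n} Bij`, where
`n` is the cardinality of `S`. As the bijections form a torsor, the class of a pair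
(element, bijection) is recorded by the family of all its representatives: for every bijection
`e : [n] ≃ S` the unique element `φ n e` of `E(n)` such that `(φ n e, e)` lies in the class. The
equivariance condition says that `(x · σ, e ∘ σ)` and `(x, e)` represent the same class. -/
def SigmaMod.ext (E : SigmaMod k) (S : Type) :
    Submodule k (∀ n : ℕ, (Fin n ≃ S) → E.obj n) where
  carrier := {φ | ∀ (n : ℕ) (σ : Equiv.Perm (Fin n)) (e : Fin n ≃ S),
    φ n (σ.trans e) = E.act σ (φ n e)}
  add_mem' := by
    intro a b ha hb n σ e
    simp [ha n σ e, hb n σ e]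
  zero_mem' := by intro n σ e; simp
  smul_mem' := by
    intro c a ha n σ e
    simp [ha n σ e]

/-- `S ↦ E(S)` is functorial for bijections. -/
def SigmaMod.extMap (E : SigmaMod k) {S S' : Type} (f : S ≃ S') : E.ext S →ₗ[k] E.ext S' where
  toFun φ := ⟨fun n e => φ.1 n (e.trans f.symm), fun n σ e => φ.2 n σ (e.trans f.symm)⟩
  map_add' _ _ := rfl
  map_smul' _ _ := rfl

/-- `E ↦ E(S)` is functorial in the `Σ`-module. -/
def SigmaMod.homExt {E F : SigmaMod k} (g : E ⟶ F) (S : Type) : E.ext S →ₗ[k] F.ext S where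
  toFun φ := ⟨fun n e => g.app n (φ.1 n e), fun n σ e => by
    change g.app n (φ.1 n (σ.trans e)) = _
    rw [φ.2 n σ e, g.app_act]⟩
  map_add' _ _ := by ext; simp
  map_smul' _ _ := by ext; simp

/-- A bijection `e : [n] ≃ S` identifies `E(S)` with `E(n)`. -/
theorem SigmaMod.ext_eval_bijective (E : SigmaMod k) {S : Type} {n : ℕ} (e : Fin n ≃ S) :
    Function.Bijective
      ((LinearMap.proj e ∘ₗ LinearMap.proj n) ∘ₗ (E.ext S).subtype : E.ext S →ₗ[k] E.obj n) := by
  constructor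
  · intro φ ψ h
    apply Subtype.ext
    funext m e'
    obtain rfl : m = n := Fin.equiv_iff_eq.1 ⟨e'.trans e.symm⟩
    have h' : φ.1 m e = ψ.1 m e := h
    have he : e' = (e'.trans e.symm : Equiv.Perm (Fin m)).trans e := by ext; simp
    rw [he, φ.2, ψ.2, h']
  · intro x
    have key : ∀ (m : ℕ) (e' : Fin m ≃ S), m = n := fun m e' =>
      Fin.equiv_iff_eq.1 ⟨e'.trans e.symm⟩
    refine ⟨⟨fun m e' => by
      exact E.act (n := m) (e'.trans (e.symm.trans (finCongr (key m e').symm)))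
        (cast (by rw [key m e']) x), ?_⟩, ?_⟩
    · intro m σ e'
      obtain rfl := key m e'
      exact E.act_mul (e'.trans e.symm) σ x
    · change E.act _ x = x
      convert E.act_one x
      ext; simp

/-- The identification `E(S) ≅ E(n)` given by `e : [n] ≃ S`; its inverse sends `x` to the class
of `(x, e)`. -/
noncomputable def SigmaMod.extEquiv (E : SigmaMod k) {S : Type} {n : ℕ} (e : Fin n ≃ S) :
    E.ext S ≃ₗ[k] E.obj n :=
  LinearEquiv.ofBijective _ (E.ext_eval_bijective e)

end

/-! ### Rooted trees -/

/-- Abstract (non-planar) finite rooted trees: either the exceptional tree, consisting of one leg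
that is the root and a leaf at the same time, or a root vertex with a finite set `I` of input
edges, and for each `i : I` the rooted tree whose root is the edge `i`. -/
inductive RTree : Type 1
  | leg : RTree
  | node (I : Type) [Finite I] (c : I → RTree) : RTree

namespace RTree

/-- The set of leaves. -/
def Leaves : RTree → Type
  | leg => Unit
  | node I c => Σ i : I, (c i).Leaves

/-- The set of (internal) vertices; `none` is the root vertex. -/
def Vert : RTree → Type
  | leg => Empty
  | node I c => Option (Σ i : I, (c i).Vert)

/-- The set `in(v)` of input edges of a vertex. -/
def inputs : (T : RTree) → T.Vert → Type
  | node I _, none => I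
  | node _ c, some ⟨i, v⟩ => (c i).inputs v

/-- Isomorphisms of rooted trees: a bijection between the inputs of the root vertices together
with isomorphisms of the corresponding subtrees. -/
def Iso : RTree → RTree → Type
  | leg, leg => Unit
  | leg, node _ _ => Empty
  | node _ _, leg => Empty
  | node I c, node J d => Σ e : I ≃ J, ∀ j : J, Iso (c (e.symm j)) (d j)

namespace Iso

/-- The identity isomorphism. -/
def id : (T : RTree) → Iso T T
  | leg => ()
  | node I c => ⟨Equiv.refl I, fun i => id (c i)⟩

/-- Composition of isomorphisms. -/
def comp : {T T' T'' : RTree} → Iso T T' → Iso T' T'' → Iso T T''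
  | leg, leg, _, _, g => g
  | leg, node _ _, _, f, _ => f.elim
  | node _ _, leg, _, f, _ => f.elim
  | node _ _, node _ _, leg, _, g => g.elim
  | node _ _, node _ _, node _ _, f, g =>
    ⟨f.1.trans g.1, fun j => comp (f.2 (g.1.symm j)) (g.2 j)⟩

/-- The bijection of leaves induced by an isomorphism (read backwards). -/
def leaves : {T T' : RTree} → Iso T T' → (T'.Leaves ≃ T.Leaves)
  | leg, leg, _ => Equiv.refl Unit
  | leg, node _ _, f => f.elim
  | node _ _, leg, f => f.elim
  | node _ _, node _ _, f => Equiv.sigmaCongr f.1.symm (fun j => leaves (f.2 j))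

/-- The bijection of vertices induced by an isomorphism (read backwards). -/
def vert : {T T' : RTree} → Iso T T' → (T'.Vert ≃ T.Vert)
  | leg, leg, _ => Equiv.refl Empty
  | leg, node _ _, f => f.elim
  | node _ _, leg, f => f.elim
  | node _ _, node _ _, f =>
    Equiv.optionCongr (Equiv.sigmaCongr f.1.symm (fun j => vert (f.2 j)))

/-- The bijection between the inputs of corresponding vertices. -/
def inputs : {T T' : RTree} → (f : Iso T T') → (v : T'.Vert) →
    (T.inputs (f.vert v) ≃ T'.inputs v)
  | leg, node _ _, f, _ => f.elim
  | node _ _, node _ _, f, none => f.1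
  | node _ _, node _ _, f, some ⟨j, v⟩ => inputs (f.2 j) v

theorem id_comp : ∀ {T T' : RTree} (f : Iso T T'), comp (id T) f = f
  | leg, leg, _ => rfl
  | leg, node _ _, f => f.elim
  | node _ _, leg, f => f.elim
  | node _ _, node _ _, f =>
    Sigma.ext rfl (heq_of_eq (funext fun j => id_comp (f.2 j)))

theorem comp_id : ∀ {T T' : RTree} (f : Iso T T'), comp f (id T') = f
  | leg, leg, _ => rfl
  | leg, node _ _, f => f.elim
  | node _ _, leg, f => f.elim
  | node _ _, node _ _, f =>
    Sigma.ext rfl (heq_of_eq (funext fun j => comp_id (f.2 j)))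

theorem assoc : ∀ {T₁ T₂ T₃ T₄ : RTree} (f : Iso T₁ T₂) (g : Iso T₂ T₃) (h : Iso T₃ T₄),
    comp (comp f g) h = comp f (comp g h)
  | leg, leg, leg, _, _, _, _ => rfl
  | leg, leg, node _ _, _, _, g, _ => g.elim
  | leg, node _ _, _, _, f, _, _ => f.elim
  | node _ _, leg, _, _, f, _, _ => f.elim
  | node _ _, node _ _, leg, _, _, g, _ => g.elim
  | node _ _, node _ _, node _ _, leg, _, _, h => h.elim
  | node _ _, node _ _, node _ _, node _ _, f, g, h =>
    Sigma.ext rfl (heq_of_eq (funext fun j =>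
      assoc (f.2 (g.1.symm (h.1.symm j))) (g.2 (h.1.symm j)) (h.2 j)))

theorem leaves_id : ∀ (T : RTree) (l : T.Leaves), (id T).leaves l = l
  | leg, _ => rfl
  | node _ c, ⟨i, l⟩ => Sigma.ext rfl (heq_of_eq (leaves_id (c i) l))

theorem leaves_comp : ∀ {T T' T'' : RTree} (f : Iso T T') (g : Iso T' T'') (l : T''.Leaves),
    (comp f g).leaves l = f.leaves (g.leaves l)
  | leg, leg, leg, _, _, _ => rfl
  | leg, leg, node _ _, _, g, _ => g.elim
  | leg, node _ _, _, f, _, _ => f.elim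
  | node _ _, leg, _, f, _, _ => f.elim
  | node _ _, node _ _, leg, _, g, _ => g.elim
  | node _ _, node _ _, node _ _, f, g, ⟨j, l⟩ =>
    Sigma.ext rfl (heq_of_eq (leaves_comp (f.2 (g.1.symm j)) (g.2 j) l))

/-- The inverse isomorphism. -/
def symm : {T T' : RTree} → Iso T T' → Iso T' T
  | leg, leg, _ => ()
  | leg, node _ _, f => f.elim
  | node _ _, leg, f => f.elim
  | node _ c, node _ d, f => ⟨f.1.symm, fun i =>
      cast (congrArg (fun i' => Iso (d (f.1 i)) (c i')) (f.1.symm_apply_apply i))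
        (symm (f.2 (f.1 i)))⟩

theorem eq_id_aux {I : Type} [Finite I] {c : I → RTree} (e : I ≃ I) (he : e = Equiv.refl I)
    (F : ∀ j, Iso (c (e.symm j)) (c j))
    (hF : ∀ i j (h : i = e.symm j) (h' : i = j), F j = cast (by rw [← h, h']) (id (c i))) :
    (⟨e, F⟩ : Σ e : I ≃ I, ∀ j : I, Iso (c (e.symm j)) (c j)) =
      ⟨Equiv.refl I, fun i => id (c i)⟩ := by
  subst he
  exact Sigma.ext rfl (heq_of_eq (funext fun j => hF j j rfl rfl))

theorem comp_symm : ∀ {T T' : RTree} (f : Iso T T'), comp f (symm f) = id T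
  | leg, leg, _ => rfl
  | leg, node _ _, f => f.elim
  | node _ _, leg, f => f.elim
  | node I c, node J d, f => by
    refine eq_id_aux (f.1.trans f.1.symm) (by simp) _ ?_
    intro i j h h'
    subst h'
    have key : ∀ (i' : I) (h : i' = i) (g : Iso (c i') (d (f.1 i))), comp g (symm g) = id (c i') →
        comp g (cast (congrArg (fun i' => Iso (d (f.1 i)) (c i')) h) (symm g)) =
          cast (by rw [h]) (id (c i)) := by
      rintro i' rfl g hg
      exact hg
    exact key _ (f.1.symm_apply_apply i) (f.2 (f.1 i)) (comp_symm _)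

theorem symm_comp {T T' : RTree} (f : Iso T T') : comp (symm f) f = id T' := by
  have h : symm (symm f) = f := by
    rw [← id_comp (symm (symm f)), ← comp_symm f, assoc, comp_symm, comp_id]
  have h' := comp_symm (symm f)
  rwa [h] at h'

end Iso

/-! ### Labeled trees -/

/-- Decorations of the vertices of a tree by elements of a `Σ`-module: a vertex `v` carries an
element of `E(in(v))`. -/
abbrev Dec {k : Type u} [CommRing k] (E : SigmaMod k) (T : RTree) : Type u :=
  ∀ v : T.Vert, E.ext (T.inputs v)

/-- The decoration transported along an isomorphism. -/
def Iso.push {k : Type u} [CommRing k] (E : SigmaMod k) {T T' : RTree} (f : Iso T T')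
    (d : Dec E T) : Dec E T' :=
  fun v => E.extMap (f.inputs v) (d (f.vert v))

theorem Iso.push_id {k : Type u} [CommRing k] (E : SigmaMod k) :
    ∀ (T : RTree) (d : Dec E T), (Iso.id T).push E d = d
  | leg, _ => funext fun v => v.elim
  | node _ c, d => funext fun v => match v with
    | none => rfl
    | some ⟨i, v⟩ => congrFun (push_id E (c i) (fun v => d (some ⟨i, v⟩))) v

theorem Iso.push_comp {k : Type u} [CommRing k] (E : SigmaMod k) :
    ∀ {T T' T'' : RTree} (f : Iso T T') (g : Iso T' T'') (d : Dec E T),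
      (f.comp g).push E d = g.push E (f.push E d)
  | leg, leg, leg, _, _, _ => funext fun v => v.elim
  | leg, leg, node _ _, _, g, _ => g.elim
  | leg, node _ _, _, f, _, _ => f.elim
  | node _ _, leg, _, f, _, _ => f.elim
  | node _ _, node _ _, leg, _, g, _ => g.elim
  | node _ _, node _ _, node _ _, f, g, d => funext fun v => match v with
    | none => rfl
    | some ⟨j, v⟩ => congrFun (push_comp E (f.2 (g.1.symm j)) (g.2 j)
        (fun v => d (some ⟨f.1.symm (g.1.symm j), v⟩))) v

instance finite_vert : ∀ T : RTree, Finite T.Vert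
  | leg => inferInstanceAs (Finite Empty)
  | node I c => by
    have := fun i => finite_vert (c i)
    exact inferInstanceAs (Finite (Option (Σ i : I, (c i).Vert)))

/-! ### Grafting and substitution -/

/-- The corolla with one vertex and the finite set `S` of leaves. -/
abbrev corolla (S : Type) [Finite S] : RTree := node S (fun _ => leg)

/-- Grafting: the root of `s l` is glued to the leaf `l` of `t`. -/
def graft : (t : RTree) → (t.Leaves → RTree) → RTree
  | leg, s => s ()
  | node I c, s => node I (fun i => graft (c i) (fun l => s ⟨i, l⟩))

/-- The leaves of a grafted tree are those of the trees that are grafted onto it. -/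
def graftLeaves : (t : RTree) → (s : t.Leaves → RTree) →
    ((graft t s).Leaves ≃ Σ l : t.Leaves, (s l).Leaves)
  | leg, s => (Equiv.uniqueSigma (fun l : Unit => (s l).Leaves)).symm
  | node I c, s =>
    (Equiv.sigmaCongrRight (fun i => graftLeaves (c i) (fun l => s ⟨i, l⟩))).trans
      (Equiv.sigmaAssoc (fun (i : I) (l : (c i).Leaves) => (s ⟨i, l⟩).Leaves)).symm

/-- The decoration of a grafted tree induced by decorations of its constituents. -/
def graftDec {k : Type u} [CommRing k] {E : SigmaMod k} : (t : RTree) → (s : t.Leaves → RTree) →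
    Dec E t → (∀ l, Dec E (s l)) → Dec E (graft t s)
  | leg, _, _, d' => d' ()
  | node _ c, s, d, d' => fun v => match v with
    | none => d none
    | some ⟨i, v⟩ =>
      graftDec (c i) (fun l => s ⟨i, l⟩) (fun v => d (some ⟨i, v⟩)) (fun l => d' ⟨i, l⟩) v

/-- Substitution: every vertex `v` of `T` is replaced by a tree `t v`, the leaves of which are
labeled by the input edges of `v`. -/
def subst : (T : RTree) → (t : T.Vert → RTree) → (∀ v, (t v).Leaves ≃ T.inputs v) → RTree
  | leg, _, _ => leg
  | node _ c, t, b =>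
    graft (t none) (fun l => subst (c (b none l))
      (fun v => t (some ⟨b none l, v⟩)) (fun v => b (some ⟨b none l, v⟩)))

/-- Substitution does not change the leaves. -/
def substLeaves : (T : RTree) → (t : T.Vert → RTree) → (b : ∀ v, (t v).Leaves ≃ T.inputs v) →
    ((subst T t b).Leaves ≃ T.Leaves)
  | leg, _, _ => Equiv.refl Unit
  | node _ c, t, b =>
    (graftLeaves _ _).trans (Equiv.sigmaCongr (b none) (fun l => substLeaves (c (b none l))
      (fun v => t (some ⟨b none l, v⟩)) (fun v => b (some ⟨b none l, v⟩))))

/-- The vertices of the substituted tree are those of the trees `t v`, and they keep their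
decorations. -/
def substDec {k : Type u} [CommRing k] {E : SigmaMod k} : (T : RTree) → (t : T.Vert → RTree) →
    (b : ∀ v, (t v).Leaves ≃ T.inputs v) → (∀ v, Dec E (t v)) → Dec E (subst T t b)
  | leg, _, _, _ => fun v => v.elim
  | node _ c, t, b, d =>
    graftDec (t none) _ (d none) (fun l => substDec (c (b none l))
      (fun v => t (some ⟨b none l, v⟩)) (fun v => b (some ⟨b none l, v⟩))
      (fun v => d (some ⟨b none l, v⟩)))

theorem nonempty_vert_subst : ∀ (T : RTree) (t : T.Vert → RTree)
    (b : ∀ v, (t v).Leaves ≃ T.inputs v), Nonempty T.Vert → (∀ v, Nonempty (t v).Vert) →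
    Nonempty (subst T t b).Vert
  | leg, _, _, h, _ => h
  | node _ c, t, b, _, h => by
    have key : ∀ (t : RTree) (s : t.Leaves → RTree), Nonempty t.Vert →
        Nonempty (graft t s).Vert := by
      intro t s ht
      cases t with
      | leg => exact ht.elim fun v => v.elim
      | node I c => exact ⟨none⟩
    exact key _ _ (h none)

end RTree

/-- A class of rooted trees that is closed under isomorphism, contains the corollas, and is closed
under substitution. -/
structure TreeClass where
  Mem : RTree → Prop
  mem_iso : ∀ {T T' : RTree}, RTree.Iso T T' → Mem T → Mem T'
  mem_corolla : ∀ n : ℕ, Mem (RTree.corolla (Fin n))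
  mem_subst : ∀ (T : RTree) (t : T.Vert → RTree) (b : ∀ v, (t v).Leaves ≃ T.inputs v),
    Mem T → (∀ v, Mem (t v)) → Mem (T.subst t b)

/-- The trees with at least one vertex, that is all trees but the exceptional one. -/
def ordinaryTrees : TreeClass where
  Mem T := Nonempty T.Vert
  mem_iso f h := h.map f.vert.symm
  mem_corolla _ := ⟨none⟩
  mem_subst := RTree.nonempty_vert_subst

/-- All trees, including the exceptional one. -/
def allTrees : TreeClass where
  Mem _ := True
  mem_iso _ _ := trivial
  mem_corolla _ := trivial
  mem_subst _ _ _ _ _ := trivial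

/-- The category of (leaf-) labeled rooted `n`-trees in a class `P`, and their isomorphisms: it is
`Tree_n` for `ordinaryTrees` and `UTree_n` for `allTrees`. -/
structure LTree (P : TreeClass) (n : ℕ) where
  tree : RTree
  label : tree.Leaves ≃ Fin n
  mem : P.Mem tree

namespace LTree
variable {P : TreeClass} {n : ℕ}

instance : Category (LTree P n) where
  Hom X Y := {f : RTree.Iso X.tree Y.tree // ∀ l, X.label (f.leaves l) = Y.label l}
  id X := ⟨RTree.Iso.id X.tree, fun l => congrArg X.label (RTree.Iso.leaves_id X.tree l)⟩
  comp f g := ⟨f.1.comp g.1, fun l => by rw [RTree.Iso.leaves_comp, f.2, g.2]⟩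
  id_comp f := Subtype.ext (RTree.Iso.id_comp f.1)
  comp_id f := Subtype.ext (RTree.Iso.comp_id f.1)
  assoc f g h := Subtype.ext (RTree.Iso.assoc f.1 g.1 h.1)

/-- Every isomorphism of trees compatible with the labels is invertible in the category. -/
def mkIso {X Y : LTree P n} (f : X ⟶ Y) : X ≅ Y where
  hom := f
  inv := ⟨f.1.symm, fun l => by
    have h := f.2 (f.1.symm.leaves l)
    rw [← RTree.Iso.leaves_comp, RTree.Iso.comp_symm, RTree.Iso.leaves_id] at h
    exact h.symm⟩
  hom_inv_id := Subtype.ext (RTree.Iso.comp_symm f.1)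
  inv_hom_id := Subtype.ext (RTree.Iso.symm_comp f.1)

/-- The symmetric group re-labels the leaves: the leaf with label `σ i` gets the label `i`. -/
def relabel (σ : Equiv.Perm (Fin n)) (X : LTree P n) : LTree P n :=
  ⟨X.tree, X.label.trans σ.symm, X.mem⟩

/-- Re-labeling of morphisms. -/
def relabelHom (σ : Equiv.Perm (Fin n)) {X Y : LTree P n} (f : X ⟶ Y) :
    relabel σ X ⟶ relabel σ Y :=
  ⟨f.1, fun l => congrArg σ.symm (f.2 l)⟩

end LTree

/-! The category of labeled trees is essentially small, so that its colimits exist. -/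

/-- Rooted trees whose vertices have inputs numbered by `Fin m`. -/
inductive NTree : Type
  | leg : NTree
  | node (m : ℕ) (c : Fin m → NTree) : NTree

/-- The underlying rooted tree. -/
def NTree.toRTree : NTree → RTree
  | leg => RTree.leg
  | node m c => RTree.node (Fin m) (fun i => (c i).toRTree)

theorem RTree.exists_iso_toRTree (T : RTree) : ∃ p : NTree, Nonempty (RTree.Iso T p.toRTree) := by
  induction T with
  | leg => exact ⟨NTree.leg, ⟨()⟩⟩
  | node I c ih =>
    choose p hp using ih
    obtain ⟨m, ⟨e⟩⟩ := Finite.exists_equiv_fin I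
    exact ⟨NTree.node m (fun j => p (e.symm j)), ⟨⟨e, fun j => (hp (e.symm j)).some⟩⟩⟩

instance (P : TreeClass) (n : ℕ) : EssentiallySmall.{0} (LTree P n) := by
  rw [essentiallySmall_iff]
  refine ⟨?_, inferInstance⟩
  let S := Σ p : NTree, { _l : p.toRTree.Leaves ≃ Fin n // P.Mem p.toRTree }
  refine small_of_surjective
    (f := fun s : S => toSkeleton (⟨s.1.toRTree, s.2.1, s.2.2⟩ : LTree P n)) ?_
  intro x
  obtain ⟨X, rfl⟩ := Quotient.exists_rep x
  obtain ⟨p, ⟨f⟩⟩ := X.tree.exists_iso_toRTree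
  refine ⟨⟨p, f.leaves.trans X.label, P.mem_iso f X.mem⟩, ?_⟩
  refine Quotient.sound ⟨(LTree.mkIso (Y := ⟨p.toRTree, f.leaves.trans X.label, _⟩)
    ⟨f, fun l => rfl⟩).symm⟩

instance (P : TreeClass) (n : ℕ) (k : Type u) [CommRing k] :
    HasColimitsOfShape (LTree P n) (ModuleCat.{u} k) :=
  hasColimitsOfShape_of_essentiallySmall.{0} (LTree P n) (ModuleCat.{u} k)

/-! ### The endofunctors -/

section
variable {k : Type u} [CommRing k]

theorem treeTensor_map_aux {E : SigmaMod k} {T T' : RTree} (f : RTree.Iso T T')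
    (d : RTree.Dec E T) :
    PiTensorProduct.map (fun v : T'.Vert => E.extMap (f.inputs v))
      (PiTensorProduct.reindex k (fun v : T.Vert => E.ext (T.inputs v)) f.vert.symm
        (PiTensorProduct.tprod k d)) = PiTensorProduct.tprod k (f.push E d) := by
  rw [PiTensorProduct.reindex_tprod, PiTensorProduct.map_tprod]
  rfl

/-- The functor `T ↦ E(T) = ⨂_{v ∈ vert(T)} E(in(v))` on labeled trees. -/
noncomputable def treeTensor (P : TreeClass) (E : SigmaMod k) (n : ℕ) :
    LTree P n ⥤ ModuleCat.{u} k where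
  obj X := ModuleCat.of k (⨂[k] v : X.tree.Vert, E.ext (X.tree.inputs v))
  map {X Y} f := ModuleCat.ofHom
    (PiTensorProduct.map (fun v : Y.tree.Vert => E.extMap (f.1.inputs v)) ∘ₗ
      (PiTensorProduct.reindex k (fun v : X.tree.Vert => E.ext (X.tree.inputs v))
        f.1.vert.symm).toLinearMap)
  map_id X := by
    apply ModuleCat.hom_ext
    apply PiTensorProduct.ext
    ext1 d
    exact (treeTensor_map_aux (RTree.Iso.id X.tree) d).trans
      (congrArg (PiTensorProduct.tprod k) (RTree.Iso.push_id E X.tree d))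
  map_comp {X Y Z} f g := by
    apply ModuleCat.hom_ext
    apply PiTensorProduct.ext
    ext1 d
    refine (treeTensor_map_aux (f.1.comp g.1) d).trans ?_
    rw [RTree.Iso.push_comp]
    refine (treeTensor_map_aux g.1 _).symm.trans ?_
    refine Eq.trans ?_ (congrArg
      (fun z => PiTensorProduct.map (fun v : Z.tree.Vert => E.extMap (g.1.inputs v))
        (PiTensorProduct.reindex k (fun v : Y.tree.Vert => E.ext (Y.tree.inputs v))
          g.1.vert.symm z)) (treeTensor_map_aux f.1 d).symm)
    rfl

/-- `E(T)` is natural in the `Σ`-module `E`. -/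
noncomputable def treeTensorMap (P : TreeClass) {E F : SigmaMod k} (g : E ⟶ F) (n : ℕ) :
    treeTensor P E n ⟶ treeTensor P F n where
  app X := ModuleCat.ofHom
    (PiTensorProduct.map (fun v : X.tree.Vert => SigmaMod.homExt g (X.tree.inputs v)))
  naturality X Y f := by
    apply ModuleCat.hom_ext
    apply PiTensorProduct.ext
    ext1 d
    refine (congrArg (PiTensorProduct.map
      (fun v : Y.tree.Vert => SigmaMod.homExt g (Y.tree.inputs v)))
      (treeTensor_map_aux f.1 d)).trans ?_
    refine Eq.trans ?_ (congrArg
      (fun z => PiTensorProduct.map (fun v : Y.tree.Vert => F.extMap (f.1.inputs v))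
        (PiTensorProduct.reindex k (fun v : X.tree.Vert => F.ext (X.tree.inputs v))
          f.1.vert.symm z)) (PiTensorProduct.map_tprod _ d).symm)
    rw [PiTensorProduct.map_tprod]
    exact (treeTensor_map_aux (E := F) f.1
      (fun v => SigmaMod.homExt g (X.tree.inputs v) (d v))).symm

/-- The re-labeling of the leaves by `σ`, as a cocone. -/
noncomputable def relabelCocone (P : TreeClass) (E : SigmaMod k) {n : ℕ}
    (σ : Equiv.Perm (Fin n)) : Cocone (treeTensor P E n) where
  pt := colimit (treeTensor P E n)
  ι :=
    { app := fun X => colimit.ι (treeTensor P E n) (LTree.relabel σ X)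
      naturality := fun X Y f => by
        have h := colimit.w (treeTensor P E n) (LTree.relabelHom σ f)
        exact h.trans (Category.comp_id _).symm }

/-- The re-labeling of the leaves by `σ`. -/
noncomputable def relabelMap (P : TreeClass) (E : SigmaMod k) {n : ℕ}
    (σ : Equiv.Perm (Fin n)) : colimit (treeTensor P E n) ⟶ colimit (treeTensor P E n) :=
  colimit.desc (treeTensor P E n) (relabelCocone P E σ)

theorem ι_relabelMap (P : TreeClass) (E : SigmaMod k) {n : ℕ} (σ : Equiv.Perm (Fin n))
    (X : LTree P n) : colimit.ι (treeTensor P E n) X ≫ relabelMap P E σ =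
      colimit.ι (treeTensor P E n) (LTree.relabel σ X) :=
  colimit.ι_desc (relabelCocone P E σ) X

/-- The `Σ`-module with components `colim_T E(T)`, where `T` runs over the labeled `n`-trees in the
class `P`. The symmetric group re-labels the leaves. -/
noncomputable def treeModule (P : TreeClass) (E : SigmaMod k) : SigmaMod k where
  obj n := (colimit (treeTensor P E n) : ModuleCat.{u} k)
  act {n} σ := (relabelMap P E σ).hom
  act_one {n} x := by
    have h : relabelMap P E (1 : Equiv.Perm (Fin n)) = 𝟙 _ := by
      apply colimit.hom_ext
      intro X
      rw [ι_relabelMap, Category.comp_id]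
      rfl
    rw [h]
    rfl
  act_mul {n} σ τ x := by
    have h : relabelMap P E (σ * τ) = relabelMap P E σ ≫ relabelMap P E τ := by
      apply colimit.hom_ext
      intro X
      rw [ι_relabelMap, ← Category.assoc, ι_relabelMap]
      exact (ι_relabelMap P E τ (LTree.relabel σ X)).symm
    rw [h]
    rfl

/-- The endofunctor `E ↦ colim_T E(T)` of the category of `Σ`-modules. It is the functor `Ψ` for
`ordinaryTrees` and the functor `Γ` for `allTrees`. -/
noncomputable def treeFunctor (P : TreeClass) (k : Type u) [CommRing k] :
    SigmaMod k ⥤ SigmaMod k where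
  obj E := treeModule P E
  map {E F} g :=
    { app := fun n => (colimMap (treeTensorMap P g n)).hom
      app_act := fun {n} σ x => by
        have h : relabelMap P E σ ≫ colimMap (treeTensorMap P g n) =
            colimMap (treeTensorMap P g n) ≫ relabelMap P F σ := by
          apply colimit.hom_ext
          intro X
          rw [ι_colimMap_assoc, ι_relabelMap, ← Category.assoc, ι_relabelMap]
          exact ι_colimMap (treeTensorMap P g n) (LTree.relabel σ X)
        exact congrArg (fun φ => φ.hom x) h }
  map_id E := by
    apply SigmaMod.hom_ext
    intro n
    have h : colimMap (treeTensorMap P (𝟙 E) n) = 𝟙 _ := by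
      apply colimit.hom_ext
      intro X
      rw [ι_colimMap, Category.comp_id]
      refine Eq.trans ?_ (Category.id_comp _)
      congr 1
      apply ModuleCat.hom_ext
      apply PiTensorProduct.ext
      ext1 d
      exact PiTensorProduct.map_tprod _ d
    exact congrArg (fun φ => φ.hom) h
  map_comp {E F G} f g := by
    apply SigmaMod.hom_ext
    intro n
    have h : colimMap (treeTensorMap P (f ≫ g) n) =
        colimMap (treeTensorMap P f n) ≫ colimMap (treeTensorMap P g n) := by
      apply colimit.hom_ext
      intro X
      rw [ι_colimMap, ι_colimMap_assoc, ι_colimMap, ← Category.assoc]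
      congr 1
      apply ModuleCat.hom_ext
      apply PiTensorProduct.ext
      ext1 d
      refine (PiTensorProduct.map_tprod _ d).trans ?_
      refine Eq.trans ?_ (congrArg (PiTensorProduct.map
        (fun v : X.tree.Vert => SigmaMod.homExt g (X.tree.inputs v)))
        (PiTensorProduct.map_tprod _ d).symm)
      rw [PiTensorProduct.map_tprod]
      rfl
    exact congrArg (fun φ => φ.hom) h

/-- The element of `colim_T E(T)` represented by a labeled tree `X` with decoration `d`. -/
noncomputable def treeElem {P : TreeClass} {E : SigmaMod k} {n : ℕ} (X : LTree P n)
    (d : RTree.Dec E X.tree) : ((treeFunctor P k).obj E).obj n :=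
  (colimit.ι (treeTensor P E n) X).hom (PiTensorProduct.tprod k d)

/-- The element of the value of the `Σ`-module `colim_T E(T)` at a finite set `S` that is
represented by a decorated tree with leaves labeled by `S`: with respect to `e : [n] ≃ S` it is
the tree with labels moved to `[n]` along `e`. -/
noncomputable def treeElemExt {P : TreeClass} {E : SigmaMod k} {S : Type} (t : RTree)
    (ht : P.Mem t) (b : t.Leaves ≃ S) (d : RTree.Dec E t) :
    ((treeFunctor P k).obj E).ext S :=
  ⟨fun _ e => treeElem ⟨t, b.trans e.symm, ht⟩ d, fun n σ e => by
    have h := ι_relabelMap P E σ ⟨t, b.trans e.symm, ht⟩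
    exact (congrArg (fun φ => φ.hom (PiTensorProduct.tprod k d)) h).symm⟩

/-! ### The triples -/

/-- The `n`-corolla, with leaves labeled in the obvious way. -/
def corollaTree (P : TreeClass) (n : ℕ) : LTree P n :=
  ⟨RTree.corolla (Fin n), Equiv.sigmaUnique (Fin n) (fun _ => Unit), P.mem_corolla n⟩

/-- The `n`-corolla with its vertex decorated by `x`. -/
noncomputable def corollaDec {E : SigmaMod k} {n : ℕ} (x : E.obj n) :
    RTree.Dec E (RTree.corolla (Fin n)) :=
  fun v => match v with
    | none => (E.extEquiv (Equiv.refl (Fin n))).symm x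
    | some ⟨_, v⟩ => v.elim

/-- The unit identifies the elements of `E` with decorated corollas. -/
def IsCorollaUnit {P : TreeClass} (η : 𝟭 (SigmaMod k) ⟶ treeFunctor P k) : Prop :=
  ∀ (E : SigmaMod k) (n : ℕ) (x : E.obj n),
    (η.app E).app n x = treeElem (corollaTree P n) (corollaDec x)

/-- The multiplication erases the braces: a tree `X` whose vertices `v` are decorated by
decorated trees `t v` (with leaves labeled by the inputs of `v`) is sent to the decorated tree
obtained by substituting the trees `t v` for the vertices of `X`. -/
def ErasesBraces {P : TreeClass} (μ : treeFunctor P k ⋙ treeFunctor P k ⟶ treeFunctor P k) :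
    Prop :=
  ∀ (E : SigmaMod k) (n : ℕ) (X : LTree P n) (t : X.tree.Vert → RTree) (ht : ∀ v, P.Mem (t v))
    (b : ∀ v, (t v).Leaves ≃ X.tree.inputs v) (d : ∀ v, RTree.Dec E (t v)),
    (μ.app E).app n
        (treeElem (E := (treeFunctor P k).obj E) X (fun v => treeElemExt (t v) (ht v) (b v) (d v))) =
      treeElem ⟨X.tree.subst t b, (X.tree.substLeaves t b).trans X.label,
        P.mem_subst X.tree t b X.mem ht⟩ (X.tree.substDec t b d)

end

/-- The triple on `Σ`-modules given by the trees in the class `P`: the endofunctor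
`E ↦ colim_T E(T)`, with the unit given by decorated corollas and the multiplication that erases
the braces. As `colim_T E(T)` is spanned by decorated trees, `η` and `μ` are determined by these
conditions. -/
structure TreeTriple (P : TreeClass) (k : Type u) [CommRing k] where
  η : 𝟭 (SigmaMod k) ⟶ treeFunctor P k
  μ : treeFunctor P k ⋙ treeFunctor P k ⟶ treeFunctor P k
  isCorollaUnit : IsCorollaUnit η
  erasesBraces : ErasesBraces μ
  assoc : ∀ E : SigmaMod k, (treeFunctor P k).map (μ.app E) ≫ μ.app E =
    μ.app ((treeFunctor P k).obj E) ≫ μ.app E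
  left_unit : ∀ E : SigmaMod k, η.app ((treeFunctor P k).obj E) ≫ μ.app E = 𝟙 _
  right_unit : ∀ E : SigmaMod k, (treeFunctor P k).map (η.app E) ≫ μ.app E = 𝟙 _

/-- The underlying monad of a tree triple. -/
noncomputable def TreeTriple.monad {P : TreeClass} {k : Type u} [CommRing k]
    (T : TreeTriple P k) : Monad (SigmaMod k) where
  toFunctor := treeFunctor P k
  η := T.η
  μ := T.μ
  assoc := T.assoc
  left_unit := T.left_unit
  right_unit := T.right_unit

/-! ### Operads -/

/-- For `m + n = p + 1` and a position `i`, the positions of `f ∘_i g`, where `f` has `m` and `g`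
has `n` inputs: inputs of `f` before `i`, then the inputs of `g`, then the inputs of `f` after
`i`. -/
def blockFun {m n p : ℕ} (h : m + n = p + 1) (i : Fin m) : {j : Fin m // j ≠ i} ⊕ Fin n → Fin p
  | Sum.inl j =>
    if hj : j.1.1 < i.1 then ⟨j.1.1, by omega⟩
    else ⟨j.1.1 + n - 1, by
      have h1 : j.1.1 ≠ i.1 := fun h => j.2 (Fin.ext h)
      have h2 := j.1.2
      omega⟩
  | Sum.inr l => ⟨i.1 + l.1, by omega⟩

theorem blockFun_bijective {m n p : ℕ} (h : m + n = p + 1) (i : Fin m) :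
    Function.Bijective (blockFun h i) := by
  rw [Fintype.bijective_iff_injective_and_card]
  constructor
  · rintro (⟨j, hj⟩ | l) (⟨j', hj'⟩ | l') hh
    · have h1 : j.1 ≠ i.1 := fun h => hj (Fin.ext h)
      have h2 : j'.1 ≠ i.1 := fun h => hj' (Fin.ext h)
      have : j = j' := by
        apply Fin.ext
        simp only [blockFun] at hh
        split_ifs at hh <;> simp only [Fin.mk.injEq] at hh <;> omega
      subst this
      rfl
    · have h1 : j.1 ≠ i.1 := fun h => hj (Fin.ext h)
      simp only [blockFun] at hh
      split_ifs at hh <;> simp only [Fin.mk.injEq] at hh <;> omega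
    · have h1 : j'.1 ≠ i.1 := fun h => hj' (Fin.ext h)
      simp only [blockFun] at hh
      split_ifs at hh <;> simp only [Fin.mk.injEq] at hh <;> omega
    · simp only [blockFun, Fin.mk.injEq] at hh
      congr 1
      apply Fin.ext
      omega
  · rw [Fintype.card_sum, Fintype.card_subtype_compl, Fintype.card_fin, Fintype.card_fin,
      Fintype.card_fin, Fintype.card_subtype_eq]
    have := i.2
    omega

/-- `blockFun` as a bijection. -/
noncomputable def blockEquiv {m n p : ℕ} (h : m + n = p + 1) (i : Fin m) :
    {j : Fin m // j ≠ i} ⊕ Fin n ≃ Fin p :=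
  Equiv.ofBijective _ (blockFun_bijective h i)

/-- The permutation `τ ∘_i σ`, given by inserting `σ` at the `i`-th place of `τ`. -/
noncomputable def insertPerm {m n p : ℕ} (h : m + n = p + 1) (i : Fin m)
    (τ : Equiv.Perm (Fin m)) (σ : Equiv.Perm (Fin n)) : Equiv.Perm (Fin p) :=
  (blockEquiv h i).symm.trans
    ((Equiv.sumCongr (τ.subtypeEquiv (fun j => (τ.injective.ne_iff (x := j) (y := i)).symm)) σ).trans
      (blockEquiv h (τ i)))

/-- Non-unital (Markl's) operads: `Σ`-modules with compositions
`∘_i : S(m) ⊗ S(n) → S(m + n - 1)`, written here as bilinear maps into `S(p)`, where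
`m + n = p + 1`. The positions `i` are counted from `0`. -/
structure NonunitalOperad (k : Type u) [CommRing k] extends SigmaMod k where
  circ : ∀ {m n p : ℕ}, m + n = p + 1 → Fin m → obj m →ₗ[k] obj n →ₗ[k] obj p
  assoc_before : ∀ {a b c p q r : ℕ} (hab : a + b = p + 1) (hpc : p + c = q + 1)
    (hac : a + c = r + 1) (hrb : r + b = q + 1) (j : Fin a) (i : ℕ) (hi : i < j.1)
    (f : obj a) (g : obj b) (h : obj c),
    circ hpc ⟨i, by omega⟩ (circ hab j f g) h =
      circ hrb ⟨j.1 + c - 1, by omega⟩ (circ hac ⟨i, by omega⟩ f h) g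
  assoc_inside : ∀ {a b c p q s : ℕ} (hab : a + b = p + 1) (hpc : p + c = q + 1)
    (hbc : b + c = s + 1) (has : a + s = q + 1) (j : Fin a) (i : ℕ) (_hi : j.1 ≤ i)
    (hi' : i < j.1 + b) (f : obj a) (g : obj b) (h : obj c),
    circ hpc ⟨i, by omega⟩ (circ hab j f g) h =
      circ has j f (circ hbc ⟨i - j.1, by omega⟩ g h)
  assoc_after : ∀ {a b c p q r : ℕ} (hab : a + b = p + 1) (hpc : p + c = q + 1)
    (hac : a + c = r + 1) (hrb : r + b = q + 1) (j : Fin a) (i : ℕ) (hi : j.1 + b ≤ i)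
    (hi' : i < p) (f : obj a) (g : obj b) (h : obj c),
    circ hpc ⟨i, hi'⟩ (circ hab j f g) h =
      circ hrb ⟨j.1, by omega⟩ (circ hac ⟨i + 1 - b, by omega⟩ f h) g
  equivariance : ∀ {m n p : ℕ} (hmn : m + n = p + 1) (i : Fin m) (τ : Equiv.Perm (Fin m))
    (σ : Equiv.Perm (Fin n)) (f : obj m) (g : obj n),
    circ hmn i (act τ f) (act σ g) = act (insertPerm hmn i τ σ) (circ hmn (τ i) f g)

/-- (Unital) operads, in the form of Markl: non-unital operads with a unit `e ∈ S(1)`. -/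
structure Operad (k : Type u) [CommRing k] extends NonunitalOperad k where
  unit : obj 1
  circ_unit : ∀ {m : ℕ} (i : Fin m) (f : obj m), circ (m := m) (n := 1) rfl i f unit = f
  unit_circ : ∀ {n : ℕ} (g : obj n), circ (Nat.add_comm 1 n) 0 unit g = g

section
variable {k : Type u} [CommRing k]

/-- Morphisms of non-unital operads are the morphisms of `Σ`-modules that commute with the
compositions. -/
@[ext]
structure NonunitalOperad.Hom (S R : NonunitalOperad k) where
  hom : S.toSigmaMod ⟶ R.toSigmaMod
  map_circ : ∀ {m n p : ℕ} (h : m + n = p + 1) (i : Fin m) (f : S.obj m) (g : S.obj n),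
    hom.app p (S.circ h i f g) = R.circ h i (hom.app m f) (hom.app n g)

instance : Category (NonunitalOperad k) where
  Hom S R := NonunitalOperad.Hom S R
  id S := ⟨𝟙 S.toSigmaMod, fun _ _ _ _ => rfl⟩
  comp f g := ⟨f.hom ≫ g.hom, fun h i x y =>
    (congrArg (g.hom.app _) (f.map_circ h i x y)).trans (g.map_circ h i _ _)⟩

/-- Morphisms of operads also preserve the units. -/
@[ext]
structure Operad.Hom (S R : Operad k) where
  hom : S.toNonunitalOperad ⟶ R.toNonunitalOperad
  map_unit : hom.hom.app 1 S.unit = R.unit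

instance : Category (Operad k) where
  Hom S R := Operad.Hom S R
  id S := ⟨𝟙 S.toNonunitalOperad, rfl⟩
  comp f g := ⟨f.hom ≫ g.hom, (congrArg (g.hom.hom.app 1) f.map_unit).trans g.map_unit⟩

end

/-- The forgetful functor from non-unital operads to `Σ`-modules. -/
def NonunitalOperad.forget (k : Type u) [CommRing k] : NonunitalOperad k ⥤ SigmaMod k where
  obj S := S.toSigmaMod
  map f := f.hom

/-- The forgetful functor from operads to `Σ`-modules. -/
def Operad.forget (k : Type u) [CommRing k] : Operad k ⥤ SigmaMod k where
  obj S := S.toSigmaMod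
  map f := f.hom.hom

/-- Two categories over `C` are isomorphic over `C`: there are mutually inverse functors between
them that commute with the functors to `C`. -/
def IsomorphicOver {A B C : Type*} [Category A] [Category B] [Category C]
    (U : A ⥤ C) (V : B ⥤ C) : Prop :=
  ∃ (F : A ⥤ B) (G : B ⥤ A), F ⋙ G = 𝟭 A ∧ G ⋙ F = 𝟭 B ∧ F ⋙ V = U ∧ G ⋙ U = V

end TreeOperads

namespace TreeOperads

/-! ### Values of Sigma-modules at finite sets -/

section
variable {k : Type u} [CommRing k]

/-! A decorated tree is a formal composite of operations, and an operad is a Σ-module in which such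
composites have values. Write Γ for the tree functor of a class `P`; both classes are treated
together. The central construction is the evaluation `ev` of a tree decorated by operations of a
non-unital operad, with a prescribed value `e` for the exceptional tree.

Equivariance is what allows the compositions to be written for operations with arbitrary finite sets
of inputs (`compAt`), without numberings. The associativity axioms then say that compositions at
different inputs commute (`compAt_parallel`) and that nested compositions associate
(`compAt_nested`). Hence plugging operations into several inputs does not depend on the order
(`gamma_perm`), and `ev` can be defined by recursion on the tree. Only subtrees with a vertex are
plugged in, so no unit is needed. The result is invariant under isomorphisms (`ev_push`) and linear
at each vertex (`ev_linear`), so it descends to the colimit as `evHom`.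

Conversely Γ(E) is itself an operad under grafting (`freeOperad`). Its axioms are checked on
concrete decorated trees `DTree`, where grafting is the bind of a monad and the axioms become
equalities of trees. The evaluation Γ(S) → S respects compositions (`evHom_freeCirc`): for two trees
with vertices this is `evD_bind_single`, and the exceptional tree is covered by `UnitLaws`, under
which `e` is a unit if that tree belongs to `P` and zero otherwise.

The multiplication of the monad is the evaluation in the free operad, and `ev_cl` identifies it with
substitution of trees. Evaluation is natural for operad morphisms (`map_evHom`). Applied to the
multiplication, which is such a morphism, this is the associativity law. The unit laws say that a
corolla evaluates to its decoration and that substituting corollas changes nothing.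

For an algebra α, put f ∘_i g = α(ηf ∘_i ηg). The algebra laws make α compatible with grafting
(`algCirc_app`), so the operad axioms are images of those of Γ(A). An operad is made into an algebra
by evaluation. That α is recovered is naturality of evaluation along α (`evHom_algOperad`); that the
compositions are recovered is the multiplicativity of evaluation on corollas. -/

theorem SigmaMod.ext_inj (E : SigmaMod k) {S : Type} {n : ℕ} (e : Fin n ≃ S) {φ ψ : E.ext S}
    (h : φ.1 n e = ψ.1 n e) : φ = ψ :=
  (E.ext_eval_bijective e).1 h

theorem SigmaMod.extMap_apply (E : SigmaMod k) {S S' : Type} (f : S ≃ S') (φ : E.ext S) (n : ℕ)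
    (e : Fin n ≃ S') : (E.extMap f φ).1 n e = φ.1 n (e.trans f.symm) := rfl

theorem SigmaMod.extMap_extMap (E : SigmaMod k) {S S' S'' : Type} (f : S ≃ S') (g : S' ≃ S'')
    (φ : E.ext S) : E.extMap g (E.extMap f φ) = E.extMap (f.trans g) φ := rfl

theorem SigmaMod.extMap_refl (E : SigmaMod k) {S : Type} (φ : E.ext S) :
    E.extMap (Equiv.refl S) φ = φ := rfl

theorem SigmaMod.extMap_id (E : SigmaMod k) {S : Type} (f : S ≃ S) (hf : ∀ s, f s = s)
    (φ : E.ext S) : E.extMap f φ = φ := by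
  obtain rfl : f = Equiv.refl S := Equiv.ext hf
  rfl

theorem SigmaMod.extEquiv_symm_apply (E : SigmaMod k) {S : Type} {n : ℕ} (e : Fin n ≃ S)
    (x : E.obj n) : ((E.extEquiv e).symm x).1 n e = x :=
  (E.extEquiv e).apply_symm_apply x

theorem SigmaMod.homExt_apply {E F : SigmaMod k} (g : E ⟶ F) {S : Type} (φ : E.ext S) (n : ℕ)
    (e : Fin n ≃ S) : (SigmaMod.homExt g S φ).1 n e = g.app n (φ.1 n e) := rfl

theorem SigmaMod.homExt_extMap {E F : SigmaMod k} (g : E ⟶ F) {S S' : Type} (f : S ≃ S')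
    (φ : E.ext S) : SigmaMod.homExt g S' (E.extMap f φ) = F.extMap f (SigmaMod.homExt g S φ) :=
  rfl

/-! ### Positions in partial compositions -/

theorem blockEquiv_symm_blockFun {m n p : ℕ} (h : m + n = p + 1) (i : Fin m)
    (s : {j : Fin m // j ≠ i} ⊕ Fin n) : (blockEquiv h i).symm (blockFun h i s) = s :=
  (Equiv.symm_apply_eq _).2 rfl

theorem blockFun_inl_val {m n p : ℕ} (h : m + n = p + 1) (i : Fin m) (j : Fin m) (hj : j ≠ i) :
    j.1 < i.1 ∧ (blockFun h i (Sum.inl ⟨j, hj⟩)).1 = j.1 ∨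
      i.1 < j.1 ∧ (blockFun h i (Sum.inl ⟨j, hj⟩)).1 = j.1 + n - 1 := by
  have := Fin.val_ne_of_ne hj
  simp only [blockFun]
  split_ifs
  · exact Or.inl ⟨‹_›, rfl⟩
  · exact Or.inr ⟨by omega, rfl⟩

theorem blockFun_inr_val {m n p : ℕ} (h : m + n = p + 1) (i : Fin m) (l : Fin n) :
    (blockFun h i (Sum.inr l)).1 = i.1 + l.1 := rfl

theorem insertPerm_inl {m n p : ℕ} (h : m + n = p + 1) (i : Fin m) (τ : Equiv.Perm (Fin m))
    (σ : Equiv.Perm (Fin n)) (j : Fin m) (hj : j ≠ i) :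
    insertPerm h i τ σ (blockFun h i (Sum.inl ⟨j, hj⟩)) =
      blockFun h (τ i) (Sum.inl ⟨τ j, τ.injective.ne hj⟩) := by
  simp only [insertPerm, Equiv.trans_apply, blockEquiv_symm_blockFun]
  rfl

theorem insertPerm_inr {m n p : ℕ} (h : m + n = p + 1) (i : Fin m) (τ : Equiv.Perm (Fin m))
    (σ : Equiv.Perm (Fin n)) (l : Fin n) :
    insertPerm h i τ σ (blockFun h i (Sum.inr l)) = blockFun h (τ i) (Sum.inr (σ l)) := by
  simp only [insertPerm, Equiv.trans_apply, blockEquiv_symm_blockFun]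
  rfl

theorem blockFun_inl_of_lt {m n p : ℕ} (h : m + n = p + 1) {i j : Fin m} (hj : j ≠ i)
    (hji : j.1 < i.1) : (blockFun h i (Sum.inl ⟨j, hj⟩)).1 = j.1 := by
  simp [blockFun, hji]

theorem blockFun_inl_of_gt {m n p : ℕ} (h : m + n = p + 1) {i j : Fin m} (hj : j ≠ i)
    (hji : i.1 < j.1) : (blockFun h i (Sum.inl ⟨j, hj⟩)).1 = j.1 + n - 1 := by
  simp [blockFun, Nat.not_lt.2 hji.le]

theorem blockFun_injective {m n p : ℕ} (h : m + n = p + 1) (i : Fin m) :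
    Function.Injective (blockFun h i) := (blockFun_bijective h i).1

/-! ### Positions for compositions at two different inputs. -/

section before
variable {a b c p q r : ℕ} (hab : a + b = p + 1) (hpc : p + c = q + 1)
    (hac : a + c = r + 1) (hrb : r + b = q + 1) {j i : Fin a} {i₁ : Fin p} {j₁ : Fin r}

/-- Every input lies before or after each insertion point, so the equation is a case distinction in
linear arithmetic. The positions `i₁` and `j₁` are prescribed through their values only, so that the
proofs of their bounds do not matter in applications. -/
theorem blockFun_before_left (hi : i.1 < j.1) (hi₁ : i₁.1 = i.1) (hj₁ : j₁.1 = j.1 + c - 1)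
    (x : Fin a) (hxj : x ≠ j) (hxi : x ≠ i) (h₁ h₂) :
    blockFun hpc i₁ (Sum.inl ⟨blockFun hab j (Sum.inl ⟨x, hxj⟩), h₁⟩) =
      blockFun hrb j₁ (Sum.inl ⟨blockFun hac i (Sum.inl ⟨x, hxi⟩), h₂⟩) := by
  have e₁ := blockFun_inl_val hab j x hxj
  have e₂ := blockFun_inl_val hac i x hxi
  have e₃ := blockFun_inl_val hpc i₁ _ h₁
  have e₄ := blockFun_inl_val hrb j₁ _ h₂
  apply Fin.ext
  omega

theorem blockFun_before_mid (hi : i.1 < j.1) (hi₁ : i₁.1 = i.1) (hj₁ : j₁.1 = j.1 + c - 1)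
    (l : Fin b) (h₁) :
    blockFun hpc i₁ (Sum.inl ⟨blockFun hab j (Sum.inr l), h₁⟩) =
      blockFun hrb j₁ (Sum.inr l) := by
  have e₁ := blockFun_inr_val hab j l
  have e₂ := blockFun_inr_val hrb j₁ l
  have e₃ := blockFun_inl_val hpc i₁ _ h₁
  apply Fin.ext
  omega

theorem blockFun_before_right (hi : i.1 < j.1) (hi₁ : i₁.1 = i.1) (hj₁ : j₁.1 = j.1 + c - 1)
    (l : Fin c) (h₁) :
    blockFun hpc i₁ (Sum.inr l) =
      blockFun hrb j₁ (Sum.inl ⟨blockFun hac i (Sum.inr l), h₁⟩) := by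
  have e₁ := blockFun_inr_val hac i l
  have e₂ := blockFun_inr_val hpc i₁ l
  have e₃ := blockFun_inl_val hrb j₁ _ h₁
  apply Fin.ext
  omega

end before

/-! ### Positions for nested compositions. -/

section inside
variable {a b c p q s : ℕ} (hab : a + b = p + 1) (hpc : p + c = q + 1)
    (hbc : b + c = s + 1) (has : a + s = q + 1) {j : Fin a} {i : Fin b} {i₁ : Fin p}

theorem blockFun_inside_left (hi₁ : i₁.1 = j.1 + i.1) (x : Fin a) (hxj : x ≠ j) (h₁) :
    blockFun hpc i₁ (Sum.inl ⟨blockFun hab j (Sum.inl ⟨x, hxj⟩), h₁⟩) =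
      blockFun has j (Sum.inl ⟨x, hxj⟩) := by
  have e₁ := blockFun_inl_val hab j x hxj
  have e₂ := blockFun_inl_val has j x hxj
  have e₃ := blockFun_inl_val hpc i₁ _ h₁
  have := i.2
  apply Fin.ext
  omega

theorem blockFun_inside_mid (hi₁ : i₁.1 = j.1 + i.1) (l : Fin b) (hl : l ≠ i) (h₁) :
    blockFun hpc i₁ (Sum.inl ⟨blockFun hab j (Sum.inr l), h₁⟩) =
      blockFun has j (Sum.inr (blockFun hbc i (Sum.inl ⟨l, hl⟩))) := by
  have e₁ := blockFun_inr_val hab j l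
  have e₂ := blockFun_inl_val hbc i l hl
  have e₃ := blockFun_inl_val hpc i₁ _ h₁
  have e₄ := blockFun_inr_val has j (blockFun hbc i (Sum.inl ⟨l, hl⟩))
  apply Fin.ext
  omega

theorem blockFun_inside_right (hi₁ : i₁.1 = j.1 + i.1) (l : Fin c) :
    blockFun hpc i₁ (Sum.inr l) =
      blockFun has j (Sum.inr (blockFun hbc i (Sum.inr l))) := by
  have e₁ := blockFun_inr_val hpc i₁ l
  have e₂ := blockFun_inr_val hbc i l
  have e₃ := blockFun_inr_val has j (blockFun hbc i (Sum.inr l))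
  apply Fin.ext
  omega

end inside

/-! ### Partial compositions indexed by finite sets -/

/-- Given numberings of `X` and `J`, the induced numbering of `Y ≃ (X ∖ i) ⊔ J`. -/
noncomputable def blockLabel {X J Y : Type} {m n p : ℕ} (h : m + n = p + 1) (a : Fin m ≃ X)
    (b : Fin n ≃ J) (i : X) (e : {x : X // x ≠ i} ⊕ J ≃ Y) : Fin p ≃ Y :=
  ((blockEquiv h (a.symm i)).symm.trans (Equiv.sumCongr
    (a.subtypeEquiv (fun j => by rw [ne_eq, ne_eq, Equiv.eq_symm_apply])) b)).trans e

/-- The position is a variable `i'` with `a i' = i` instead of `a.symm i`, so that the lemma applies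
when the position is only known through arithmetic. -/
theorem blockLabel_inl {X J Y : Type} {m n p : ℕ} (h : m + n = p + 1) (a : Fin m ≃ X)
    (b : Fin n ≃ J) {i : X} (e : {x : X // x ≠ i} ⊕ J ≃ Y) (i' : Fin m) (hi : a i' = i)
    (j : Fin m) (hj : j ≠ i') (hj' : a j ≠ i) :
    blockLabel h a b i e (blockFun h i' (Sum.inl ⟨j, hj⟩)) = e (Sum.inl ⟨a j, hj'⟩) := by
  obtain rfl : i' = a.symm i := by simp [← hi]
  simp only [blockLabel, Equiv.trans_apply, blockEquiv_symm_blockFun]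
  rfl

theorem blockLabel_inr {X J Y : Type} {m n p : ℕ} (h : m + n = p + 1) (a : Fin m ≃ X)
    (b : Fin n ≃ J) {i : X} (e : {x : X // x ≠ i} ⊕ J ≃ Y) (i' : Fin m) (hi : a i' = i)
    (l : Fin n) : blockLabel h a b i e (blockFun h i' (Sum.inr l)) = e (Sum.inr (b l)) := by
  obtain rfl : i' = a.symm i := by simp [← hi]
  simp only [blockLabel, Equiv.trans_apply, blockEquiv_symm_blockFun]
  rfl

theorem equiv_ext_blockFun {Y : Type} {m n p : ℕ} (h : m + n = p + 1) (i : Fin m)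
    {w w' : Fin p ≃ Y}
    (h₁ : ∀ j hj, w (blockFun h i (Sum.inl ⟨j, hj⟩)) = w' (blockFun h i (Sum.inl ⟨j, hj⟩)))
    (h₂ : ∀ l, w (blockFun h i (Sum.inr l)) = w' (blockFun h i (Sum.inr l))) : w = w' := by
  ext t
  obtain ⟨s, rfl⟩ := (blockFun_bijective h i).2 t
  rcases s with ⟨j, hj⟩ | l
  · exact h₁ j hj
  · exact h₂ l

theorem card_add_card_eq {X J : Type} [Finite X] (i : X) :
    Nat.card X + Nat.card J = (Nat.card X + Nat.card J - 1) + 1 := by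
  have : 0 < Nat.card X := Nat.card_pos_iff.2 ⟨⟨i⟩, inferInstance⟩
  omega

/-- The partial composition of an element of `S(X)` with an element of `S(J)` at `i ∈ X`, where
the result is labeled by `Y ≃ (X ∖ i) ⊔ J`. -/
noncomputable def NonunitalOperad.compAt (S : NonunitalOperad k) {X J Y : Type} [Finite X]
    [Finite J] (i : X) (e : {x : X // x ≠ i} ⊕ J ≃ Y) :
    S.ext X →ₗ[k] S.ext J →ₗ[k] S.ext Y :=
  ((S.circ (card_add_card_eq (J := J) i) ((Finite.equivFin X) i)).compr₂
    (S.extEquiv (blockLabel (card_add_card_eq (J := J) i) (Finite.equivFin X).symm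
      (Finite.equivFin J).symm i e)).symm.toLinearMap).compl₁₂
    (S.extEquiv (Finite.equivFin X).symm).toLinearMap
    (S.extEquiv (Finite.equivFin J).symm).toLinearMap

/-- The numberings chosen in the definition of `compAt` are irrelevant: this is the equivariance
axiom, since other numberings of `X` and `J` differ from the chosen ones by permutations. -/
theorem NonunitalOperad.compAt_apply_blockLabel (S : NonunitalOperad k) {X J Y : Type} [Finite X]
    [Finite J] {i : X} (e : {x : X // x ≠ i} ⊕ J ≃ Y) (x : S.ext X) (y : S.ext J) {m n p : ℕ}
    (h : m + n = p + 1) (a : Fin m ≃ X) (b : Fin n ≃ J) (i' : Fin m) (hi : a i' = i) :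
    (S.compAt i e x y).1 p (blockLabel h a b i e) = S.circ h i' (x.1 m a) (y.1 n b) := by
  obtain rfl : m = Nat.card X := Fin.equiv_iff_eq.1 ⟨a.trans (Finite.equivFin X)⟩
  obtain rfl : n = Nat.card J := Fin.equiv_iff_eq.1 ⟨b.trans (Finite.equivFin J)⟩
  obtain rfl : p = Nat.card X + Nat.card J - 1 := by omega
  set a₀ := (Finite.equivFin X).symm with ha₀
  set b₀ := (Finite.equivFin J).symm with hb₀
  have hx : x.1 _ a = S.act (a.trans a₀.symm) (x.1 _ a₀) := by
    rw [← x.2, Equiv.trans_assoc, Equiv.symm_trans_self, Equiv.trans_refl]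
  have hy : y.1 _ b = S.act (b.trans b₀.symm) (y.1 _ b₀) := by
    rw [← y.2, Equiv.trans_assoc, Equiv.symm_trans_self, Equiv.trans_refl]
  -- If the numberings of `X` and `J` change by τ and σ, the induced numbering of `Y` changes by τ
  -- ∘_i σ.
  have hw : blockLabel h a b i e = (insertPerm h i' (a.trans a₀.symm) (b.trans b₀.symm)).trans
      (blockLabel h a₀ b₀ i e) := by
    apply equiv_ext_blockFun h i'
    · intro j hj
      have hj' : a j ≠ i := fun h => hj (a.injective (h.trans hi.symm))
      rw [blockLabel_inl h a b e i' hi j hj hj', Equiv.trans_apply, insertPerm_inl,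
        blockLabel_inl h a₀ b₀ e _ (by simp [hi]) _ _ (by simpa using hj')]
      simp
    · intro l
      rw [blockLabel_inr h a b e i' hi, Equiv.trans_apply, insertPerm_inr,
        blockLabel_inr h a₀ b₀ e _ (by simp [hi])]
      simp
  rw [hx, hy, S.equivariance, hw, (S.compAt i e x y).2]
  congr 1
  refine (S.extEquiv_symm_apply _ _).trans ?_
  simp only [Equiv.trans_apply, hi]
  rfl

/-- The numbering `w` of the result is characterised by its values on the two blocks, which is
easier to verify than an equality with `blockLabel`. -/
theorem NonunitalOperad.compAt_apply (S : NonunitalOperad k) {X J Y : Type} [Finite X]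
    [Finite J] {i : X} (e : {x : X // x ≠ i} ⊕ J ≃ Y) (x : S.ext X) (y : S.ext J) {m n p : ℕ}
    (h : m + n = p + 1) (a : Fin m ≃ X) (b : Fin n ≃ J) (i' : Fin m) (hi : a i' = i)
    (w : Fin p ≃ Y)
    (h₁ : ∀ j hj hj', w (blockFun h i' (Sum.inl ⟨j, hj⟩)) = e (Sum.inl ⟨a j, hj'⟩))
    (h₂ : ∀ l, w (blockFun h i' (Sum.inr l)) = e (Sum.inr (b l))) :
    (S.compAt i e x y).1 p w = S.circ h i' (x.1 m a) (y.1 n b) := by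
  rw [← S.compAt_apply_blockLabel e x y h a b i' hi]
  refine congrArg _ ?_
  apply equiv_ext_blockFun h i'
  · intro j hj
    have hj' : a j ≠ i := fun h => hj (a.injective (h.trans hi.symm))
    rw [h₁ j hj hj', blockLabel_inl h a b e i' hi j hj hj']
  · intro l
    rw [h₂, blockLabel_inr h a b e i' hi]

/-- Numberings can be transported along `f`, `g` and `φ`; with these, both sides are given by the
same partial composition of the same two elements. -/
theorem NonunitalOperad.compAt_congr (S : NonunitalOperad k) {X J Y X' J' Y' : Type} [Finite X]
    [Finite J] [Finite X'] [Finite J'] {i : X} {e : {x : X // x ≠ i} ⊕ J ≃ Y} {i' : X'}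
    {e' : {x : X' // x ≠ i'} ⊕ J' ≃ Y'} (f : X ≃ X') (g : J ≃ J') (φ : Y ≃ Y') (hi : f i = i')
    (h₁ : ∀ x hx hx', e' (Sum.inl ⟨f x, hx'⟩) = φ (e (Sum.inl ⟨x, hx⟩)))
    (h₂ : ∀ j, e' (Sum.inr (g j)) = φ (e (Sum.inr j))) (x : S.ext X) (y : S.ext J) :
    S.compAt i' e' (S.extMap f x) (S.extMap g y) = S.extMap φ (S.compAt i e x y) := by
  have a := (Finite.equivFin X).symm
  have b := (Finite.equivFin J).symm
  have h := card_add_card_eq (J := J) i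
  apply S.ext_inj ((blockLabel h a b i e).trans φ)
  rw [SigmaMod.extMap_apply, S.compAt_apply e' _ _ h (a.trans f) (b.trans g) (a.symm i) (by simp [hi])]
  · have : ((blockLabel h a b i e).trans φ).trans φ.symm = blockLabel h a b i e := by ext; simp
    rw [this, S.compAt_apply_blockLabel e x y h a b (a.symm i) (by simp)]
    simp only [SigmaMod.extMap_apply, Equiv.trans_assoc, Equiv.self_trans_symm, Equiv.trans_refl]
  · intro j hj hj'
    have : a j ≠ i := fun h => hj (by simp [← h])
    rw [Equiv.trans_apply, blockLabel_inl h a b e (a.symm i) (by simp) j hj this, ← h₁]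
    rfl
  · intro l
    rw [Equiv.trans_apply, blockLabel_inr h a b e (a.symm i) (by simp), ← h₂]
    rfl

theorem NonunitalOperad.extMap_compAt (S : NonunitalOperad k) {X J Y Y' : Type} [Finite X]
    [Finite J] {i : X} (e : {x : X // x ≠ i} ⊕ J ≃ Y) (φ : Y ≃ Y') (x : S.ext X) (y : S.ext J) :
    S.extMap φ (S.compAt i e x y) = S.compAt i (e.trans φ) x y :=
  (S.compAt_congr (Equiv.refl X) (Equiv.refl J) φ rfl (fun _ _ _ => rfl) (fun _ => rfl) x y).symm

/-- Numbering `X` so that `i₂` precedes `i₁` turns the identity into `assoc_before`. The hypotheses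
on `e₁`, `e₂`, `f₁`, `f₂` say that both orders label `Z` by the inputs in `X` other than `i₁`, `i₂`,
together with `J` and `L`, in the same way. -/
theorem NonunitalOperad.compAt_parallel_of_lt (S : NonunitalOperad k) {X J L Y₁ Y₂ Z : Type}
    [Finite X] [Finite J] [Finite L] [Finite Y₁] [Finite Y₂] {i₁ i₂ : X}
    (e₁ : {x : X // x ≠ i₁} ⊕ J ≃ Y₁) (e₂ : {x : X // x ≠ i₂} ⊕ L ≃ Y₂) {k₁ : Y₁} {k₂ : Y₂}
    (f₁ : {y : Y₁ // y ≠ k₁} ⊕ L ≃ Z) (f₂ : {y : Y₂ // y ≠ k₂} ⊕ J ≃ Z)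
    (hk₁ : ∀ h, e₁ (Sum.inl ⟨i₂, h⟩) = k₁) (hk₂ : ∀ h, e₂ (Sum.inl ⟨i₁, h⟩) = k₂)
    (h₀ : ∀ x hx₁ hx₂ h h', f₁ (Sum.inl ⟨e₁ (Sum.inl ⟨x, hx₁⟩), h⟩) =
      f₂ (Sum.inl ⟨e₂ (Sum.inl ⟨x, hx₂⟩), h'⟩))
    (h₁ : ∀ j h, f₁ (Sum.inl ⟨e₁ (Sum.inr j), h⟩) = f₂ (Sum.inr j))
    (h₂ : ∀ l h, f₁ (Sum.inr l) = f₂ (Sum.inl ⟨e₂ (Sum.inr l), h⟩))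
    (x : S.ext X) (y : S.ext J) (z : S.ext L) {m : ℕ} (a : Fin m ≃ X)
    (hlt : (a.symm i₂).1 < (a.symm i₁).1) :
    S.compAt k₁ f₁ (S.compAt i₁ e₁ x y) z = S.compAt k₂ f₂ (S.compAt i₂ e₂ x z) y := by
  obtain ⟨b, ⟨B⟩⟩ := Finite.exists_equiv_fin J
  obtain ⟨c, ⟨C⟩⟩ := Finite.exists_equiv_fin L
  replace B := B.symm
  replace C := C.symm
  obtain ⟨j, rfl⟩ := a.surjective i₁
  obtain ⟨i, rfl⟩ := a.surjective i₂
  simp only [Equiv.symm_apply_apply] at hlt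
  have hij : i ≠ j := fun h => by simp [h] at hlt
  obtain ⟨p, hab⟩ : ∃ p, m + b = p + 1 := ⟨m + b - 1, by have := j.2; omega⟩
  obtain ⟨q, hpc⟩ : ∃ q, p + c = q + 1 := ⟨p + c - 1, by have := j.2; omega⟩
  obtain ⟨r, hac⟩ : ∃ r, m + c = r + 1 := ⟨m + c - 1, by have := j.2; omega⟩
  have hrb : r + b = q + 1 := by omega
  -- The input `i₂` keeps its position, as it lies before the insertion; below, `i₁` is shifted by
  -- `c - 1`, as it lies after the insertion of `c` inputs in place of one.
  have hP₁ : blockLabel hab a B (a j) e₁ ⟨i.1, by omega⟩ = k₁ := by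
    rw [← hk₁ (a.injective.ne hij), ← blockLabel_inl hab a B e₁ j rfl i hij]
    congr 1
    exact Fin.ext (blockFun_inl_of_lt hab hij hlt).symm
  have hP₂ : blockLabel hac a C (a i) e₂ ⟨j.1 + c - 1, by omega⟩ = k₂ := by
    rw [← hk₂ (a.injective.ne hij.symm), ← blockLabel_inl hac a C e₂ i rfl j hij.symm]
    congr 1
    exact Fin.ext (blockFun_inl_of_gt hac hij.symm hlt).symm
  -- Both sides are compared at the numbering of `Z` built from the left side. After `assoc_before`
  -- it remains to see that this numbering also has the block form of the right side.
  apply S.ext_inj (blockLabel hpc (blockLabel hab a B (a j) e₁) C k₁ f₁)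
  rw [S.compAt_apply_blockLabel f₁ _ _ hpc _ _ ⟨i.1, by omega⟩ hP₁,
    S.compAt_apply_blockLabel e₁ _ _ hab a B j rfl,
    S.assoc_before hab hpc hac hrb j i.1 hlt,
    S.compAt_apply f₂ _ _ hrb (blockLabel hac a C (a i) e₂) B ⟨j.1 + c - 1, by omega⟩ hP₂,
    S.compAt_apply_blockLabel e₂ _ _ hac a C i rfl]
  · intro t ht ht'
    obtain ⟨s, rfl⟩ := (blockFun_bijective hac i).2 t
    rcases s with ⟨s, hs⟩ | l
    · have hsj : s ≠ j := by
        rintro rfl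
        exact ht (Fin.ext (blockFun_inl_of_gt hac hij.symm hlt))
      have hsi' : a s ≠ a i := a.injective.ne hs
      have hsj' : a s ≠ a j := a.injective.ne hsj
      have h1 : blockFun hab j (Sum.inl ⟨s, hsj⟩) ≠ ⟨i.1, by omega⟩ := by
        intro h
        refine hs (congrArg Subtype.val (Sum.inl_injective (blockFun_injective hab j
          (h.trans (b := _) (c := blockFun hab j (Sum.inl ⟨i, hij⟩)) ?_))))
        exact Fin.ext (blockFun_inl_of_lt hab hij hlt).symm
      rw [← blockFun_before_left hab hpc hac hrb hlt (i₁ := ⟨i.1, by omega⟩)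
        (j₁ := ⟨j.1 + c - 1, by omega⟩) rfl rfl s hsj hs h1]
      have h2 : blockLabel hab a B (a j) e₁ (blockFun hab j (Sum.inl ⟨s, hsj⟩)) ≠ k₁ := by
        rw [← hP₁]
        exact (Equiv.injective _).ne h1
      rw [blockLabel_inl hpc _ C f₁ ⟨i.1, by omega⟩ hP₁ _ h1 h2]
      have h3 := blockLabel_inl hab a B e₁ j rfl s hsj hsj'
      have h4 := blockLabel_inl hac a C e₂ i rfl s hs hsi'
      simp only [h3, h4]
      exact h₀ _ _ _ _ _
    · rw [← blockFun_before_right hpc hac hrb hlt (i₁ := ⟨i.1, by omega⟩)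
        (j₁ := ⟨j.1 + c - 1, by omega⟩) rfl rfl l,
        blockLabel_inr hpc _ C f₁ ⟨i.1, by omega⟩ hP₁]
      have h4 := blockLabel_inr hac a C e₂ i rfl l
      simp only [h4]
      exact h₂ _ _
  · intro l
    have h1 : blockFun hab j (Sum.inr l) ≠ ⟨i.1, by omega⟩ := by
      intro h
      have := congrArg Fin.val h
      simp only [blockFun_inr_val] at this
      omega
    have h2 : blockLabel hab a B (a j) e₁ (blockFun hab j (Sum.inr l)) ≠ k₁ := by
      rw [← hP₁]
      exact (Equiv.injective _).ne h1
    rw [← blockFun_before_mid hab hpc hrb hlt (i₁ := ⟨i.1, by omega⟩)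
        (j₁ := ⟨j.1 + c - 1, by omega⟩) rfl rfl l h1,
      blockLabel_inl hpc _ C f₁ ⟨i.1, by omega⟩ hP₁ _ h1 h2]
    have h3 := blockLabel_inr hab a B e₁ j rfl l
    simp only [h3]
    exact h₁ _ _

/-- Partial compositions at different positions commute. -/
theorem NonunitalOperad.compAt_parallel (S : NonunitalOperad k) {X J L Y₁ Y₂ Z : Type}
    [Finite X] [Finite J] [Finite L] [Finite Y₁] [Finite Y₂] {i₁ i₂ : X} (hi : i₁ ≠ i₂)
    (e₁ : {x : X // x ≠ i₁} ⊕ J ≃ Y₁) (e₂ : {x : X // x ≠ i₂} ⊕ L ≃ Y₂) {k₁ : Y₁} {k₂ : Y₂}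
    (f₁ : {y : Y₁ // y ≠ k₁} ⊕ L ≃ Z) (f₂ : {y : Y₂ // y ≠ k₂} ⊕ J ≃ Z)
    (hk₁ : ∀ h, e₁ (Sum.inl ⟨i₂, h⟩) = k₁) (hk₂ : ∀ h, e₂ (Sum.inl ⟨i₁, h⟩) = k₂)
    (h₀ : ∀ x hx₁ hx₂ h h', f₁ (Sum.inl ⟨e₁ (Sum.inl ⟨x, hx₁⟩), h⟩) =
      f₂ (Sum.inl ⟨e₂ (Sum.inl ⟨x, hx₂⟩), h'⟩))
    (h₁ : ∀ j h, f₁ (Sum.inl ⟨e₁ (Sum.inr j), h⟩) = f₂ (Sum.inr j))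
    (h₂ : ∀ l h, f₁ (Sum.inr l) = f₂ (Sum.inl ⟨e₂ (Sum.inr l), h⟩))
    (x : S.ext X) (y : S.ext J) (z : S.ext L) :
    S.compAt k₁ f₁ (S.compAt i₁ e₁ x y) z = S.compAt k₂ f₂ (S.compAt i₂ e₂ x z) y := by
  have a := (Finite.equivFin X).symm
  -- An arbitrary numbering of `X` decides which input comes first. The two strict cases are the
  -- same statement with the two compositions exchanged.
  rcases lt_trichotomy (a.symm i₂).1 (a.symm i₁).1 with h | h | h
  · exact S.compAt_parallel_of_lt e₁ e₂ f₁ f₂ hk₁ hk₂ h₀ h₁ h₂ x y z a h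
  · exact absurd (a.symm.injective (Fin.ext h)).symm hi
  · exact (S.compAt_parallel_of_lt e₂ e₁ f₂ f₁ hk₂ hk₁
      (fun x hx₁ hx₂ h h' => (h₀ x hx₂ hx₁ h' h).symm) (fun j h => (h₂ j h).symm)
      (fun l h => (h₁ l h).symm) x z y a h).symm

/-- Associativity of nested partial compositions. -/
theorem NonunitalOperad.compAt_nested (S : NonunitalOperad k) {X J L Y W Z : Type}
    [Finite X] [Finite J] [Finite L] [Finite Y] [Finite W] {i : X} {j : J} {k₁ : Y}
    (e₁ : {x : X // x ≠ i} ⊕ J ≃ Y) (f₁ : {y : Y // y ≠ k₁} ⊕ L ≃ Z)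
    (e₂ : {x : J // x ≠ j} ⊕ L ≃ W) (f₂ : {x : X // x ≠ i} ⊕ W ≃ Z)
    (hk₁ : e₁ (Sum.inr j) = k₁)
    (h₀ : ∀ x hx h, f₁ (Sum.inl ⟨e₁ (Sum.inl ⟨x, hx⟩), h⟩) = f₂ (Sum.inl ⟨x, hx⟩))
    (h₁ : ∀ x hx h, f₁ (Sum.inl ⟨e₁ (Sum.inr x), h⟩) = f₂ (Sum.inr (e₂ (Sum.inl ⟨x, hx⟩))))
    (h₂ : ∀ l, f₁ (Sum.inr l) = f₂ (Sum.inr (e₂ (Sum.inr l))))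
    (x : S.ext X) (y : S.ext J) (z : S.ext L) :
    S.compAt k₁ f₁ (S.compAt i e₁ x y) z = S.compAt i f₂ x (S.compAt j e₂ y z) := by
  obtain ⟨m, ⟨A⟩⟩ := Finite.exists_equiv_fin X
  obtain ⟨b, ⟨B⟩⟩ := Finite.exists_equiv_fin J
  obtain ⟨c, ⟨C⟩⟩ := Finite.exists_equiv_fin L
  replace A := A.symm
  replace B := B.symm
  replace C := C.symm
  obtain ⟨s, rfl⟩ := A.surjective i
  obtain ⟨t, rfl⟩ := B.surjective j
  obtain ⟨p, hab⟩ : ∃ p, m + b = p + 1 := ⟨m + b - 1, by have := s.2; omega⟩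
  obtain ⟨q, hpc⟩ : ∃ q, p + c = q + 1 := ⟨p + c - 1, by have := s.2; have := t.2; omega⟩
  obtain ⟨r, hbc⟩ : ∃ r, b + c = r + 1 := ⟨b + c - 1, by have := t.2; omega⟩
  have has : m + r = q + 1 := by omega
  have hst : s.1 + t.1 < p := by omega
  -- The `t`-th input of the operation plugged in at position `s` becomes the input number `s + t`,
  -- since positions are counted from zero.
  have hP₁ : blockLabel hab A B (A s) e₁ ⟨s.1 + t.1, hst⟩ = k₁ := by
    rw [← hk₁, ← blockLabel_inr hab A B e₁ s rfl t]
    rfl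
  apply S.ext_inj (blockLabel hpc (blockLabel hab A B (A s) e₁) C k₁ f₁)
  rw [S.compAt_apply_blockLabel f₁ _ _ hpc _ _ ⟨s.1 + t.1, hst⟩ hP₁,
    S.compAt_apply_blockLabel e₁ _ _ hab A B s rfl,
    S.assoc_inside hab hpc hbc has s (s.1 + t.1) (by omega) (by omega),
    S.compAt_apply f₂ _ _ has A (blockLabel hbc B C (B t) e₂) s rfl,
    S.compAt_apply_blockLabel e₂ _ _ hbc B C t rfl]
  · have : (⟨s.1 + t.1 - s.1, by omega⟩ : Fin b) = t := Fin.ext (by simp)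
    rw [this]
  · intro l hl hl'
    have h1 : blockFun hab s (Sum.inl ⟨l, hl⟩) ≠ ⟨s.1 + t.1, hst⟩ := by
      intro h
      have := blockFun_injective hab s (h.trans (b := _) (c := blockFun hab s (Sum.inr t)) rfl)
      simp at this
    have h2 : blockLabel hab A B (A s) e₁ (blockFun hab s (Sum.inl ⟨l, hl⟩)) ≠ k₁ := by
      rw [← hP₁]
      exact (Equiv.injective _).ne h1
    rw [← blockFun_inside_left hab hpc has (i := t) (i₁ := ⟨s.1 + t.1, hst⟩) rfl l hl h1,
      blockLabel_inl hpc _ C f₁ _ hP₁ _ h1 h2]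
    have h3 := blockLabel_inl hab A B e₁ s rfl l hl hl'
    simp only [h3]
    exact h₀ _ _ _
  · intro l
    obtain ⟨u, rfl⟩ := (blockFun_bijective hbc t).2 l
    rcases u with ⟨u, hu⟩ | l
    · have h1 : blockFun hab s (Sum.inr u) ≠ ⟨s.1 + t.1, hst⟩ := by
        intro h
        have := blockFun_injective hab s (h.trans (b := _) (c := blockFun hab s (Sum.inr t)) rfl)
        exact hu (Sum.inr_injective this)
      have h2 : blockLabel hab A B (A s) e₁ (blockFun hab s (Sum.inr u)) ≠ k₁ := by
        rw [← hP₁]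
        exact (Equiv.injective _).ne h1
      have hu' : B u ≠ B t := B.injective.ne hu
      rw [← blockFun_inside_mid hab hpc hbc has (i₁ := ⟨s.1 + t.1, hst⟩) rfl u hu h1,
        blockLabel_inl hpc _ C f₁ _ hP₁ _ h1 h2, blockLabel_inl hbc B C e₂ t rfl u hu hu']
      have h3 := blockLabel_inr hab A B e₁ s rfl u
      simp only [h3]
      exact h₁ _ _ _
    · rw [← blockFun_inside_right hpc hbc has (i := t) (j := s) (i₁ := ⟨s.1 + t.1, hst⟩) rfl l,
        blockLabel_inr hpc _ C f₁ _ hP₁, blockLabel_inr hbc B C e₂ t rfl]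
      exact h₂ _

theorem NonunitalOperad.homExt_compAt {S R : NonunitalOperad k} (g : S ⟶ R) {X J Y : Type}
    [Finite X] [Finite J] (i : X) (e : {x : X // x ≠ i} ⊕ J ≃ Y) (x : S.ext X) (y : S.ext J) :
    SigmaMod.homExt g.hom Y (S.compAt i e x y) =
      R.compAt i e (SigmaMod.homExt g.hom X x) (SigmaMod.homExt g.hom J y) := by
  have a := (Finite.equivFin X).symm
  have b := (Finite.equivFin J).symm
  have h := card_add_card_eq (J := J) i
  apply R.ext_inj (blockLabel h a b i e)
  rw [SigmaMod.homExt_apply, S.compAt_apply_blockLabel e x y h a b (a.symm i) (by simp),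
    R.compAt_apply_blockLabel e _ _ h a b (a.symm i) (by simp), g.map_circ]
  rfl

-- From here on `compAt` is known only through its formal properties; the numberings chosen in its
-- definition must not be unfolded.
attribute [irreducible] NonunitalOperad.compAt

end

/-! ### Iterated compositions -/

/-- The inputs of an operation with inputs `I` after operations with inputs `J i` have been plugged
into the inputs `i ∈ L`. -/
inductive Pend {I : Type} (J : I → Type) (L : List I) : Type
  | todo (i : I) (h : i ∉ L)
  | done (i : I) (h : i ∈ L) (j : J i)

namespace Pend
variable {I : Type} {J : I → Type} {L : List I}

instance [Finite I] [∀ i, Finite (J i)] : Finite (Pend J L) := by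
  refine Finite.of_injective (β := I ⊕ Σ i, J i)
    (fun q => match q with
      | todo i _ => Sum.inl i
      | done i _ j => Sum.inr ⟨i, j⟩) ?_
  rintro (⟨i, h⟩ | ⟨i, h, j⟩) (⟨i', h'⟩ | ⟨i', h', j'⟩) hh
  · obtain rfl : i = i' := Sum.inl_injective hh
    rfl
  · simp at hh
  · simp at hh
  · have := Sum.inr_injective hh
    cases this
    rfl

/-- The inputs after plugging in an operation at `i`. -/
def consFun (i : I) (h : i ∉ L) :
    {q : Pend J L // q ≠ todo i h} ⊕ J i → Pend J (i :: L)
  | Sum.inl ⟨todo j hj, hne⟩ => todo j (by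
      rw [List.mem_cons, not_or]
      exact ⟨fun h => hne (by subst h; rfl), hj⟩)
  | Sum.inl ⟨done j hj x, _⟩ => done j (List.mem_cons_of_mem i hj) x
  | Sum.inr x => done i List.mem_cons_self x

theorem consFun_bijective (i : I) (h : i ∉ L) : Function.Bijective (consFun (J := J) i h) := by
  constructor
  · rintro (⟨⟨j, hj⟩ | ⟨j, hj, x⟩, hne⟩ | x) (⟨⟨j', hj'⟩ | ⟨j', hj', x'⟩, hne'⟩ | x') hh
    all_goals try simp [consFun] at hh
    · subst hh; rfl
    · obtain ⟨rfl, hh⟩ := hh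
      cases hh
      rfl
    · exact absurd (hh.1 ▸ hj) h
    · exact absurd (hh.1 ▸ hj') h
    · rw [hh]
  · rintro (⟨j, hj⟩ | ⟨j, hj, x⟩)
    · rw [List.mem_cons, not_or] at hj
      exact ⟨Sum.inl ⟨todo j hj.2, fun h => hj.1 (by injection h)⟩, rfl⟩
    · rcases List.mem_cons.1 hj with rfl | hj'
      · exact ⟨Sum.inr x, rfl⟩
      · exact ⟨Sum.inl ⟨done j hj' x, fun h => by cases h⟩, rfl⟩

/-- `consFun` as a bijection. -/
noncomputable def consEquiv (i : I) (h : i ∉ L) :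
    {q : Pend J L // q ≠ todo i h} ⊕ J i ≃ Pend J (i :: L) :=
  Equiv.ofBijective _ (consFun_bijective i h)

theorem consEquiv_done (i : I) (h : i ∉ L) (j : I) (hj : j ∈ L) (x : J j) (hne) :
    consEquiv (J := J) i h (Sum.inl ⟨done j hj x, hne⟩) = done j (List.mem_cons_of_mem i hj) x :=
  rfl

/-- Nothing has been plugged in. -/
def nilEquiv : I ≃ Pend J [] where
  toFun i := todo i List.not_mem_nil
  invFun q := match q with
    | todo i _ => i
  left_inv _ := rfl
  right_inv q := match q with
    | todo _ _ => rfl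

/-- Functoriality of `Pend`. -/
def mapFun {I' : Type} {J' : I' → Type} {L' : List I'} (e : I ≃ I') (h : ∀ i, i ∈ L ↔ e i ∈ L')
    (f : ∀ i, i ∈ L → (J i ≃ J' (e i))) : Pend J L → Pend J' L'
  | todo i hi => todo (e i) (mt (h i).2 hi)
  | done i hi j => done (e i) ((h i).1 hi) (f i hi j)

/-- Functoriality of `Pend`. -/
noncomputable def mapEquiv {I' : Type} {J' : I' → Type} {L' : List I'} (e : I ≃ I')
    (h : ∀ i, i ∈ L ↔ e i ∈ L') (f : ∀ i, i ∈ L → (J i ≃ J' (e i))) : Pend J L ≃ Pend J' L' :=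
  Equiv.ofBijective (mapFun e h f) (by
    constructor
    · rintro (⟨i, hi⟩ | ⟨i, hi, j⟩) (⟨i', hi'⟩ | ⟨i', hi', j'⟩) hh
      · have : i = i' := e.injective (by injection hh)
        subst this
        rfl
      · cases hh
      · cases hh
      · have : i = i' := e.injective (by injection hh)
        subst this
        simp only [mapFun, done.injEq, heq_eq_eq, true_and] at hh
        rw [(f i hi).injective hh]
    · rintro (⟨i, hi⟩ | ⟨i, hi, j⟩)
      · obtain ⟨i, rfl⟩ := e.surjective i
        exact ⟨todo i (mt (h i).1 hi), rfl⟩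
      · obtain ⟨i, rfl⟩ := e.surjective i
        obtain ⟨j, rfl⟩ := (f i ((h i).2 hi)).surjective j
        exact ⟨done i ((h i).2 hi) j, rfl⟩)

theorem mapEquiv_todo {I' : Type} {J' : I' → Type} {L' : List I'} (e : I ≃ I')
    (h : ∀ i, i ∈ L ↔ e i ∈ L') (f : ∀ i, i ∈ L → (J i ≃ J' (e i))) (i : I) (hi : i ∉ L) :
    mapEquiv e h f (todo i hi) = todo (e i) (mt (h i).2 hi) := rfl

end Pend

section
variable {k : Type u} [CommRing k]

namespace NonunitalOperad
variable (S : NonunitalOperad k)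

/-- The operation `y i` is plugged into the input `i` of `x` for all `i ∈ L`. -/
noncomputable def gamma {I : Type} [Finite I] {J : I → Type} [∀ i, Finite (J i)] (x : S.ext I)
    (y : ∀ i, S.ext (J i)) : (L : List I) → L.Nodup → S.ext (Pend J L)
  | [], _ => S.extMap Pend.nilEquiv x
  | i :: L, h => S.compAt (Pend.todo i (List.nodup_cons.1 h).1)
      (Pend.consEquiv i (List.nodup_cons.1 h).1) (gamma x y L (List.nodup_cons.1 h).2) (y i)

variable {I : Type} [Finite I] {J : I → Type} [∀ i, Finite (J i)]

theorem gamma_nil (x : S.ext I) (y : ∀ i, S.ext (J i)) (h) :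
    S.gamma x y [] h = S.extMap Pend.nilEquiv x := rfl

theorem gamma_cons (x : S.ext I) (y : ∀ i, S.ext (J i)) (i : I) (L : List I) (h) (hi : i ∉ L)
    (hL : L.Nodup) : S.gamma x y (i :: L) h =
      S.compAt (Pend.todo i hi) (Pend.consEquiv i hi) (S.gamma x y L hL) (y i) := rfl

/-- It suffices to exchange two neighbours in the list, and then the claim is that compositions at
different inputs commute, `compAt_parallel`. -/
theorem gamma_perm (x : S.ext I) (y : ∀ i, S.ext (J i)) {L L' : List I} (p : L.Perm L')
    (h : L.Nodup) (h' : L'.Nodup) :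
    S.extMap (Pend.mapEquiv (Equiv.refl I) (fun _ => p.mem_iff) (fun i _ => Equiv.refl (J i)))
      (S.gamma x y L h) = S.gamma x y L' h' := by
  induction p with
  | nil => exact S.extMap_id _ (by rintro (⟨i, hi⟩ | ⟨i, hi, j⟩) <;> rfl) _
  | @cons i L L' p ih =>
    have ih := ih (List.nodup_cons.1 h).2 (List.nodup_cons.1 h').2
    rw [S.gamma_cons x y i L h (List.nodup_cons.1 h).1 (List.nodup_cons.1 h).2,
      S.gamma_cons x y i L' h' (List.nodup_cons.1 h').1 (List.nodup_cons.1 h').2, ← ih]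
    refine (S.compAt_congr (Pend.mapEquiv (Equiv.refl I) (fun _ => p.mem_iff)
      (fun i _ => Equiv.refl (J i))) (Equiv.refl (J i)) _ rfl ?_ (fun _ => rfl) _ _).symm
    rintro (⟨i, hi⟩ | ⟨i, hi, j⟩) hx hx' <;> rfl
  | swap i j L =>
    simp only [gamma]
    rw [extMap_compAt]
    have h1 : j ≠ i := fun hh => (List.nodup_cons.1 h).1 (hh ▸ List.mem_cons_self)
    have hi := (List.nodup_cons.1 (List.nodup_cons.1 h).2).1
    have hj := (List.nodup_cons.1 (List.nodup_cons.1 h').2).1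
    refine S.compAt_parallel (i₁ := Pend.todo i hi) (i₂ := Pend.todo j hj)
      (fun hh => h1 (by injection hh with hh; exact hh.symm)) _ _ _ _ (fun _ => rfl)
      (fun _ => rfl) ?_ ?_ ?_ _ _ _
    · rintro (⟨i, hi⟩ | ⟨i, hi, j⟩) hx₁ hx₂ h h' <;> rfl
    · intro j h
      rfl
    · intro l h
      rfl
  | @trans L₁ L₂ L₃ p q ih₁ ih₂ =>
    have h₂ := (p.nodup_iff).1 h
    rw [← ih₂ h₂ h', ← ih₁ h h₂, SigmaMod.extMap_extMap]
    congr 1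
    congr 1
    apply Equiv.ext
    rintro (⟨i, hi⟩ | ⟨i, hi, j⟩) <;> rfl

/-- Naturality under bijections of all inputs involved. The bijections `f i` are needed for `i ∈ L`
only, because nothing is plugged in elsewhere; this matters for trees where one subtree changes
substantially. -/
theorem gamma_map {I' : Type} [Finite I'] {J' : I' → Type} [∀ i, Finite (J' i)] (x : S.ext I)
    (y : ∀ i, S.ext (J i)) (y' : ∀ i, S.ext (J' i)) {L : List I} {L' : List I'} (e : I ≃ I')
    (h : ∀ i, i ∈ L ↔ e i ∈ L') (f : ∀ i, i ∈ L → (J i ≃ J' (e i)))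
    (hy : ∀ i hi, S.extMap (f i hi) (y i) = y' (e i)) (hL : L.Nodup) (hL' : L'.Nodup) :
    S.extMap (Pend.mapEquiv e h f) (S.gamma x y L hL) = S.gamma (S.extMap e x) y' L' hL' := by
  -- The induction runs along the image list `L.map e`, where the order is preserved; passing to
  -- `L'` is then a permutation.
  have key : ∀ (L : List I) (f : ∀ i, i ∈ L → (J i ≃ J' (e i)))
      (_ : ∀ i hi, S.extMap (f i hi) (y i) = y' (e i)) (hL : L.Nodup)
      (hL' : (L.map e).Nodup),
      S.extMap (Pend.mapEquiv e (fun i => (List.mem_map_of_injective e.injective).symm) f)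
        (S.gamma x y L hL) = S.gamma (S.extMap e x) y' (L.map e) hL' := by
    intro L
    induction L with
    | nil =>
      intro f hf hL hL'
      change _ = S.gamma (S.extMap e x) y' [] List.nodup_nil
      rw [gamma_nil, gamma_nil, SigmaMod.extMap_extMap, SigmaMod.extMap_extMap]
      congr 2
      exact Equiv.ext fun _ => rfl
    | cons i L ih =>
      intro f hf hL hL'
      have ih := ih (fun j hj => f j (List.mem_cons_of_mem i hj)) (fun j hj => hf j _)
        (List.nodup_cons.1 hL).2 (List.nodup_cons.1 hL').2
      change _ = S.gamma (S.extMap e x) y' (e i :: L.map e) hL'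
      rw [S.gamma_cons x y i L hL (List.nodup_cons.1 hL).1 (List.nodup_cons.1 hL).2,
        S.gamma_cons _ y' (e i) (L.map e) hL' (List.nodup_cons.1 hL').1 (List.nodup_cons.1 hL').2,
        ← ih, ← hf i List.mem_cons_self]
      refine (S.compAt_congr (Pend.mapEquiv e _ _) (f i List.mem_cons_self) _ rfl ?_
        (fun _ => rfl) _ _).symm
      rintro (⟨i, hi⟩ | ⟨i, hi, j⟩) hx hx' <;> rfl
  have p : (L.map e).Perm L' := by
    rw [List.perm_ext_iff_of_nodup (hL.map e.injective) hL']
    intro i'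
    obtain ⟨i, rfl⟩ := e.surjective i'
    rw [List.mem_map_of_injective e.injective, h]
  rw [← S.gamma_perm _ y' p (hL.map e.injective) hL', ← key L f hy hL (hL.map e.injective),
    SigmaMod.extMap_extMap]
  congr 1
  congr 1
  apply Equiv.ext
  rintro (⟨i, hi⟩ | ⟨i, hi, j⟩) <;> rfl

theorem gamma_congr (x : S.ext I) {y y' : ∀ i, S.ext (J i)} (L : List I) (hL : L.Nodup)
    (h : ∀ i ∈ L, y i = y' i) : S.gamma x y L hL = S.gamma x y' L hL := by
  induction L with
  | nil => rfl
  | cons i L ih =>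
    simp only [gamma]
    rw [ih _ (fun j hj => h j (List.mem_cons_of_mem i hj)), h i List.mem_cons_self]

theorem gamma_linear_left (a b : k) (x₁ x₂ : S.ext I) (y : ∀ i, S.ext (J i)) (L : List I)
    (hL : L.Nodup) : S.gamma (a • x₁ + b • x₂) y L hL =
      a • S.gamma x₁ y L hL + b • S.gamma x₂ y L hL := by
  induction L with
  | nil => simp only [gamma, map_add, map_smul]
  | cons i L ih =>
    simp only [gamma, ih, map_add, map_smul, LinearMap.add_apply, LinearMap.smul_apply]

/-- By `gamma_perm` the input `i` may be moved to the front of the list. The composition at `i` is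
then the outermost one, and `compAt` is linear in its second argument. -/
theorem gamma_linear_right (a b : k) (x : S.ext I) {y y₁ y₂ : ∀ i, S.ext (J i)} (i : I)
    (hi : y i = a • y₁ i + b • y₂ i) (h₁ : ∀ j, j ≠ i → y₁ j = y j) (h₂ : ∀ j, j ≠ i → y₂ j = y j)
    (L : List I) (hL : L.Nodup) (hiL : i ∈ L) : S.gamma x y L hL =
      a • S.gamma x y₁ L hL + b • S.gamma x y₂ L hL := by
  classical
  obtain ⟨L', p⟩ : ∃ L', (i :: L').Perm L := ⟨_, (List.perm_cons_erase hiL).symm⟩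
  have hL' : (i :: L').Nodup := p.nodup_iff.2 hL
  rw [← S.gamma_perm x y p hL' hL, ← S.gamma_perm x y₁ p hL' hL, ← S.gamma_perm x y₂ p hL' hL,
    ← map_smul, ← map_smul, ← map_add]
  congr 1
  have hne : ∀ j ∈ L', j ≠ i := fun j hj h => (List.nodup_cons.1 hL').1 (h ▸ hj)
  simp only [gamma]
  rw [S.gamma_congr x (y := y₁) (y' := y) L' _ (fun j hj => h₁ j (hne j hj)),
    S.gamma_congr x (y := y₂) (y' := y) L' _ (fun j hj => h₂ j (hne j hj)), hi, map_add, map_smul,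
    map_smul]

theorem homExt_gamma {S R : NonunitalOperad k} (g : S ⟶ R) (x : S.ext I) (y : ∀ i, S.ext (J i))
    (L : List I) (hL : L.Nodup) : SigmaMod.homExt g.hom _ (S.gamma x y L hL) =
      R.gamma (SigmaMod.homExt g.hom _ x) (fun i => SigmaMod.homExt g.hom _ (y i)) L hL := by
  induction L with
  | nil => rfl
  | cons i L ih =>
    simp only [gamma]
    rw [homExt_compAt, ih]

end NonunitalOperad

end

/-! ### Evaluation of decorated trees -/

namespace RTree

instance finite_leaves : ∀ T : RTree, Finite T.Leaves
  | leg => inferInstanceAs (Finite Unit)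
  | node I c => by
    have := fun i => finite_leaves (c i)
    exact inferInstanceAs (Finite (Σ i : I, (c i).Leaves))

/-- The leaf of the exceptional tree. -/
def onlyLeaf : (T : RTree) → ¬ Nonempty T.Vert → T.Leaves
  | leg, _ => ()
  | node _ _, h => (h ⟨none⟩).elim

theorem eq_onlyLeaf : ∀ (T : RTree) (h : ¬ Nonempty T.Vert) (l : T.Leaves), l = T.onlyLeaf h
  | leg, _, _ => rfl
  | node _ _, h, _ => (h ⟨none⟩).elim

/-- If `L` consists of the inputs of the root at which there is a non-trivial subtree, then the
leaves of the tree are those inputs not in `L`, and the leaves of the subtrees at the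
inputs in `L`. -/
noncomputable def pendEquiv {I : Type} [Finite I] (c : I → RTree) (L : List I)
    (hL : ∀ i, i ∈ L ↔ Nonempty (c i).Vert) :
    Pend (fun i => (c i).Leaves) L ≃ (node I c).Leaves :=
  Equiv.ofBijective
    (fun q => match q with
      | .todo i h => ⟨i, (c i).onlyLeaf (mt (hL i).2 h)⟩
      | .done i _ l => ⟨i, l⟩) (by
    constructor
    · rintro (⟨i, hi⟩ | ⟨i, hi, j⟩) (⟨i', hi'⟩ | ⟨i', hi', j'⟩) hh
      · obtain rfl : i = i' := congrArg Sigma.fst hh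
        rfl
      · obtain rfl : i = i' := congrArg Sigma.fst hh
        exact absurd hi' hi
      · obtain rfl : i = i' := congrArg Sigma.fst hh
        exact absurd hi hi'
      · cases hh
        rfl
    · rintro ⟨i, l⟩
      by_cases hi : i ∈ L
      · exact ⟨.done i hi l, rfl⟩
      · exact ⟨.todo i hi, by rw [(c i).eq_onlyLeaf (mt (hL i).2 hi) l]⟩)

theorem pendEquiv_todo {I : Type} [Finite I] (c : I → RTree) (L : List I)
    (hL : ∀ i, i ∈ L ↔ Nonempty (c i).Vert) (i : I) (h : i ∉ L) (l : (c i).Leaves) :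
    pendEquiv c L hL (.todo i h) = ⟨i, l⟩ := by
  rw [(c i).eq_onlyLeaf (mt (hL i).2 h) l]
  rfl

theorem exists_vertList {I : Type} [Finite I] (c : I → RTree) :
    ∃ L : List I, L.Nodup ∧ ∀ i, i ∈ L ↔ Nonempty (c i).Vert := by
  classical
  have := Fintype.ofFinite I
  exact ⟨(Finset.univ.filter fun i => Nonempty (c i).Vert).toList, Finset.nodup_toList _, by simp⟩

/-- The inputs of the root at which there is a non-trivial subtree. -/
noncomputable def vertList {I : Type} [Finite I] (c : I → RTree) : List I :=
  (exists_vertList c).choose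

theorem nodup_vertList {I : Type} [Finite I] (c : I → RTree) : (vertList c).Nodup :=
  (exists_vertList c).choose_spec.1

theorem mem_vertList {I : Type} [Finite I] (c : I → RTree) (i : I) :
    i ∈ vertList c ↔ Nonempty (c i).Vert :=
  (exists_vertList c).choose_spec.2 i

/-- The bijection of the inputs of the roots given by an isomorphism. -/
def Iso.rootEquiv {I J : Type} [Finite I] [Finite J] {c : I → RTree} {c' : J → RTree}
    (f : Iso (node I c) (node J c')) : I ≃ J := f.1

/-- The isomorphisms of subtrees given by an isomorphism. -/
def Iso.child {I J : Type} [Finite I] [Finite J] {c : I → RTree} {c' : J → RTree}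
    (f : Iso (node I c) (node J c')) (j : J) : Iso (c (f.rootEquiv.symm j)) (c' j) := f.2 j

/-- The number of leaves of the exceptional tree is one. -/
def legEquiv : Fin 1 ≃ leg.Leaves := finOneEquiv

section
variable {k : Type u} [CommRing k] {E : SigmaMod k}

/-- The decoration of the root. -/
def Dec.root {I : Type} [Finite I] {c : I → RTree} (d : Dec E (node I c)) : E.ext I := d none

/-- The decorations of the subtrees. -/
def Dec.child {I : Type} [Finite I] {c : I → RTree} (d : Dec E (node I c)) (i : I) : Dec E (c i) :=
  fun v => d (some ⟨i, v⟩)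

/-- The decoration given by decorations of the root and of the subtrees. -/
def Dec.cons {I : Type} [Finite I] {c : I → RTree} (x : E.ext I) (r : ∀ i, Dec E (c i)) :
    Dec E (node I c) := fun v => match v with
  | none => x
  | some ⟨i, v⟩ => r i v

end

end RTree

section
variable {k : Type u} [CommRing k]

namespace NonunitalOperad
variable (S : NonunitalOperad k) (e : S.obj 1)

open RTree

/-- The composition of the operations that decorate a tree; `e` is the value of the exceptional
tree. -/
noncomputable def ev : (T : RTree) → Dec S.toSigmaMod T → S.ext T.Leaves
  | leg, _ => (S.extEquiv legEquiv).symm e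
  | node _ c, d => S.extMap (pendEquiv c (vertList c) (mem_vertList c))
      (S.gamma (Dec.root d) (fun i => ev (c i) (Dec.child d i)) (vertList c)
        (nodup_vertList c))

/-- The order of the chosen list of non-trivial subtrees is irrelevant by `gamma_perm`, so later
arguments can put a prescribed input first. -/
theorem ev_node {I : Type} [Finite I] (c : I → RTree) (d : Dec S.toSigmaMod (node I c))
    (L : List I) (hL : ∀ i, i ∈ L ↔ Nonempty (c i).Vert) (h : L.Nodup) :
    S.ev e (node I c) d = S.extMap (pendEquiv c L hL)
      (S.gamma (Dec.root d) (fun i => S.ev e (c i) (Dec.child d i)) L h) := by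
  have p : (vertList c).Perm L := by
    rw [List.perm_ext_iff_of_nodup (nodup_vertList c) h]
    intro i
    rw [hL, mem_vertList]
  rw [← S.gamma_perm _ _ p (nodup_vertList c) h, ev, SigmaMod.extMap_extMap]
  congr 2
  apply Equiv.ext
  rintro (⟨i, hi⟩ | ⟨i, hi, j⟩) <;> rfl

/-- The isomorphism matches the roots and, by induction, the values of the subtrees, so this is
`gamma_map`. It is one of the two conditions for descending to the colimit, `ev_linear` being the
other. -/
theorem ev_push : ∀ {T T' : RTree} (f : Iso T T') (d : Dec S.toSigmaMod T),
    S.extMap f.leaves (S.ev e T' (f.push S.toSigmaMod d)) = S.ev e T d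
  | leg, leg, _, _ => rfl
  | leg, node _ _, f, _ => f.elim
  | node _ _, leg, f, _ => f.elim
  | node I c, node J c', f, d => by
    have hL : ∀ j, j ∈ vertList c' ↔ f.rootEquiv.symm j ∈ vertList c := by
      intro j
      rw [mem_vertList, mem_vertList]
      exact (f.child j).vert.nonempty_congr
    have key := S.gamma_map (J' := fun i => (c i).Leaves) (Dec.root (f.push S.toSigmaMod d))
      (fun j => S.ev e (c' j) (Dec.child (f.push S.toSigmaMod d) j))
      (fun i => S.ev e (c i) (Dec.child d i))
      f.rootEquiv.symm hL (fun j _ => (f.child j).leaves)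
      (fun j _ => ev_push (f.child j) (Dec.child d (f.rootEquiv.symm j)))
      (nodup_vertList c') (nodup_vertList c)
    have hd : S.extMap f.rootEquiv.symm (Dec.root (f.push S.toSigmaMod d)) = Dec.root d := by
      have h : Dec.root (f.push S.toSigmaMod d) = S.extMap f.rootEquiv (Dec.root d) := rfl
      rw [h, SigmaMod.extMap_extMap]
      exact S.extMap_id _ (fun i => by simp) _
    rw [hd] at key
    rw [ev, ev, SigmaMod.extMap_extMap, ← key, SigmaMod.extMap_extMap]
    congr 2
    apply Equiv.ext
    rintro (⟨j, hj⟩ | ⟨j, hj, l⟩)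
    -- An unused input carries an exceptional tree; its leaf is unique, so any description of that
    -- leaf may be inserted.
    · have hj' := mt (mem_vertList c' j).2 hj
      rw [Equiv.trans_apply, Equiv.trans_apply, pendEquiv_todo c' _ _ j hj ((c' j).onlyLeaf hj'),
        Pend.mapEquiv_todo,
        pendEquiv_todo c _ _ _ _ ((f.child j).leaves ((c' j).onlyLeaf hj'))]
      rfl
    · rfl

theorem ev_linear (a b : k) : ∀ {T : RTree} {d d₁ d₂ : Dec S.toSigmaMod T} (v : T.Vert)
    (_ : d v = a • d₁ v + b • d₂ v) (_ : ∀ w, w ≠ v → d₁ w = d w) (_ : ∀ w, w ≠ v → d₂ w = d w),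
    S.ev e T d = a • S.ev e T d₁ + b • S.ev e T d₂
  | leg, _, _, _, v, _, _, _ => v.elim
  | node I c, d, d₁, d₂, none, hv, h₁, h₂ => by
    have hr : Dec.root d = a • Dec.root d₁ + b • Dec.root d₂ := hv
    have e₁ : ∀ i, Dec.child d₁ i = Dec.child d i := fun i =>
      funext fun v => h₁ _ (Option.some_ne_none _)
    have e₂ : ∀ i, Dec.child d₂ i = Dec.child d i := fun i =>
      funext fun v => h₂ _ (Option.some_ne_none _)
    simp only [ev, e₁, e₂]
    rw [hr, gamma_linear_left, map_add, map_smul, map_smul]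
  | node I c, d, d₁, d₂, some ⟨i, v⟩, hv, h₁, h₂ => by
    have ih := ev_linear a b (T := c i) (d := Dec.child d i)
      (d₁ := Dec.child d₁ i) (d₂ := Dec.child d₂ i) v hv
      (fun w hw => h₁ _ (fun h => hw (by cases h; rfl)))
      (fun w hw => h₂ _ (fun h => hw (by cases h; rfl)))
    have r₁ : Dec.root d₁ = Dec.root d := h₁ none (fun h => by cases h)
    have r₂ : Dec.root d₂ = Dec.root d := h₂ none (fun h => by cases h)
    rw [ev, ev, ev, r₁, r₂, ← map_smul, ← map_smul, ← map_add]
    congr 1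
    -- The subtree at `i` contains the vertex `v`, hence `i` is one of the inputs into which
    -- something is plugged.
    refine S.gamma_linear_right a b (Dec.root d) i ih ?_ ?_ _ _ ((mem_vertList c i).2 ⟨v⟩)
    · intro j hj
      refine congrArg _ ?_
      exact funext fun w => h₁ _ (fun h => hj (by cases h; rfl))
    · intro j hj
      refine congrArg _ ?_
      exact funext fun w => h₂ _ (fun h => hj (by cases h; rfl))

/-- A morphism commutes with each composition in the recursion. This is the source of the naturality
of evaluation, and through it of the associativity of the multiplication. -/
theorem homExt_ev {S R : NonunitalOperad k} (g : S ⟶ R) (e : S.obj 1) (e' : R.obj 1)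
    (he : g.hom.app 1 e = e') : ∀ (T : RTree) (d : Dec S.toSigmaMod T),
    SigmaMod.homExt g.hom _ (S.ev e T d) =
      R.ev e' T (fun v => SigmaMod.homExt g.hom _ (d v))
  | leg, d => by
    apply R.ext_inj legEquiv
    rw [ev, ev, SigmaMod.homExt_apply, SigmaMod.extEquiv_symm_apply, SigmaMod.extEquiv_symm_apply,
      he]
  | node I c, d => by
    rw [ev, ev, SigmaMod.homExt_extMap, homExt_gamma]
    refine congrArg _ ?_
    refine congrArg (fun y => R.gamma _ y _ _) (funext fun i => ?_)
    exact homExt_ev g e e' he (c i) _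

end NonunitalOperad

end

/-! ### Decorated trees with labeled leaves -/

section
variable {k : Type u} [CommRing k]

/-- Trees with vertices decorated by elements of `E` and leaves labeled by elements of `Z`. -/
inductive DTree (E : SigmaMod k) (Z : Type) : Type (max 1 u)
  | leg (z : Z)
  | node (I : Type) [Finite I] (x : E.ext I) (c : I → DTree E Z)

/-- A tree together with a labeling of the leaves and a decoration of the vertices. -/
structure Rep (E : SigmaMod k) (Z : Type) where
  tree : RTree
  lab : tree.Leaves → Z
  dec : RTree.Dec E tree

/-- The exceptional tree with its label. -/
def Rep.leg {E : SigmaMod k} {Z : Type} (z : Z) : Rep E Z :=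
  ⟨RTree.leg, fun _ => z, fun v => v.elim⟩

/-- The tree with root decorated by `x` and the subtrees `r i`. -/
def Rep.node {E : SigmaMod k} {Z : Type} (I : Type) [Finite I] (x : E.ext I) (r : I → Rep E Z) :
    Rep E Z :=
  ⟨RTree.node I (fun i => (r i).tree), fun l => (r l.1).lab l.2, fun v => match v with
    | none => x
    | some ⟨i, v⟩ => (r i).dec v⟩

namespace DTree
variable {E : SigmaMod k} {Z Z' Z'' : Type}

/-- The underlying tree with its labels and decorations. -/
def rep : DTree E Z → Rep E Z
  | leg z => Rep.leg z
  | node I x c => Rep.node I x (fun i => (c i).rep)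

/-- The leaves of a decorated tree. -/
abbrev Leaves (D : DTree E Z) : Type := D.rep.tree.Leaves

/-- The labels of the leaves of a decorated tree. -/
abbrev lab (D : DTree E Z) : D.Leaves → Z := D.rep.lab

/-- The decorated tree given by a tree, labels and decorations. -/
def ofDec : (T : RTree) → (T.Leaves → Z) → RTree.Dec E T → DTree E Z
  | RTree.leg, b, _ => leg (b ())
  | RTree.node I c, b, d =>
    node I d.root (fun i => ofDec (c i) (fun l => b ⟨i, l⟩) (RTree.Dec.child d i))

/-- With `ofDec_rep` this shows that `DTree` and `Rep` carry the same data: the former makes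
grafting a structural recursion, the latter is the form in which trees enter the colimit. -/
theorem rep_ofDec : ∀ (T : RTree) (b : T.Leaves → Z) (d : RTree.Dec E T),
    (ofDec T b d).rep = ⟨T, b, d⟩
  | RTree.leg, b, d => by
    have : d = fun v => v.elim := funext fun v => v.elim
    subst this
    rfl
  | RTree.node I c, b, d => by
    have ih : (fun i => (ofDec (c i) (fun l => b ⟨i, l⟩) (RTree.Dec.child d i)).rep) =
      fun i => ⟨c i, (fun l => b ⟨i, l⟩), RTree.Dec.child d i⟩ := funext fun i => rep_ofDec _ _ _
    change Rep.node I d.root _ = _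
    rw [ih]
    refine congrArg (fun d' => (⟨RTree.node I c, b, d'⟩ : Rep E Z)) ?_
    funext v
    rcases v with _ | ⟨i, v⟩ <;> rfl

theorem ofDec_rep (D : DTree E Z) : ofDec D.rep.tree D.rep.lab D.rep.dec = D := by
  induction D with
  | leg z => rfl
  | node I x c ih =>
    change node I x _ = _
    congr 1
    exact funext ih

/-- Grafting of the trees `f z` onto the leaves with label `z`. -/
def bind : DTree E Z → (Z → DTree E Z') → DTree E Z'
  | leg z, f => f z
  | node I x c, f => node I x (fun i => (c i).bind f)

/-- Grafting is associative as an equality of inductive trees, not merely up to isomorphism. The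
associativity axioms of the free operad are derived from this. -/
theorem bind_assoc (D : DTree E Z) (f : Z → DTree E Z') (g : Z' → DTree E Z'') :
    (D.bind f).bind g = D.bind (fun z => (f z).bind g) := by
  induction D with
  | leg z => rfl
  | node I x c ih =>
    simp only [bind]
    congr 1
    exact funext ih

theorem bind_congr (D : DTree E Z) {f g : Z → DTree E Z'} (h : ∀ l, f (D.lab l) = g (D.lab l)) :
    D.bind f = D.bind g := by
  induction D with
  | leg z => exact h ()
  | node I x c ih =>
    simp only [bind]
    congr 1
    exact funext fun i => ih i (fun l => h ⟨i, l⟩)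

/-- Re-labeling of the leaves. -/
def map (g : Z → Z') (D : DTree E Z) : DTree E Z' := D.bind (fun z => leg (g z))

theorem bind_leg (D : DTree E Z) : D.bind leg = D := by
  induction D with
  | leg z => rfl
  | node I x c ih =>
    simp only [bind]
    congr 1
    exact funext ih

theorem map_map (D : DTree E Z) (f : Z → Z') (g : Z' → Z'') :
    (D.map f).map g = D.map (fun z => g (f z)) := bind_assoc _ _ _

theorem map_bind (D : DTree E Z) (f : Z → Z') (g : Z' → DTree E Z'') :
    (D.map f).bind g = D.bind (fun z => g (f z)) := bind_assoc _ _ _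

theorem bind_map (D : DTree E Z) (f : Z → DTree E Z') (g : Z' → Z'') :
    (D.bind f).map g = D.bind (fun z => (f z).map g) := bind_assoc _ _ _

/-- If only exceptional trees are grafted onto `D`, then only the labels change. -/
theorem bind_eq_ofDec (D : DTree E Z) (f : Z → DTree E Z') (g : D.Leaves → Z')
    (h : ∀ l, f (D.lab l) = leg (g l)) : D.bind f = ofDec D.rep.tree g D.rep.dec := by
  induction D with
  | leg z => exact h ()
  | node I x c ih =>
    change node I x _ = node I x _
    congr 1
    exact funext fun i => ih i (fun l => g ⟨i, l⟩) (fun l => h ⟨i, l⟩)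

theorem rep_map (D : DTree E Z) (g : Z → Z') :
    (D.map g).rep = ⟨D.rep.tree, fun l => g (D.lab l), D.rep.dec⟩ := by
  rw [map, D.bind_eq_ofDec _ (fun l => g (D.lab l)) (fun _ => rfl), rep_ofDec]

/-- The leaves of a grafted tree. -/
def bindLeaves : (D : DTree E Z) → (f : Z → DTree E Z') →
    ((D.bind f).Leaves ≃ Σ l : D.Leaves, (f (D.lab l)).Leaves)
  | leg z, f => (Equiv.uniqueSigma (fun _ : Unit => (f z).Leaves)).symm
  | node I _ c, f =>
    (Equiv.sigmaCongrRight (fun i => bindLeaves (c i) f)).trans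
      (Equiv.sigmaAssoc (fun (i : I) (l : (c i).Leaves) => (f ((c i).lab l)).Leaves)).symm

theorem lab_bind : ∀ (D : DTree E Z) (f : Z → DTree E Z') (l : (D.bind f).Leaves),
    (D.bind f).lab l = (f (D.lab (D.bindLeaves f l).1)).lab (D.bindLeaves f l).2
  | leg _, _, _ => rfl
  | node _ _ c, f, ⟨i, l⟩ => lab_bind (c i) f l

theorem injective_lab_bind (D : DTree E Z) (f : Z → DTree E Z') (hD : Function.Injective D.lab)
    (hf : Function.Injective (fun p : Σ z, (f z).Leaves => (f p.1).lab p.2)) :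
    Function.Injective (D.bind f).lab := by
  intro l l' h
  rw [lab_bind, lab_bind] at h
  have h' := @hf ⟨_, _⟩ ⟨_, _⟩ h
  apply (D.bindLeaves f).injective
  generalize D.bindLeaves f l = p at h'
  generalize D.bindLeaves f l' = p' at h'
  obtain ⟨a, b⟩ := p
  obtain ⟨a', b'⟩ := p'
  have : a = a' := hD (congrArg Sigma.fst h')
  subst this
  simpa using h'

theorem surjective_lab_bind (D : DTree E Z) (f : Z → DTree E Z') (hD : Function.Surjective D.lab)
    (hf : Function.Surjective (fun p : Σ z, (f z).Leaves => (f p.1).lab p.2)) :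
    Function.Surjective (D.bind f).lab := by
  intro y
  obtain ⟨⟨z, l⟩, rfl⟩ := hf y
  obtain ⟨l', rfl⟩ := hD z
  refine ⟨(D.bindLeaves f).symm ⟨l', l⟩, ?_⟩
  rw [lab_bind, Equiv.apply_symm_apply]

/-- `D` is not the exceptional tree. -/
def IsNode (D : DTree E Z) : Prop := Nonempty D.rep.tree.Vert

theorem isNode_node (I : Type) [Finite I] (x : E.ext I) (c : I → DTree E Z) :
    (node I x c).IsNode := ⟨none⟩

theorem not_isNode_leg (z : Z) : ¬ (leg z : DTree E Z).IsNode := fun h => h.elim fun v => v.elim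

theorem IsNode.bind {D : DTree E Z} (h : D.IsNode) (f : Z → DTree E Z') : (D.bind f).IsNode := by
  cases D with
  | leg z => exact absurd h (not_isNode_leg z)
  | node I x c => exact isNode_node _ _ _

/-! #### Isomorphisms of decorated trees -/

/-- Decorated trees are isomorphic. -/
inductive Eqv : DTree E Z → DTree E Z → Prop
  | leg (z : Z) : Eqv (leg z) (leg z)
  | node {I J : Type} [Finite I] [Finite J] (e : I ≃ J) (x : E.ext I) (c : I → DTree E Z)
      (c' : J → DTree E Z) (h : ∀ j, Eqv (c (e.symm j)) (c' j)) :
      Eqv (node I x c) (node J (E.extMap e x) c')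

theorem Eqv.refl (D : DTree E Z) : Eqv D D := by
  induction D with
  | leg z => exact .leg z
  | node I x c ih => exact .node (Equiv.refl I) x c c ih

theorem Eqv.bind {D D' : DTree E Z} (h : Eqv D D') {f f' : Z → DTree E Z'}
    (hf : ∀ z, Eqv (f z) (f' z)) : Eqv (D.bind f) (D'.bind f') := by
  induction h with
  | leg z => exact hf z
  | node e x c c' h ih => exact .node e x _ _ ih

/-- Together with `eqv_ofDec_push` this translates between the inductive relation and isomorphisms
that respect labels and decorations. -/
theorem Eqv.exists_iso {D D' : DTree E Z} (h : Eqv D D') :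
    ∃ f : RTree.Iso D.rep.tree D'.rep.tree, (∀ l, D.rep.lab (f.leaves l) = D'.rep.lab l) ∧
      f.push E D.rep.dec = D'.rep.dec := by
  induction h with
  | leg z => exact ⟨(), fun _ => rfl, funext fun v => v.elim⟩
  | node e x c c' h ih =>
    choose f h₁ h₂ using ih
    refine ⟨⟨e, f⟩, ?_, ?_⟩
    · rintro ⟨j, l⟩
      exact h₁ j l
    · funext v
      rcases v with _ | ⟨j, v⟩
      · rfl
      · exact congrFun (h₂ j) v

theorem eqv_ofDec_push : ∀ {T T' : RTree} (f : RTree.Iso T T') (b : T.Leaves → Z)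
    (b' : T'.Leaves → Z) (_ : ∀ l, b (f.leaves l) = b' l) (d : RTree.Dec E T),
    Eqv (ofDec T b d) (ofDec T' b' (f.push E d))
  | RTree.leg, RTree.leg, _, b, b', h, _ => by
    have : b () = b' () := h ()
    simp only [ofDec, this]
    exact .leg _
  | RTree.leg, RTree.node _ _, f, _, _, _, _ => f.elim
  | RTree.node _ _, RTree.leg, f, _, _, _, _ => f.elim
  | RTree.node I c, RTree.node J c', f, b, b', h, d =>
    .node f.rootEquiv d.root _ _ (fun j => eqv_ofDec_push (f.child j) _ _ (fun l => h ⟨j, l⟩)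
      (d.child (f.rootEquiv.symm j)))

/-! #### Linear combinations at a vertex -/

/-- `LinComb a b D D₁ D₂` means that the decorated trees `D`, `D₁`, `D₂` differ only in the
decoration of one vertex, where `D` has the linear combination with coefficients `a` and `b` of
those of `D₁` and `D₂`. -/
inductive LinComb (a b : k) : DTree E Z → DTree E Z → DTree E Z → Prop
  | root {I : Type} [Finite I] (x x₁ x₂ : E.ext I) (hx : x = a • x₁ + b • x₂)
      (c : I → DTree E Z) : LinComb a b (node I x c) (node I x₁ c) (node I x₂ c)
  | child {I : Type} [Finite I] (x : E.ext I) (c c₁ c₂ : I → DTree E Z) (i : I)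
      (h : LinComb a b (c i) (c₁ i) (c₂ i)) (h₁ : ∀ j, j ≠ i → c₁ j = c j)
      (h₂ : ∀ j, j ≠ i → c₂ j = c j) : LinComb a b (node I x c) (node I x c₁) (node I x c₂)

theorem LinComb.bind_left {a b : k} {D D₁ D₂ : DTree E Z} (h : LinComb a b D D₁ D₂)
    (f : Z → DTree E Z') : LinComb a b (D.bind f) (D₁.bind f) (D₂.bind f) := by
  induction h with
  | root x x₁ x₂ hx c => exact .root x x₁ x₂ hx _
  | child x c c₁ c₂ i h h₁ h₂ ih =>
    exact .child x _ _ _ i ih (fun j hj => by rw [h₁ j hj]) (fun j hj => by rw [h₂ j hj])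

/-- Injectivity of the labels ensures that the varied tree is grafted exactly once; with repeated
labels the result would vary at several vertices. -/
theorem LinComb.bind_right {a b : k} (D : DTree E Z) {f f₁ f₂ : Z → DTree E Z'} (l : D.Leaves)
    (hD : Function.Injective D.lab)
    (h : LinComb a b (f (D.lab l)) (f₁ (D.lab l)) (f₂ (D.lab l)))
    (h₁ : ∀ z, z ≠ D.lab l → f₁ z = f z) (h₂ : ∀ z, z ≠ D.lab l → f₂ z = f z) :
    LinComb a b (D.bind f) (D.bind f₁) (D.bind f₂) := by
  induction D with
  | leg z => exact h
  | node I x c ih =>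
    obtain ⟨i, l⟩ := l
    have hne : ∀ j, j ≠ i → ∀ l', (c j).lab l' ≠ (c i).lab l := fun j hj l' h =>
      hj (congrArg Sigma.fst (@hD ⟨j, l'⟩ ⟨i, l⟩ h))
    refine .child x _ _ _ i (ih i l ?_ h h₁ h₂) ?_ ?_
    · intro l₁ l₂ h
      have := @hD ⟨i, l₁⟩ ⟨i, l₂⟩ h
      exact eq_of_heq (Sigma.mk.inj this).2
    · exact fun j hj => bind_congr _ (fun l' => h₁ _ (hne j hj l'))
    · exact fun j hj => bind_congr _ (fun l' => h₂ _ (hne j hj l'))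

theorem linComb_ofDec {a b : k} : ∀ {T : RTree} (lab : T.Leaves → Z) {d d₁ d₂ : RTree.Dec E T}
    (v : T.Vert) (_ : d v = a • d₁ v + b • d₂ v) (_ : ∀ w, w ≠ v → d₁ w = d w)
    (_ : ∀ w, w ≠ v → d₂ w = d w), LinComb a b (ofDec T lab d) (ofDec T lab d₁) (ofDec T lab d₂)
  | RTree.leg, _, _, _, _, v, _, _, _ => v.elim
  | RTree.node I c, lab, d, d₁, d₂, none, hv, h₁, h₂ => by
    have hr : d.root = a • d₁.root + b • d₂.root := hv
    have e₁ : ∀ i, d₁.child i = d.child i := fun i =>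
      funext fun v => h₁ _ (Option.some_ne_none _)
    have e₂ : ∀ i, d₂.child i = d.child i := fun i =>
      funext fun v => h₂ _ (Option.some_ne_none _)
    simp only [ofDec, e₁, e₂]
    exact .root _ _ _ hr _
  | RTree.node I c, lab, d, d₁, d₂, some ⟨i, v⟩, hv, h₁, h₂ => by
    have r₁ : d₁.root = d.root := h₁ none (fun h => by cases h)
    have r₂ : d₂.root = d.root := h₂ none (fun h => by cases h)
    simp only [ofDec, r₁, r₂]
    refine .child _ _ _ _ i (linComb_ofDec (d := d.child i) (d₁ := d₁.child i)
      (d₂ := d₂.child i) _ v hv (fun w hw => h₁ _ (fun h => hw (by cases h; rfl)))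
      (fun w hw => h₂ _ (fun h => hw (by cases h; rfl)))) ?_ ?_
    · intro j hj
      refine congrArg _ ?_
      exact funext fun w => h₁ _ (fun h => hj (by cases h; rfl))
    · intro j hj
      refine congrArg _ ?_
      exact funext fun w => h₂ _ (fun h => hj (by cases h; rfl))

/-- The three trees have the same underlying tree and labels, so the relation can be restated for
decorations of one tree, where multilinearity of the tensor product applies. -/
theorem LinComb.exists_dec {a b : k} {D D₁ D₂ : DTree E Z} (h : LinComb a b D D₁ D₂) :
    ∃ (v : D.rep.tree.Vert) (d₁ d₂ : RTree.Dec E D.rep.tree),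
      D.rep.dec v = a • d₁ v + b • d₂ v ∧ (∀ w, w ≠ v → d₁ w = D.rep.dec w) ∧
      (∀ w, w ≠ v → d₂ w = D.rep.dec w) ∧ D₁ = ofDec D.rep.tree D.rep.lab d₁ ∧
      D₂ = ofDec D.rep.tree D.rep.lab d₂ := by
  classical
  induction h with
  | @root I _ x x₁ x₂ hx c =>
    refine ⟨none, (node I x₁ c).rep.dec, (node I x₂ c).rep.dec, hx, ?_, ?_,
      (ofDec_rep (node I x₁ c)).symm, (ofDec_rep (node I x₂ c)).symm⟩
    · rintro (_ | ⟨j, w⟩) hw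
      · exact absurd rfl hw
      · rfl
    · rintro (_ | ⟨j, w⟩) hw
      · exact absurd rfl hw
      · rfl
  | @child I _ x c c₁ c₂ i h h₁ h₂ ih =>
    obtain ⟨v, d₁, d₂, hv, hw₁, hw₂, e₁, e₂⟩ := ih
    have key : ∀ (c₁ : I → DTree E Z) (_ : ∀ j, j ≠ i → c₁ j = c j)
        (d₁ : RTree.Dec E (c i).rep.tree) (_ : c₁ i = ofDec (c i).rep.tree (c i).rep.lab d₁),
        node I x c₁ = ofDec (node I x c).rep.tree (node I x c).rep.lab
          (RTree.Dec.cons (c := fun i => (c i).rep.tree) x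
            (Function.update (fun i => (c i).rep.dec) i d₁)) := by
      intro c₁ h₁ d₁ e₁
      change node I x c₁ = node I x _
      congr 1
      funext j
      by_cases hj : j = i
      · subst hj
        rw [e₁]
        refine congrArg _ ?_
        exact (Function.update_self (f := fun i => (c i).rep.dec) j d₁).symm
      · rw [h₁ j hj]
        refine (ofDec_rep (c j)).symm.trans ?_
        refine congrArg _ ?_
        exact (Function.update_of_ne hj d₁ (fun i => (c i).rep.dec)).symm
    refine ⟨some ⟨i, v⟩, _, _, ?_, ?_, ?_, key c₁ h₁ d₁ e₁, key c₂ h₂ d₂ e₂⟩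
    · change (c i).rep.dec v = a • Function.update (fun i => (c i).rep.dec) i d₁ i v +
        b • Function.update (fun i => (c i).rep.dec) i d₂ i v
      rw [Function.update_self, Function.update_self]
      exact hv
    · rintro (_ | ⟨j, w⟩) hw
      · rfl
      · by_cases hj : j = i
        · subst hj
          have : w ≠ v := fun h => hw (by rw [h])
          change Function.update (fun i => (c i).rep.dec) j d₁ j w = (c j).rep.dec w
          rw [Function.update_self]
          exact hw₁ w this
        · change Function.update (fun i => (c i).rep.dec) i d₁ j w = (c j).rep.dec w
          rw [Function.update_of_ne hj]
    · rintro (_ | ⟨j, w⟩) hw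
      · rfl
      · by_cases hj : j = i
        · subst hj
          have : w ≠ v := fun h => hw (by rw [h])
          change Function.update (fun i => (c i).rep.dec) j d₂ j w = (c j).rep.dec w
          rw [Function.update_self]
          exact hw₂ w this
        · change Function.update (fun i => (c i).rep.dec) i d₂ j w = (c j).rep.dec w
          rw [Function.update_of_ne hj]

end DTree

end

/-! ### Linear maps out of colimits over trees -/

section
variable {k : Type u} [CommRing k] {P : TreeClass} {E : SigmaMod k}

theorem treeElem_push {n : ℕ} {X Y : LTree P n} (f : X ⟶ Y) (d : RTree.Dec E X.tree) :
    treeElem Y (f.1.push E d) = treeElem X d := by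
  have h := congrArg (fun φ => φ.hom (PiTensorProduct.tprod k d)) (colimit.w (treeTensor P E n) f)
  refine Eq.trans ?_ h
  exact congrArg (colimit.ι (treeTensor P E n) Y).hom (treeTensor_map_aux f.1 d).symm

/-- Additivity and homogeneity at a vertex are combined in one formula. The three decorations agree
away from `v`, so they are updates of `d`, and the tensor product is multilinear. -/
theorem treeElem_linear {n : ℕ} (X : LTree P n) (a b : k) {d d₁ d₂ : RTree.Dec E X.tree}
    (v : X.tree.Vert) (hv : d v = a • d₁ v + b • d₂ v) (h₁ : ∀ w, w ≠ v → d₁ w = d w)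
    (h₂ : ∀ w, w ≠ v → d₂ w = d w) :
    treeElem X d = a • treeElem X d₁ + b • treeElem X d₂ := by
  classical
  have e₁ : d₁ = Function.update d v (d₁ v) := by
    funext w
    by_cases hw : w = v
    · subst hw; simp
    · rw [Function.update_of_ne hw, h₁ w hw]
  have e₂ : d₂ = Function.update d v (d₂ v) := by
    funext w
    by_cases hw : w = v
    · subst hw; simp
    · rw [Function.update_of_ne hw, h₂ w hw]
  have e : d = Function.update d v (a • d₁ v + b • d₂ v) := by rw [← hv, Function.update_eq_self]
  have h : PiTensorProduct.tprod k d =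
      a • PiTensorProduct.tprod k d₁ + b • PiTensorProduct.tprod k d₂ := by
    rw [e, e₁, e₂, MultilinearMap.map_update_add, MultilinearMap.map_update_smul,
      MultilinearMap.map_update_smul]
    simp
  unfold treeElem
  rw [h]
  exact ((colimit.ι (treeTensor P E n) X).hom.map_add _ _).trans
    (congrArg₂ (· + ·) (map_smul _ _ _) (map_smul _ _ _))

/-- Decorated trees span the colimit. -/
theorem treeElem_induction {n : ℕ} {p : ((treeFunctor P k).obj E).obj n → Prop}
    (h : ∀ (X : LTree P n) (d : RTree.Dec E X.tree), p (treeElem X d)) (h0 : p 0)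
    (hadd : ∀ x y, p x → p y → p (x + y)) (hsmul : ∀ (a : k) x, p x → p (a • x)) (x) : p x := by
  have key : ∀ x, x ∈ Submodule.span k
      (Set.range fun p : Σ X : LTree P n, RTree.Dec E X.tree => treeElem p.1 p.2) := by
    set W := Submodule.span k
      (Set.range fun p : Σ X : LTree P n, RTree.Dec E X.tree => treeElem p.1 p.2) with hW
    -- The quotient by the span of all decorated trees receives the zero map from every E(T), hence
    -- from the colimit.
    have h0 : (ModuleCat.ofHom W.mkQ : (colimit (treeTensor P E n) : ModuleCat.{u} k) ⟶
        ModuleCat.of k (((treeFunctor P k).obj E).obj n ⧸ W)) = ModuleCat.ofHom 0 := by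
      apply colimit.hom_ext
      intro X
      apply ModuleCat.hom_ext
      apply PiTensorProduct.ext
      ext1 d
      exact (Submodule.Quotient.mk_eq_zero W).2 (Submodule.subset_span ⟨⟨X, d⟩, rfl⟩)
    intro x
    exact (Submodule.Quotient.mk_eq_zero W).1 (congrArg (fun f => f.hom x) h0)
  refine Submodule.span_induction (p := fun x _ => p x) ?_ h0 (fun x y _ _ => hadd x y)
    (fun a x _ => hsmul a x) (key x)
  rintro _ ⟨⟨X, d⟩, rfl⟩
  exact h X d

/-- The multilinear map given by a function that is linear in every variable. -/
def multilinearOfLinear {M : Type u} [AddCommGroup M] [Module k M] {T : RTree}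
    (F : RTree.Dec E T → M)
    (hF : ∀ (a b : k) (d d₁ d₂ : RTree.Dec E T) (v : T.Vert), d v = a • d₁ v + b • d₂ v →
      (∀ w, w ≠ v → d₁ w = d w) → (∀ w, w ≠ v → d₂ w = d w) → F d = a • F d₁ + b • F d₂) :
    MultilinearMap k (fun v : T.Vert => E.ext (T.inputs v)) M where
  toFun := F
  map_update_add' d v x y := by
    rw [hF 1 1 _ (Function.update d v x) (Function.update d v y) v (by simp)
      (fun w hw => by simp [hw]) (fun w hw => by simp [hw]), one_smul, one_smul]
  map_update_smul' d v c x := by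
    -- A scalar multiple is regarded as a linear combination whose second coefficient is zero.
    rw [hF c 0 _ (Function.update d v x) (Function.update d v x) v (by simp)
      (fun w hw => by simp [hw]) (fun w hw => by simp [hw]), zero_smul, add_zero]

/-- The cocone given by functions on decorations that are invariant under isomorphisms and linear
at every vertex. -/
noncomputable def treeCocone {M : Type u} [AddCommGroup M] [Module k M] {n : ℕ}
    (F : ∀ X : LTree P n, RTree.Dec E X.tree → M)
    (hF : ∀ X (a b : k) (d d₁ d₂ : RTree.Dec E X.tree) (v : X.tree.Vert),
      d v = a • d₁ v + b • d₂ v → (∀ w, w ≠ v → d₁ w = d w) → (∀ w, w ≠ v → d₂ w = d w) →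
      F X d = a • F X d₁ + b • F X d₂)
    (hF' : ∀ (X Y : LTree P n) (f : X ⟶ Y) d, F Y (f.1.push E d) = F X d) :
    Cocone (treeTensor P E n) where
  pt := ModuleCat.of k M
  ι :=
    { app := fun X => ModuleCat.ofHom (PiTensorProduct.lift (multilinearOfLinear (F X) (hF X)))
      naturality := fun X Y f => by
        apply ModuleCat.hom_ext
        apply PiTensorProduct.ext
        ext1 d
        refine (congrArg (PiTensorProduct.lift (multilinearOfLinear (F Y) (hF Y)))
          (treeTensor_map_aux f.1 d)).trans ?_
        refine (PiTensorProduct.lift.tprod _).trans ?_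
        refine (hF' X Y f d).trans ?_
        exact (PiTensorProduct.lift.tprod (φ := multilinearOfLinear (F X) (hF X)) d).symm }

/-- A linear map on the colimit, given by functions on decorations that are invariant under
isomorphisms and linear at every vertex. -/
noncomputable def treeLift {M : Type u} [AddCommGroup M] [Module k M] {n : ℕ}
    (F : ∀ X : LTree P n, RTree.Dec E X.tree → M)
    (hF : ∀ X (a b : k) (d d₁ d₂ : RTree.Dec E X.tree) (v : X.tree.Vert),
      d v = a • d₁ v + b • d₂ v → (∀ w, w ≠ v → d₁ w = d w) → (∀ w, w ≠ v → d₂ w = d w) →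
      F X d = a • F X d₁ + b • F X d₂)
    (hF' : ∀ (X Y : LTree P n) (f : X ⟶ Y) d, F Y (f.1.push E d) = F X d) :
    ((treeFunctor P k).obj E).obj n →ₗ[k] M :=
  (colimit.desc (treeTensor P E n) (treeCocone F hF hF')).hom

theorem treeLift_treeElem {M : Type u} [AddCommGroup M] [Module k M] {n : ℕ}
    (F : ∀ X : LTree P n, RTree.Dec E X.tree → M) (hF) (hF') (X : LTree P n)
    (d : RTree.Dec E X.tree) : treeLift F hF hF' (treeElem X d) = F X d := by
  have h : (colimit.ι (treeTensor P E n) X ≫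
      colimit.desc (treeTensor P E n) (treeCocone F hF hF')).hom (PiTensorProduct.tprod k d) =
      ((treeCocone F hF hF').ι.app X).hom (PiTensorProduct.tprod k d) := by
    rw [colimit.ι_desc]
  exact h.trans (PiTensorProduct.lift.tprod (φ := multilinearOfLinear (F X) (hF X)) d)

/-! ### The classes of decorated trees -/

/-- The tree belongs to `P`, and its leaves are bijectively labeled by `Z`. -/
def Rep.Good (P : TreeClass) {Z : Type} (r : Rep E Z) : Prop :=
  P.Mem r.tree ∧ Function.Bijective r.lab

/-- The class of a decorated tree the leaves of which are bijectively labeled by `Z`. -/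
noncomputable def Rep.cl (P : TreeClass) {Z : Type} (r : Rep E Z) :
    ((treeFunctor P k).obj E).ext Z :=
  open Classical in
  if h : r.Good P then treeElemExt r.tree h.1 (Equiv.ofBijective r.lab h.2) r.dec else 0

namespace DTree
variable {Z Z' : Type}

/-- The tree `D` belongs to `P`, and its leaves are bijectively labeled by `Z`. -/
def Good (P : TreeClass) (D : DTree E Z) : Prop := D.rep.Good P

/-- The class of a decorated tree the leaves of which are bijectively labeled by `Z`. -/
noncomputable def cl (P : TreeClass) (D : DTree E Z) : ((treeFunctor P k).obj E).ext Z :=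
  D.rep.cl P

theorem Good.mem {D : DTree E Z} (h : D.Good P) : P.Mem D.rep.tree := h.1

theorem Good.bijective {D : DTree E Z} (h : D.Good P) : Function.Bijective D.lab := h.2

theorem cl_of_not_good {D : DTree E Z} (h : ¬ D.Good P) : D.cl P = 0 := dif_neg h

theorem Good.cl_eq {D : DTree E Z} (h : D.Good P) :
    D.cl P = treeElemExt D.rep.tree h.mem (Equiv.ofBijective D.lab h.bijective) D.rep.dec :=
  dif_pos h

theorem good_ofDec {T : RTree} (hT : P.Mem T) (b : T.Leaves ≃ Z) (d : RTree.Dec E T) :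
    (ofDec T b d).Good P := by
  rw [Good, rep_ofDec]
  exact ⟨hT, b.bijective⟩

theorem cl_ofDec {T : RTree} (hT : P.Mem T) (b : T.Leaves ≃ Z) (d : RTree.Dec E T) :
    (ofDec T b d).cl P = treeElemExt T hT b d := by
  rw [cl, rep_ofDec, Rep.cl, dif_pos ⟨hT, b.bijective⟩]
  congr 1
  exact Equiv.ext fun _ => rfl

theorem cl_ofDec' {T : RTree} (hT : P.Mem T) (b : T.Leaves → Z) (hb : Function.Bijective b)
    (d : RTree.Dec E T) :
    (ofDec T b d).cl P = treeElemExt T hT (Equiv.ofBijective b hb) d :=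
  cl_ofDec hT (Equiv.ofBijective b hb) d

theorem Good.exists_ofDec {D : DTree E Z} (h : D.Good P) :
    ∃ (T : RTree) (_ : P.Mem T) (b : T.Leaves ≃ Z) (d : RTree.Dec E T), D = ofDec T b d :=
  ⟨D.rep.tree, h.mem, Equiv.ofBijective D.lab h.bijective, D.rep.dec, (ofDec_rep D).symm⟩

theorem treeElemExt_apply {T : RTree} (hT : P.Mem T) (b : T.Leaves ≃ Z) (d : RTree.Dec E T)
    (n : ℕ) (e : Fin n ≃ Z) :
    (treeElemExt (k := k) T hT b d).1 n e = treeElem ⟨T, b.trans e.symm, hT⟩ d := rfl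

theorem Eqv.good {D D' : DTree E Z} (h : Eqv D D') (hD : D.Good P) : D'.Good P := by
  obtain ⟨f, hf, -⟩ := h.exists_iso
  refine ⟨P.mem_iso f hD.1, ?_⟩
  have : D'.rep.lab = D.rep.lab ∘ f.leaves := funext fun l => (hf l).symm
  rw [this]
  exact hD.bijective.comp f.leaves.bijective

theorem Eqv.cl_eq_of_good {D D' : DTree E Z} (h : Eqv D D') (hD : D.Good P) :
    D.cl P = D'.cl P := by
  have hD' := h.good hD
  obtain ⟨f, hf, hd⟩ := h.exists_iso
  rw [hD.cl_eq, hD'.cl_eq]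
  apply Subtype.ext
  funext n e
  rw [treeElemExt_apply, treeElemExt_apply, ← hd]
  refine (treeElem_push (X := ⟨_, _, hD.1⟩) (Y := ⟨_, _, hD'.1⟩) ⟨f, fun l => ?_⟩ _).symm
  exact congrArg e.symm (hf l)

theorem LinComb.good_iff {a b : k} {D D₁ D₂ : DTree E Z} (h : LinComb a b D D₁ D₂) :
    (D₁.Good P ↔ D.Good P) ∧ (D₂.Good P ↔ D.Good P) := by
  obtain ⟨v, d₁, d₂, -, -, -, rfl, rfl⟩ := h.exists_dec
  rw [Good, Good, Good, rep_ofDec, rep_ofDec]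
  exact ⟨Iff.rfl, Iff.rfl⟩

/-- The three trees are good or bad simultaneously; in the bad case all classes are zero by
convention, so the formula holds for every tree. -/
theorem LinComb.cl_eq {a b : k} {D D₁ D₂ : DTree E Z} (h : LinComb a b D D₁ D₂) :
    D.cl P = a • D₁.cl P + b • D₂.cl P := by
  by_cases hD : D.Good P
  · obtain ⟨v, d₁, d₂, hv, h₁, h₂, rfl, rfl⟩ := h.exists_dec
    rw [hD.cl_eq, cl_ofDec' hD.mem _ hD.bijective, cl_ofDec' hD.mem _ hD.bijective]
    apply Subtype.ext
    funext n e
    exact treeElem_linear _ a b v hv h₁ h₂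
  · rw [cl_of_not_good hD, cl_of_not_good (mt h.good_iff.1.1 hD),
      cl_of_not_good (mt h.good_iff.2.1 hD)]
    simp

theorem good_map_iff (D : DTree E Z) (φ : Z ≃ Z') :
    (D.map φ).Good P ↔ D.Good P := by
  rw [Good, Good, rep_map]
  exact and_congr_right fun _ => φ.bijective.of_comp_iff' _

theorem extMap_cl (D : DTree E Z) (φ : Z ≃ Z') :
    ((treeFunctor P k).obj E).extMap φ (D.cl P) = (D.map φ).cl P := by
  by_cases hD : D.Good P
  · have : D.map φ =
        ofDec D.rep.tree ((Equiv.ofBijective D.lab hD.bijective).trans φ) D.rep.dec :=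
      D.bind_eq_ofDec _ _ (fun _ => rfl)
    rw [this, cl_ofDec hD.mem, hD.cl_eq]
    rfl
  · rw [cl_of_not_good hD, cl_of_not_good (mt (D.good_map_iff φ).1 hD), map_zero]

/-- The class of a decorated tree with leaves labeled by `Fin n`. -/
noncomputable def toObj (P : TreeClass) {n : ℕ} (D : DTree E (Fin n)) :
    ((treeFunctor P k).obj E).obj n :=
  (D.cl P).1 n (Equiv.refl (Fin n))

theorem cl_apply (D : DTree E Z) {n : ℕ} (e : Fin n ≃ Z) :
    (D.cl P).1 n e = (D.map e.symm).toObj P := by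
  rw [toObj, ← extMap_cl, SigmaMod.extMap_apply]
  rfl

theorem toObj_ofDec {n : ℕ} (X : LTree P n) (d : RTree.Dec E X.tree) :
    (ofDec X.tree X.label d).toObj P = treeElem X d := by
  rw [toObj, cl_ofDec X.mem X.label]
  rfl

/-- The inverse appears because the action is from the right: the leaf with label `σ i` receives the
label `i`. -/
theorem act_toObj {n : ℕ} (σ : Equiv.Perm (Fin n)) (D : DTree E (Fin n)) :
    ((treeFunctor P k).obj E).act σ (D.toObj P) = (D.map σ.symm).toObj P := by
  rw [toObj, ← (D.cl P).2, ← cl_apply]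
  rfl

end DTree

theorem DTree.Eqv.toObj_eq {n : ℕ} {D D' : DTree E (Fin n)} (h : Eqv D D') (hD : D.Good P) :
    D.toObj P = D'.toObj P := by
  rw [toObj, h.cl_eq_of_good hD, toObj]

theorem DTree.LinComb.toObj_eq {n : ℕ} {a b : k} {D D₁ D₂ : DTree E (Fin n)}
    (h : LinComb a b D D₁ D₂) : D.toObj P = a • D₁.toObj P + b • D₂.toObj P := by
  rw [toObj, h.cl_eq]
  rfl

/-- A linear map on the colimit, given by a function on decorated trees. -/
noncomputable def dLift {M : Type u} [AddCommGroup M] [Module k M] {n : ℕ}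
    (F : DTree E (Fin n) → M)
    (hF : ∀ (a b : k) D D₁ D₂, D.Good P → DTree.LinComb a b D D₁ D₂ → F D = a • F D₁ + b • F D₂)
    (hF' : ∀ D D', D.Good P → DTree.Eqv D D' → F D = F D') :
    ((treeFunctor P k).obj E).obj n →ₗ[k] M :=
  treeLift (fun X d => F (DTree.ofDec X.tree X.label d))
    (fun X a b _ _ _ v hv h₁ h₂ => hF a b _ _ _ (DTree.good_ofDec X.mem X.label _)
      (DTree.linComb_ofDec X.label v hv h₁ h₂))
    (fun X Y f _ => (hF' _ _ (DTree.good_ofDec X.mem X.label _)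
      (DTree.eqv_ofDec_push f.1 X.label Y.label f.2 _)).symm)

theorem dLift_toObj {M : Type u} [AddCommGroup M] [Module k M] {n : ℕ}
    (F : DTree E (Fin n) → M) (hF) (hF') (D : DTree E (Fin n)) (hD : D.Good P) :
    dLift F hF hF' (D.toObj P) = F D := by
  obtain ⟨T, hT, b, d, rfl⟩ := hD.exists_ofDec
  rw [DTree.toObj_ofDec ⟨T, b, hT⟩ d]
  exact treeLift_treeElem _ _ _ ⟨T, b, hT⟩ d

theorem toObj_induction {n : ℕ} {p : ((treeFunctor P k).obj E).obj n → Prop}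
    (h : ∀ D : DTree E (Fin n), D.Good P → p (D.toObj P)) (h0 : p 0)
    (hadd : ∀ x y, p x → p y → p (x + y)) (hsmul : ∀ (a : k) x, p x → p (a • x)) (x) : p x := by
  refine treeElem_induction (fun X d => ?_) h0 hadd hsmul x
  rw [← DTree.toObj_ofDec]
  exact h _ (DTree.good_ofDec X.mem X.label d)

/-- Stated for functions with a proof of linearity rather than for linear maps, so that multilinear
identities can be reduced to trees in one variable at a time without bundling both sides. -/
theorem toObj_ext {M : Type*} [AddCommGroup M] [Module k M] {n : ℕ}
    {x : ((treeFunctor P k).obj E).obj n} {F G : ((treeFunctor P k).obj E).obj n → M}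
    (h : ∀ D : DTree E (Fin n), D.Good P → F (D.toObj P) = G (D.toObj P)) (hF : IsLinearMap k F)
    (hG : IsLinearMap k G) : F x = G x := by
  refine toObj_induction (p := fun x => F x = G x) h ?_ ?_ ?_ x
  · rw [hF.map_zero, hG.map_zero]
  · intro x y hx hy
    rw [hF.map_add, hG.map_add, hx, hy]
  · intro a x hx
    rw [hF.map_smul, hG.map_smul, hx]

theorem toObj_hom_ext {M : Type*} [AddCommGroup M] [Module k M] {n : ℕ}
    {φ ψ : ((treeFunctor P k).obj E).obj n →ₗ[k] M}
    (h : ∀ D : DTree E (Fin n), D.Good P → φ (D.toObj P) = ψ (D.toObj P)) : φ = ψ := by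
  ext x
  exact toObj_ext h φ.isLinear ψ.isLinear

end

/-! ### Free operads -/

/-- A class that consists of all trees with at least one vertex, and possibly the exceptional
tree. -/
class TreeClass.Full (P : TreeClass) : Prop where
  mem_iff : ∀ T : RTree, P.Mem T ↔ P.Mem RTree.leg ∨ Nonempty T.Vert

instance : ordinaryTrees.Full where
  mem_iff _ := ⟨Or.inr, fun h => h.elim (fun h => h.elim fun v => v.elim) id⟩

instance : allTrees.Full where
  mem_iff _ := ⟨fun _ => Or.inl trivial, fun _ => trivial⟩

section
variable {k : Type u} [CommRing k] {E : SigmaMod k}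

/-! ### Grafting a decorated tree onto a single leaf. -/

namespace DTree
variable {X J L W X' J' Y Y' Z : Type}

open Classical in
/-- The trees to be grafted onto the leaves of a tree in order to graft `D` onto the leaf with
label `i`. -/
noncomputable def graftFun (i : X) (w : {x : X // x ≠ i} ⊕ J → Y) (D : DTree E J) (x : X) :
    DTree E Y :=
  if h : x = i then D.map (fun j => w (Sum.inr j)) else leg (w (Sum.inl ⟨x, h⟩))

theorem graftFun_self (i : X) (w : {x : X // x ≠ i} ⊕ J → Y) (D : DTree E J) :
    graftFun i w D i = D.map (fun j => w (Sum.inr j)) := dif_pos rfl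

theorem graftFun_of_ne {i : X} (w : {x : X // x ≠ i} ⊕ J → Y) (D : DTree E J) {x : X}
    (h : x ≠ i) : graftFun i w D x = leg (w (Sum.inl ⟨x, h⟩)) := dif_neg h

/-- Grafting of `D'` onto the leaf of `D` with label `i`. -/
noncomputable def graftAt (i : X) (w : {x : X // x ≠ i} ⊕ J → Y) (D : DTree E X)
    (D' : DTree E J) : DTree E Y :=
  D.bind (graftFun i w D')

theorem injective_lab_graftFun (i : X) {w : {x : X // x ≠ i} ⊕ J → Y} (hw : Function.Injective w)
    {D : DTree E J} (hD : Function.Injective D.lab) :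
    Function.Injective (fun p : Σ x, (graftFun i w D x).Leaves => (graftFun i w D p.1).lab p.2) := by
  -- The leaf types of `graftFun i w D x` depend on a case distinction. For an arbitrary family `r`
  -- of representatives the defining equations can be rewritten without dependency problems.
  have key : ∀ r : ∀ x, Rep E Y, (∀ h : True, r i = ⟨D.rep.tree, fun l => w (Sum.inr (D.lab l)), D.rep.dec⟩) →
      (∀ x (h : x ≠ i), r x = Rep.leg (w (Sum.inl ⟨x, h⟩))) →
      Function.Injective (fun p : Σ x, (r x).tree.Leaves => (r p.1).lab p.2) := by
    intro r h₁ h₂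
    have hi : ∀ l : (r i).tree.Leaves, ∃ l', (r i).lab l = w (Sum.inr (D.lab l')) := by
      rw [h₁ trivial]
      exact fun l => ⟨l, rfl⟩
    have hii : Function.Injective (r i).lab := by
      rw [h₁ trivial]
      exact hw.comp (Sum.inr_injective.comp hD)
    have hx : ∀ x (h : x ≠ i) (l : (r x).tree.Leaves), (r x).lab l = w (Sum.inl ⟨x, h⟩) := by
      intro x h
      rw [h₂ x h]
      exact fun _ => rfl
    have hxx : ∀ x, x ≠ i → ∀ l l' : (r x).tree.Leaves, l = l' := by
      intro x h
      rw [h₂ x h]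
      exact fun _ _ => rfl
    rintro ⟨x, l⟩ ⟨x', l'⟩ h
    simp only at h
    by_cases hxi : x = i
    · subst hxi
      by_cases hxi' : x' = x
      · subst hxi'
        rw [hii h]
      · obtain ⟨l₁, hl₁⟩ := hi l
        rw [hl₁, hx x' hxi'] at h
        exact absurd (hw h) (by simp)
    · by_cases hxi' : x' = i
      · subst hxi'
        obtain ⟨l₁, hl₁⟩ := hi l'
        rw [hl₁, hx x hxi] at h
        exact absurd (hw h) (by simp)
      · rw [hx x hxi, hx x' hxi'] at h
        have := Sum.inl_injective (hw h)
        simp only [Subtype.mk.injEq] at this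
        subst this
        rw [hxx x hxi l l']
  refine key (fun x => (graftFun i w D x).rep) (fun _ => ?_) (fun x h => ?_)
  · simp only [graftFun_self, rep_map]
  · simp only [graftFun_of_ne w D h]
    rfl

theorem injective_lab_graftAt {i : X} {w : {x : X // x ≠ i} ⊕ J → Y} (hw : Function.Injective w)
    {D : DTree E X} {D' : DTree E J} (hD : Function.Injective D.lab)
    (hD' : Function.Injective D'.lab) : Function.Injective (graftAt i w D D').lab :=
  D.injective_lab_bind _ hD (injective_lab_graftFun i hw hD')

theorem exists_lab_map (f : X → Y) (D : DTree E X) (l : D.Leaves) :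
    ∃ l' : (D.map f).Leaves, (D.map f).lab l' = f (D.lab l) := by
  have : ∀ r : Rep E Y, r = ⟨D.rep.tree, fun l => f (D.lab l), D.rep.dec⟩ →
      ∃ l', r.lab l' = f (D.lab l) := by
    rintro _ rfl
    exact ⟨l, rfl⟩
  exact this _ (rep_map D f)

theorem surjective_lab_graftAt {i : X} {w : {x : X // x ≠ i} ⊕ J → Y} (hw : Function.Surjective w)
    {D : DTree E X} {D' : DTree E J} (hD : Function.Surjective D.lab)
    (hD' : Function.Surjective D'.lab) : Function.Surjective (graftAt i w D D').lab := by
  refine D.surjective_lab_bind _ hD ?_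
  intro y
  obtain ⟨⟨x, hx⟩ | j, rfl⟩ := hw y
  · have : ∃ l : (graftFun i w D' x).Leaves, (graftFun i w D' x).lab l = w (Sum.inl ⟨x, hx⟩) := by
      rw [graftFun_of_ne w D' hx]
      exact ⟨(), rfl⟩
    obtain ⟨l, hl⟩ := this
    exact ⟨⟨x, l⟩, hl⟩
  · obtain ⟨l, rfl⟩ := hD' j
    have : ∃ l' : (graftFun i w D' i).Leaves,
        (graftFun i w D' i).lab l' = w (Sum.inr (D'.lab l)) := by
      rw [graftFun_self]
      exact exists_lab_map _ D' l
    obtain ⟨l', hl'⟩ := this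
    exact ⟨⟨i, l'⟩, hl'⟩

/-- Either the exceptional tree belongs to a full class, and then every tree does, or the given tree
has a root vertex, which survives grafting. -/
theorem mem_bind {P : TreeClass} [hP : P.Full] {D : DTree E X} (hD : P.Mem D.rep.tree)
    (f : X → DTree E Y) : P.Mem (D.bind f).rep.tree := by
  rw [hP.mem_iff] at hD ⊢
  exact hD.imp_right fun h => IsNode.bind h f

theorem Good.graftAt {P : TreeClass} [P.Full] {i : X} {w : {x : X // x ≠ i} ⊕ J → Y}
    (hw : Function.Bijective w) {D : DTree E X} {D' : DTree E J} (hD : D.Good P) (hD' : D'.Good P) :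
    (graftAt i w D D').Good P :=
  ⟨mem_bind hD.mem _, injective_lab_graftAt hw.1 hD.bijective.1 hD'.bijective.1,
    surjective_lab_graftAt hw.2 hD.bijective.2 hD'.bijective.2⟩

theorem Eqv.graftAt (i : X) (w : {x : X // x ≠ i} ⊕ J → Y) {D D₁ : DTree E X}
    {D' D₁' : DTree E J} (h : Eqv D D₁) (h' : Eqv D' D₁') :
    Eqv (graftAt i w D D') (DTree.graftAt i w D₁ D₁') := by
  refine h.bind fun x => ?_
  by_cases hx : x = i
  · subst hx
    rw [graftFun_self, graftFun_self]
    exact h'.bind fun _ => .leg _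
  · rw [graftFun_of_ne w _ hx, graftFun_of_ne w _ hx]
    exact .leg _

theorem LinComb.graftAt_left {a b : k} (i : X) (w : {x : X // x ≠ i} ⊕ J → Y)
    {D D₁ D₂ : DTree E X} (h : LinComb a b D D₁ D₂) (D' : DTree E J) :
    LinComb a b (graftAt i w D D') (graftAt i w D₁ D') (graftAt i w D₂ D') :=
  h.bind_left _

theorem LinComb.graftAt_right {a b : k} (i : X) (w : {x : X // x ≠ i} ⊕ J → Y) (D : DTree E X)
    (hD : Function.Bijective D.lab) {D' D₁ D₂ : DTree E J} (h : LinComb a b D' D₁ D₂) :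
    LinComb a b (graftAt i w D D') (graftAt i w D D₁) (graftAt i w D D₂) := by
  obtain ⟨l, rfl⟩ := hD.2 i
  refine LinComb.bind_right D l hD.1 ?_ ?_ ?_
  · rw [graftFun_self, graftFun_self, graftFun_self]
    exact h.bind_left _
  · intro z hz
    rw [graftFun_of_ne w _ hz, graftFun_of_ne w _ hz]
  · intro z hz
    rw [graftFun_of_ne w _ hz, graftFun_of_ne w _ hz]

/-- Naturality of grafting in all labels. It yields the equivariance axiom and the passage from
numbered leaves to arbitrary finite sets. -/
theorem graftAt_map {i : X} {w : {x : X // x ≠ i} ⊕ J → Y} {i' : X'}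
    {w' : {x : X' // x ≠ i'} ⊕ J' → Y'} (f : X → X') (hf : Function.Injective f) (g : J → J')
    (φ : Y → Y') (hi : f i = i')
    (h₁ : ∀ x hx hx', w' (Sum.inl ⟨f x, hx'⟩) = φ (w (Sum.inl ⟨x, hx⟩)))
    (h₂ : ∀ j, w' (Sum.inr (g j)) = φ (w (Sum.inr j))) (D : DTree E X) (D' : DTree E J) :
    graftAt i' w' (D.map f) (D'.map g) = (graftAt i w D D').map φ := by
  subst hi
  rw [graftAt, graftAt, map_bind, bind_map]
  congr 1
  funext x
  by_cases hx : x = i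
  · subst hx
    rw [graftFun_self, graftFun_self, map_map, map_map]
    simp only [h₂]
  · rw [graftFun_of_ne w _ hx, graftFun_of_ne w' _ (hf.ne hx), h₁ x hx]
    rfl

/-- By `bind_assoc` both sides graft a family of trees onto `x`, and the families are compared label
by label: at `i₁`, at `i₂`, and elsewhere. No induction over trees is needed. -/
theorem graftAt_parallel {Y₁ Y₂ : Type} {i₁ i₂ : X} (hi : i₁ ≠ i₂)
    (e₁ : {x : X // x ≠ i₁} ⊕ J → Y₁) (e₂ : {x : X // x ≠ i₂} ⊕ L → Y₂)
    (he₁ : Function.Injective e₁) (he₂ : Function.Injective e₂) {k₁ : Y₁} {k₂ : Y₂}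
    (f₁ : {y : Y₁ // y ≠ k₁} ⊕ L → Z) (f₂ : {y : Y₂ // y ≠ k₂} ⊕ J → Z)
    (hk₁ : ∀ h, e₁ (Sum.inl ⟨i₂, h⟩) = k₁) (hk₂ : ∀ h, e₂ (Sum.inl ⟨i₁, h⟩) = k₂)
    (h₀ : ∀ x hx₁ hx₂ h h', f₁ (Sum.inl ⟨e₁ (Sum.inl ⟨x, hx₁⟩), h⟩) =
      f₂ (Sum.inl ⟨e₂ (Sum.inl ⟨x, hx₂⟩), h'⟩))
    (h₁ : ∀ j h, f₁ (Sum.inl ⟨e₁ (Sum.inr j), h⟩) = f₂ (Sum.inr j))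
    (h₂ : ∀ l h, f₁ (Sum.inr l) = f₂ (Sum.inl ⟨e₂ (Sum.inr l), h⟩))
    (x : DTree E X) (y : DTree E J) (z : DTree E L) :
    graftAt k₁ f₁ (graftAt i₁ e₁ x y) z = graftAt k₂ f₂ (graftAt i₂ e₂ x z) y := by
  rw [graftAt, graftAt, graftAt, graftAt, bind_assoc, bind_assoc]
  congr 1
  funext t
  have hr : ∀ j, e₁ (Sum.inr j) ≠ k₁ := fun j h =>
    absurd (he₁ (h.trans (hk₁ hi.symm).symm)) (by simp)
  have hr' : ∀ j, e₂ (Sum.inr j) ≠ k₂ := fun j h =>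
    absurd (he₂ (h.trans (hk₂ hi).symm)) (by simp)
  by_cases ht₁ : t = i₁
  · subst ht₁
    rw [graftFun_self, graftFun_of_ne e₂ z hi, map_bind]
    change _ = graftFun k₂ f₂ y (e₂ (Sum.inl ⟨t, hi⟩))
    rw [hk₂, graftFun_self, map]
    congr 1
    funext j
    rw [graftFun_of_ne f₁ z (hr j), h₁]
  · by_cases ht₂ : t = i₂
    · subst ht₂
      rw [graftFun_self, graftFun_of_ne e₁ y ht₁, map_bind]
      change graftFun k₁ f₁ z (e₁ (Sum.inl ⟨t, ht₁⟩)) = _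
      rw [hk₁, graftFun_self, map]
      congr 1
      funext j
      rw [graftFun_of_ne f₂ y (hr' j), ← h₂]
    · rw [graftFun_of_ne e₁ y ht₁, graftFun_of_ne e₂ z ht₂]
      have n₁ : e₁ (Sum.inl ⟨t, ht₁⟩) ≠ k₁ := fun h =>
        ht₂ (congrArg Subtype.val (Sum.inl_injective (he₁ (h.trans (hk₁ hi.symm).symm))))
      have n₂ : e₂ (Sum.inl ⟨t, ht₂⟩) ≠ k₂ := fun h =>
        ht₁ (congrArg Subtype.val (Sum.inl_injective (he₂ (h.trans (hk₂ hi).symm))))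
      change graftFun k₁ f₁ z _ = graftFun k₂ f₂ y _
      rw [graftFun_of_ne f₁ z n₁, graftFun_of_ne f₂ y n₂, h₀ t ht₁ ht₂]

theorem graftAt_nested {i : X} {j : J} {k₁ : Y}
    (e₁ : {x : X // x ≠ i} ⊕ J → Y) (he₁ : Function.Injective e₁) (f₁ : {y : Y // y ≠ k₁} ⊕ L → Z)
    (e₂ : {x : J // x ≠ j} ⊕ L → W) (f₂ : {x : X // x ≠ i} ⊕ W → Z)
    (hk₁ : e₁ (Sum.inr j) = k₁)
    (h₀ : ∀ x hx h, f₁ (Sum.inl ⟨e₁ (Sum.inl ⟨x, hx⟩), h⟩) = f₂ (Sum.inl ⟨x, hx⟩))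
    (h₁ : ∀ x hx h, f₁ (Sum.inl ⟨e₁ (Sum.inr x), h⟩) = f₂ (Sum.inr (e₂ (Sum.inl ⟨x, hx⟩))))
    (h₂ : ∀ l, f₁ (Sum.inr l) = f₂ (Sum.inr (e₂ (Sum.inr l))))
    (x : DTree E X) (y : DTree E J) (z : DTree E L) :
    graftAt k₁ f₁ (graftAt i e₁ x y) z = graftAt i f₂ x (graftAt j e₂ y z) := by
  rw [graftAt, graftAt, graftAt, bind_assoc]
  congr 1
  funext t
  by_cases ht : t = i
  · subst ht
    rw [graftFun_self, graftFun_self, graftAt, map_bind, bind_map]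
    congr 1
    funext s
    by_cases hs : s = j
    · subst hs
      rw [hk₁, graftFun_self, graftFun_self, map_map]
      simp only [h₂]
    · have n : e₁ (Sum.inr s) ≠ k₁ := fun h =>
        hs (Sum.inr_injective (he₁ (h.trans hk₁.symm)))
      rw [graftFun_of_ne f₁ z n, graftFun_of_ne e₂ z hs, h₁ s hs]
      rfl
  · have n : e₁ (Sum.inl ⟨t, ht⟩) ≠ k₁ := fun h =>
      absurd (he₁ (h.trans hk₁.symm)) (by simp)
    rw [graftFun_of_ne e₁ y ht, graftFun_of_ne f₂ _ ht, ← h₀ t ht n]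
    exact graftFun_of_ne f₁ z n

end DTree

/-! ### The operad structure given by grafting. -/

open DTree

variable (P : TreeClass) [P.Full]

/-- The partial composition of classes of decorated trees is given by grafting. -/
noncomputable def freeCirc (E : SigmaMod k) {m n p : ℕ} (h : m + n = p + 1) (i : Fin m) :
    ((treeFunctor P k).obj E).obj m →ₗ[k] ((treeFunctor P k).obj E).obj n →ₗ[k]
      ((treeFunctor P k).obj E).obj p :=
  have lin : ∀ (D : DTree E (Fin m)), D.Good P → ∀ (a b : k) (D' D₁ D₂ : DTree E (Fin n)),
      LinComb a b D' D₁ D₂ → (graftAt i (blockFun h i) D D').toObj P =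
        a • (graftAt i (blockFun h i) D D₁).toObj P +
          b • (graftAt i (blockFun h i) D D₂).toObj P := fun D hD a b D' D₁ D₂ h' =>
    (LinComb.graftAt_right i _ D hD.bijective h').toObj_eq
  have eqv : ∀ {D D₀ : DTree E (Fin m)} {D' D₁ : DTree E (Fin n)}, D.Good P → D'.Good P →
      Eqv D D₀ → Eqv D' D₁ → (graftAt i (blockFun h i) D D').toObj P =
        (graftAt i (blockFun h i) D₀ D₁).toObj P := fun hD hD' h₁ h₂ =>
    (Eqv.graftAt i (blockFun h i) h₁ h₂).toObj_eq
      (Good.graftAt (blockFun_bijective h i) hD hD')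
  open Classical in
  -- The inner lift exists only for good `D`, as linearity in the second tree needs distinct labels.
  -- Bad trees get the value zero, which is harmless since `dLift` tests its conditions on good
  -- trees only.
  dLift (fun D => if hD : D.Good P then
      dLift (fun D' => (graftAt i (blockFun h i) D D').toObj P)
        (fun a b D' D₁ D₂ _ h' => lin D hD a b D' D₁ D₂ h')
        (fun D' D₁ hD' h' => eqv hD hD' (Eqv.refl D) h')
      else 0)
    (fun a b D D₁ D₂ hD h' => by
      have hD₁ := h'.good_iff.1.2 hD
      have hD₂ := h'.good_iff.2.2 hD
      rw [dif_pos hD, dif_pos hD₁, dif_pos hD₂]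
      apply toObj_hom_ext
      intro D' hD'
      rw [LinearMap.add_apply, LinearMap.smul_apply, LinearMap.smul_apply, dLift_toObj _ _ _ _ hD',
        dLift_toObj _ _ _ _ hD', dLift_toObj _ _ _ _ hD']
      exact (h'.graftAt_left i _ D').toObj_eq)
    (fun D D₁ hD h' => by
      have hD₁ := h'.good hD
      rw [dif_pos hD, dif_pos hD₁]
      apply toObj_hom_ext
      intro D' hD'
      rw [dLift_toObj _ _ _ _ hD', dLift_toObj _ _ _ _ hD']
      exact eqv hD hD' h' (Eqv.refl D'))

variable {P}

theorem freeCirc_toObj {m n p : ℕ} (h : m + n = p + 1) (i : Fin m) {D : DTree E (Fin m)}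
    {D' : DTree E (Fin n)} (hD : D.Good P) (hD' : D'.Good P) :
    freeCirc P E h i (D.toObj P) (D'.toObj P) = (graftAt i (blockFun h i) D D').toObj P := by
  rw [freeCirc, dLift_toObj _ _ _ _ hD, dif_pos hD, dLift_toObj _ _ _ _ hD']

theorem freeCirc_before {a b c p q r : ℕ} (hab : a + b = p + 1) (hpc : p + c = q + 1)
    (hac : a + c = r + 1) (hrb : r + b = q + 1) {j i : Fin a} {i₁ : Fin p} {j₁ : Fin r}
    (hi : i.1 < j.1) (hi₁ : i₁.1 = i.1) (hj₁ : j₁.1 = j.1 + c - 1) (f g h) :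
    freeCirc P E hpc i₁ (freeCirc P E hab j f g) h =
      freeCirc P E hrb j₁ (freeCirc P E hac i f h) g := by
  have hij : i ≠ j := fun h => by simp [h] at hi
  -- Both sides are linear in each of the three operations, so the identity may be checked on
  -- classes of good trees, where it is an equality of trees.
  apply toObj_ext (x := f)
  rotate_left
  iterate 2 (constructor <;> simp)
  intro D hD
  apply toObj_ext (x := g)
  rotate_left
  iterate 2 (constructor <;> simp)
  intro D' hD'
  apply toObj_ext (x := h)
  rotate_left
  iterate 2 (constructor <;> simp)
  intro D'' hD''
  rw [freeCirc_toObj hab j hD hD', freeCirc_toObj hac i hD hD'',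
    freeCirc_toObj hpc i₁ (hD.graftAt (blockFun_bijective hab j) hD') hD'',
    freeCirc_toObj hrb j₁ (hD.graftAt (blockFun_bijective hac i) hD'') hD']
  congr 1
  refine graftAt_parallel hij.symm _ _ (blockFun_injective _ _) (blockFun_injective _ _) _ _
    ?_ ?_ ?_ ?_ ?_ _ _ _
  · exact fun h => Fin.ext ((blockFun_inl_of_lt hab h hi).trans hi₁.symm)
  · exact fun h => Fin.ext ((blockFun_inl_of_gt hac h hi).trans hj₁.symm)
  · exact fun x hx₁ hx₂ h h' =>
      blockFun_before_left hab hpc hac hrb hi hi₁ hj₁ x hx₁ hx₂ h h'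
  · exact fun l h => blockFun_before_mid hab hpc hrb hi hi₁ hj₁ l h
  · exact fun l h => blockFun_before_right hpc hac hrb hi hi₁ hj₁ l h

/-- The free operad, possibly without a unit, depending on the class of trees. -/
noncomputable def freeOperad (P : TreeClass) [P.Full] (E : SigmaMod k) : NonunitalOperad k where
  toSigmaMod := (treeFunctor P k).obj E
  circ := freeCirc P E
  assoc_before hab hpc hac hrb j i hi f g h :=
    freeCirc_before hab hpc hac hrb (i := ⟨i, by omega⟩) hi rfl rfl f g h
  assoc_inside {a b c p q s} hab hpc hbc has j i hi hi' f g h := by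
    apply toObj_ext (x := f)
    rotate_left
    iterate 2 (constructor <;> simp)
    intro D hD
    apply toObj_ext (x := g)
    rotate_left
    iterate 2 (constructor <;> simp)
    intro D' hD'
    apply toObj_ext (x := h)
    rotate_left
    iterate 2 (constructor <;> simp)
    intro D'' hD''
    have hi₁ : i = j.1 + (i - j.1) := by omega
    rw [freeCirc_toObj hab j hD hD',
      freeCirc_toObj hpc _ (hD.graftAt (blockFun_bijective hab j) hD') hD'',
      freeCirc_toObj hbc _ hD' hD'',
      freeCirc_toObj has j hD (hD'.graftAt (blockFun_bijective hbc _) hD'')]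
    congr 1
    refine graftAt_nested _ (blockFun_injective _ _) _ _ _ (Fin.ext ((blockFun_inr_val ..).trans hi₁.symm)) ?_ ?_ ?_ _ _ _
    · exact fun x hx h => blockFun_inside_left hab hpc has (i := ⟨i - j.1, by omega⟩) hi₁ x hx h
    · exact fun l hl h => blockFun_inside_mid hab hpc hbc has hi₁ l hl h
    · exact fun l => blockFun_inside_right hpc hbc has hi₁ l
  assoc_after {a b c p q r} hab hpc hac hrb j i hi hi' f g h := by
    have := hab
    -- This axiom is the first one read backwards, with the roles of `g` and `h` exchanged.
    exact (freeCirc_before hac hrb hab hpc (i := j) (j := ⟨i + 1 - b, by omega⟩)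
      (i₁ := ⟨j.1, by omega⟩) (j₁ := ⟨i, hi'⟩) (by simp only; omega) rfl (by simp only; omega)
      f h g).symm
  equivariance {m n p} hmn i τ σ f g := by
    apply toObj_ext (x := f)
    rotate_left
    iterate 2 (constructor <;> simp)
    intro D hD
    apply toObj_ext (x := g)
    rotate_left
    iterate 2 (constructor <;> simp)
    intro D' hD'
    rw [act_toObj, act_toObj, freeCirc_toObj hmn _ hD hD',
      freeCirc_toObj hmn i ((good_map_iff D τ.symm).2 hD) ((good_map_iff D' σ.symm).2 hD'),
      act_toObj]
    congr 1
    refine graftAt_map τ.symm τ.symm.injective σ.symm _ (by simp) ?_ ?_ D D'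
    · intro x hx hx'
      rw [Equiv.eq_symm_apply, insertPerm_inl]
      simp
    · intro l
      rw [Equiv.eq_symm_apply, insertPerm_inr]
      simp

/-- The abstract composition may be computed in any numberings; in these it is the grafting of
numbered trees, and `graftAt_map` removes the numberings. -/
theorem compAt_cl {X J Y : Type} [Finite X] [Finite J] {i : X} (e : {x : X // x ≠ i} ⊕ J ≃ Y)
    {D : DTree E X} {D' : DTree E J} (hD : D.Good P) (hD' : D'.Good P) :
    (freeOperad P E).compAt i e (D.cl P) (D'.cl P) = (graftAt i e D D').cl P := by
  have a := (Finite.equivFin X).symm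
  have b := (Finite.equivFin J).symm
  have h := card_add_card_eq (J := J) i
  apply SigmaMod.ext_inj _ (blockLabel h a b i e)
  refine ((freeOperad P E).compAt_apply_blockLabel e (D.cl P) (D'.cl P) h a b (a.symm i)
    (by simp)).trans ?_
  have e₁ := cl_apply (P := P) D a
  have e₂ := cl_apply (P := P) D' b
  have e₃ := cl_apply (P := P) (graftAt i e D D') (blockLabel h a b i e)
  refine (congrArg₂ (fun x y => freeCirc P E h (a.symm i) x y) e₁ e₂).trans ?_
  refine Eq.trans ?_ e₃.symm
  rw [freeCirc_toObj h _ ((good_map_iff D a.symm).2 hD) ((good_map_iff D' b.symm).2 hD')]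
  congr 1
  refine graftAt_map a.symm a.symm.injective b.symm _ rfl ?_ ?_ D D'
  · intro x hx hx'
    rw [Equiv.eq_symm_apply, blockLabel_inl h a b e (a.symm i) (by simp) _ hx' (by simpa using hx)]
    simp
  · intro l
    rw [Equiv.eq_symm_apply, blockLabel_inr h a b e (a.symm i) (by simp)]
    simp

end

/-! ### Evaluation and grafting -/

section
variable {k : Type u} [CommRing k]

namespace DTree
variable {E : SigmaMod k} {X Y : Type}

theorem exists_eq_leg {D : DTree E X} (h : ¬ D.IsNode) : ∃ x, D = leg x := by
  cases D with
  | leg x => exact ⟨x, rfl⟩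
  | node I x c => exact absurd (isNode_node I x c) h

theorem lab_of_eq_leg {D : DTree E X} {x : X} (h : D = leg x) (l : D.Leaves) : D.lab l = x := by
  subst h
  rfl

theorem bind_of_not_isNode {D : DTree E X} (h : ¬ D.IsNode) (f : X → DTree E Y) (l : D.Leaves) :
    D.bind f = f (D.lab l) := by
  cases D with
  | leg x => rfl
  | node I x c => exact absurd (isNode_node I x c) h

end DTree

namespace NonunitalOperad
variable (S : NonunitalOperad k) (e : S.obj 1)

/-- The composition of the operations that decorate a tree; `e` is the value of the exceptional
tree. -/
noncomputable def evD {X : Type} (D : DTree S.toSigmaMod X) : S.ext D.Leaves :=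
  S.ev e D.rep.tree D.rep.dec

open DTree

variable {S} {X Y : Type}

/-- Equal decorated trees have leaf types that need not agree definitionally; a bijection preserving
labels and values replaces transport along the equality. -/
theorem exists_equiv_of_eq {D D' : DTree S.toSigmaMod X} (h : D = D') :
    ∃ ψ : D.Leaves ≃ D'.Leaves, (∀ l, D'.lab (ψ l) = D.lab l) ∧
      S.evD e D' = S.extMap ψ (S.evD e D) := by
  subst h
  exact ⟨Equiv.refl _, fun _ => rfl, rfl⟩

/-- Grafting exceptional trees changes nothing but the labels, hence the value is the same up to a
bijection of the leaves. -/
theorem exists_equiv_bind (D : DTree S.toSigmaMod X) (f : X → DTree S.toSigmaMod Y)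
    (h : ∀ l, ¬ (f (D.lab l)).IsNode) :
    ((D.bind f).IsNode ↔ D.IsNode) ∧ ∃ ψ : D.Leaves ≃ (D.bind f).Leaves,
      (∀ l m, (D.bind f).lab (ψ l) = (f (D.lab l)).lab m) ∧
        S.evD e (D.bind f) = S.extMap ψ (S.evD e D) := by
  choose g hg using fun l => exists_eq_leg (h l)
  have key : ∀ D' : DTree S.toSigmaMod Y, D'.rep = ⟨D.rep.tree, g, D.rep.dec⟩ →
      (D'.IsNode ↔ D.IsNode) ∧ ∃ ψ : D.Leaves ≃ D'.Leaves, (∀ l, D'.lab (ψ l) = g l) ∧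
        S.evD e D' = S.extMap ψ (S.evD e D) := by
    intro D' hD'
    unfold IsNode evD lab Leaves
    rw [hD']
    exact ⟨Iff.rfl, Equiv.refl _, fun _ => rfl, rfl⟩
  obtain ⟨h₁, ψ, h₂, h₃⟩ := key (D.bind f) (by rw [D.bind_eq_ofDec f g hg, rep_ofDec])
  refine ⟨h₁, ψ, fun l m => ?_, h₃⟩
  rw [h₂]
  exact (lab_of_eq_leg (hg l) m).symm

end NonunitalOperad

namespace DTree
variable {E : SigmaMod k} {X Y : Type}

theorem exists_equiv_bind_single (D : DTree E X) (f : X → DTree E Y) (l₀ : D.Leaves)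
    (h : ∀ l, l ≠ l₀ → ¬ (f (D.lab l)).IsNode) :
    ∃ φ : {l : D.Leaves // l ≠ l₀} ⊕ (f (D.lab l₀)).Leaves ≃ (D.bind f).Leaves,
      (∀ l hl m, (D.bind f).lab (φ (Sum.inl ⟨l, hl⟩)) = (f (D.lab l)).lab m) ∧
      ∀ m, (D.bind f).lab (φ (Sum.inr m)) = (f (D.lab l₀)).lab m := by
  have hb : Function.Bijective (fun s : {l : D.Leaves // l ≠ l₀} ⊕ (f (D.lab l₀)).Leaves =>
      (match s with
      | Sum.inl l => ⟨l.1, RTree.onlyLeaf _ (h l.1 l.2)⟩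
      | Sum.inr m => ⟨l₀, m⟩ : Σ l : D.Leaves, (f (D.lab l)).Leaves)) := by
    constructor
    · rintro (⟨l, hl⟩ | m) (⟨l', hl'⟩ | m') hh
      · have : l = l' := congrArg Sigma.fst hh
        subst this
        rfl
      · exact absurd (congrArg Sigma.fst hh) hl
      · exact absurd (congrArg Sigma.fst hh).symm hl'
      · have : m = m' := by simpa using hh
        rw [this]
    · rintro ⟨l, m⟩
      by_cases hl : l = l₀
      · subst hl
        exact ⟨Sum.inr m, rfl⟩
      · exact ⟨Sum.inl ⟨l, hl⟩, by rw [RTree.eq_onlyLeaf _ (h l hl) m]⟩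
  refine ⟨(Equiv.ofBijective _ hb).trans (D.bindLeaves f).symm, fun l hl m => ?_, fun m => ?_⟩
  · rw [lab_bind, Equiv.trans_apply, Equiv.apply_symm_apply, RTree.eq_onlyLeaf _ (h l hl) m]
    rfl
  · rw [lab_bind, Equiv.trans_apply, Equiv.apply_symm_apply]
    rfl

end DTree

namespace NonunitalOperad
variable {S : NonunitalOperad k} (e : S.obj 1)
open DTree

theorem evD_node {X I : Type} [Finite I] (x : S.ext I) (c : I → DTree S.toSigmaMod X) (L : List I)
    (hL : ∀ i, i ∈ L ↔ (c i).IsNode) (h : L.Nodup) :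
    S.evD e (node I x c) = S.extMap (RTree.pendEquiv (fun i => (c i).rep.tree) L hL)
      (S.gamma x (fun i => S.evD e (c i)) L h) :=
  S.ev_node e _ _ L hL h

/-- The value of a tree that is obtained by grafting a non-trivial tree onto one of the leaves. -/
theorem evD_bind_single {X Y : Type} (D : DTree S.toSigmaMod X) (f : X → DTree S.toSigmaMod Y)
    (l₀ : D.Leaves) (hD : D.IsNode) (hf : (f (D.lab l₀)).IsNode)
    (h : ∀ l, l ≠ l₀ → ¬ (f (D.lab l)).IsNode) (inj : Function.Injective (D.bind f).lab)
    (φ : {l : D.Leaves // l ≠ l₀} ⊕ (f (D.lab l₀)).Leaves ≃ (D.bind f).Leaves)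
    (h₁ : ∀ l hl m, (D.bind f).lab (φ (Sum.inl ⟨l, hl⟩)) = (f (D.lab l)).lab m)
    (h₂ : ∀ m, (D.bind f).lab (φ (Sum.inr m)) = (f (D.lab l₀)).lab m) :
    S.evD e (D.bind f) = S.compAt l₀ φ (S.evD e D) (S.evD e (f (D.lab l₀))) := by
  classical
  induction D with
  | leg z => exact absurd hD (not_isNode_leg z)
  | node I x c ih =>
    obtain ⟨j₀, l₁⟩ := l₀
    have hne : ∀ i, i ≠ j₀ → ∀ l, ¬ (f ((c i).lab l)).IsNode := fun i hi l =>
      h ⟨i, l⟩ (fun hh => hi (congrArg Sigma.fst hh))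
    have hch := fun i (hi : i ≠ j₀) => exists_equiv_bind e (c i) f (hne i hi)
    choose hnode ψ hψ hev using hch
    -- The list contains all non-trivial subtrees except the one that contains `l₀`, so that the
    -- composition at `j₀` can be made the outermost one.
    obtain ⟨L, hLn, hL⟩ : ∃ L : List I, L.Nodup ∧ ∀ i, i ∈ L ↔ i ≠ j₀ ∧ (c i).IsNode := by
      have := Fintype.ofFinite I
      exact ⟨(Finset.univ.filter fun i => i ≠ j₀ ∧ (c i).IsNode).toList, Finset.nodup_toList _,
        by simp⟩
    have hj₀ : j₀ ∉ L := fun hh => ((hL j₀).1 hh).1 rfl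
    have hLn' : (j₀ :: L).Nodup := List.nodup_cons.2 ⟨hj₀, hLn⟩
    have hj₀' : ((c j₀).bind f).IsNode := by
      by_cases hc : (c j₀).IsNode
      · exact hc.bind f
      · rw [bind_of_not_isNode hc f l₁]
        exact hf
    have hL' : ∀ i, i ∈ j₀ :: L ↔ ((c i).bind f).IsNode := by
      intro i
      by_cases hi : i = j₀
      · subst hi
        exact ⟨fun _ => hj₀', fun _ => List.mem_cons_self⟩
      · rw [List.mem_cons, hL, hnode i hi]
        simp [hi]
    have hmem : ∀ i, i ∈ L → i ≠ j₀ := fun i hi => ((hL i).1 hi).1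
    -- Away from `j₀` only exceptional trees are grafted, so the partial composite over `L` is the
    -- same before and after grafting, up to renaming of inputs.
    have hG := S.gamma_map (J := fun i => (c i).Leaves) (J' := fun i => ((c i).bind f).Leaves) x
      (fun i => S.evD e (c i)) (fun i => S.evD e ((c i).bind f)) (Equiv.refl I)
      (fun _ => Iff.rfl) (fun i hi => ψ i (hmem i hi)) (fun i hi => (hev i (hmem i hi)).symm)
      hLn hLn
    set M := Pend.mapEquiv (J := fun i => (c i).Leaves) (J' := fun i => ((c i).bind f).Leaves)
      (Equiv.refl I) (L := L) (L' := L) (fun _ => Iff.rfl) (fun i hi => ψ i (hmem i hi)) with hM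
    set G := S.gamma (J := fun i => (c i).Leaves) x (fun i => S.evD e (c i)) L hLn with hGdef
    set pend' := RTree.pendEquiv (fun i => ((c i).bind f).rep.tree) (j₀ :: L) hL' with hpend'
    have hlhs : S.evD e ((node I x c).bind f) = S.compAt (Pend.todo j₀ hj₀)
        ((Pend.consEquiv j₀ hj₀).trans pend') (S.extMap M G) (S.evD e ((c j₀).bind f)) := by
      refine (evD_node e x (fun i => (c i).bind f) (j₀ :: L) hL' hLn').trans ?_
      rw [gamma_cons _ _ _ _ _ _ hj₀ hLn, extMap_compAt, hG]
      rfl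
    have hpt : ∀ i (hi : i ∉ L) hne (hi' : i ≠ j₀) (l : (c i).Leaves),
        ((Pend.consEquiv j₀ hj₀).trans pend') (Sum.inl ⟨Pend.todo i hi, hne⟩) =
          (⟨i, ψ i hi' l⟩ : Σ i, ((c i).bind f).Leaves) := by
      intro i hi hne hi' l
      exact RTree.pendEquiv_todo _ _ hL' i (by simp [hi, hi']) (ψ i hi' l)
    have hpd : ∀ i (hi : i ∈ L) (l : (c i).Leaves) hne,
        ((Pend.consEquiv j₀ hj₀).trans pend')
          (Sum.inl ⟨Pend.done i hi (ψ i (hmem i hi) l), hne⟩) =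
          (⟨i, ψ i (hmem i hi) l⟩ : Σ i, ((c i).bind f).Leaves) := fun i hi l hne => rfl
    -- The labels of the grafted tree are injective, so two leaves can be identified by comparing
    -- their labels.
    have hA : ∀ (z : (node I x c).Leaves) hz i (hi : i ≠ j₀) (l : (c i).Leaves),
        z = (⟨i, l⟩ : Σ i, (c i).Leaves) →
          φ (Sum.inl ⟨z, hz⟩) = (⟨i, ψ i hi l⟩ : Σ i, ((c i).bind f).Leaves) := by
      rintro _ hz i hi l rfl
      exact inj ((h₁ ⟨i, l⟩ hz (RTree.onlyLeaf _ (hne i hi l))).trans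
        (hψ i hi l (RTree.onlyLeaf _ (hne i hi l))).symm)
    -- If the subtree at `j₀` has a vertex, the induction hypothesis applies to it. Otherwise it is
    -- exceptional, and the new tree is plugged directly into the input `j₀` of the root.
    by_cases hc : (c j₀).IsNode
    · have hL'' : ∀ i, i ∈ j₀ :: L ↔ (c i).IsNode := by
        intro i
        by_cases hi : i = j₀
        · subst hi
          exact ⟨fun _ => hc, fun _ => List.mem_cons_self⟩
        · rw [List.mem_cons, hL]
          simp [hi]
      set pend := RTree.pendEquiv (fun i => (c i).rep.tree) (j₀ :: L) hL'' with hpend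
      have hrhs : S.evD e (node I x c) = S.compAt (Pend.todo j₀ hj₀)
          ((Pend.consEquiv j₀ hj₀).trans pend) G (S.evD e (c j₀)) := by
        refine (evD_node e x c (j₀ :: L) hL'' hLn').trans ?_
        rw [gamma_cons _ _ _ _ _ _ hj₀ hLn, extMap_compAt]
      have hne₁ : ∀ l, l ≠ l₁ → ¬ (f ((c j₀).lab l)).IsNode := fun l hl =>
        h ⟨j₀, l⟩ (fun hh => hl (eq_of_heq (Sigma.mk.inj hh).2))
      obtain ⟨φ₁, hφ₁, hφ₂⟩ := exists_equiv_bind_single (c j₀) f l₁ hne₁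
      have hi := ih j₀ l₁ hc hf hne₁ (fun a b hab =>
        eq_of_heq (Sigma.mk.inj (@inj ⟨j₀, a⟩ ⟨j₀, b⟩ hab)).2) φ₁ hφ₁ hφ₂
      set f₂ : {q // q ≠ Pend.todo j₀ hj₀} ⊕ ((c j₀).bind f).Leaves ≃
          ((node I x c).bind f).Leaves :=
        (Equiv.sumCongr (M.subtypeEquiv (q := fun q => q ≠ Pend.todo j₀ hj₀)
          (fun q => (M.injective.ne_iff (x := q) (y := Pend.todo j₀ hj₀)).symm))
          (Equiv.refl _)).trans ((Pend.consEquiv j₀ hj₀).trans pend') with hf₂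
      have hlhs' : S.compAt (Pend.todo j₀ hj₀)
        ((Pend.consEquiv j₀ hj₀).trans pend') (S.extMap M G) (S.evD e ((c j₀).bind f)) =
          S.compAt (Pend.todo j₀ hj₀) f₂ G (S.evD e ((c j₀).bind f)) :=
        S.compAt_congr (i := Pend.todo j₀ hj₀) (i' := Pend.todo j₀ hj₀) (e := f₂)
          (e' := (Pend.consEquiv j₀ hj₀).trans pend') M (Equiv.refl _) (Equiv.refl _) rfl
          (fun _ _ _ => rfl) (fun _ => rfl) G _
      rw [hlhs, hlhs', hrhs, hi]
      -- The left side composes the root with the already grafted subtree, the right side grafts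
      -- after composing; they are related by associativity of nested compositions.
      refine (S.compAt_nested ((Pend.consEquiv j₀ hj₀).trans pend) φ φ₁ f₂ rfl ?_ ?_ ?_ _ _ _).symm
      · rintro (⟨i, hi⟩ | ⟨i, hi, l⟩) hq hq'
        · have hi' : i ≠ j₀ := fun hh => hq (by subst hh; rfl)
          have l := RTree.onlyLeaf (c i).rep.tree (fun hh => hi ((hL i).2 ⟨hi', hh⟩))
          exact (hA _ _ i hi' l (RTree.pendEquiv_todo _ _ hL'' i (by simp [hi, hi']) l)).trans
            (hpt i hi (fun hh => hi' (by cases hh; rfl)) hi' l).symm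
        · exact (hA _ _ i (hmem i hi) l rfl).trans (hpd i hi l (fun hh => by cases hh)).symm
      · intro l hl hl'
        exact inj ((h₁ ⟨j₀, l⟩ hl' (RTree.onlyLeaf _ (hne₁ l hl))).trans
          (hφ₁ l hl (RTree.onlyLeaf _ (hne₁ l hl))).symm)
      · intro m
        exact inj ((h₂ m).trans (hφ₂ m).symm)
    · have hL'' : ∀ i, i ∈ L ↔ (c i).IsNode := by
        intro i
        rw [hL]
        exact ⟨And.right, fun hi => ⟨fun hh => hc (hh ▸ hi), hi⟩⟩
      set pend := RTree.pendEquiv (fun i => (c i).rep.tree) L hL'' with hpend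
      have hrhs : S.evD e (node I x c) = S.extMap pend G := evD_node e x c L hL'' hLn
      obtain ⟨ψ₀, hψ₀, hev₀⟩ := exists_equiv_of_eq e (bind_of_not_isNode hc f l₁).symm
      rw [hlhs, hev₀, hrhs]
      have hG' : G = S.extMap pend.symm (S.extMap pend G) := by
        rw [SigmaMod.extMap_extMap, Equiv.self_trans_symm, SigmaMod.extMap_refl]
      rw [hG', SigmaMod.extMap_extMap, ← hG']
      have hpt' : ∀ i (hi : i ∉ L) (l : (c i).Leaves),
          pend (Pend.todo i hi) = (⟨i, l⟩ : Σ i, (c i).Leaves) := fun i hi l =>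
        RTree.pendEquiv_todo _ _ hL'' i hi l
      -- Here nothing was plugged in at `j₀` before, so both sides are the same single composition
      -- and only the names of the inputs differ.
      refine S.compAt_congr (e := φ) (pend.symm.trans M) ψ₀ (Equiv.refl _) ?_ ?_ ?_ _ _
      · exact congrArg M ((Equiv.symm_apply_eq pend).2 (hpt' j₀ hj₀ l₁).symm)
      · intro z hz hz'
        obtain ⟨q, rfl⟩ := pend.surjective z
        have hq : ∀ hq', ((Pend.consEquiv j₀ hj₀).trans pend')
            (Sum.inl ⟨(pend.symm.trans M) (pend q), hz'⟩) =
            ((Pend.consEquiv j₀ hj₀).trans pend') (Sum.inl ⟨M q, hq'⟩) := by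
          intro hq'
          congr 3
          simp
        rcases q with ⟨i, hi⟩ | ⟨i, hi, l⟩
        · have l := RTree.onlyLeaf (c i).rep.tree (mt (hL'' i).2 hi)
          have hi' : i ≠ j₀ := by
            rintro rfl
            exact hz (hpt' i hi l₁)
          have hq' : M (Pend.todo i hi) ≠ Pend.todo j₀ hj₀ := fun hh => by
            cases hh
            exact hi' rfl
          exact (hq hq').trans ((hpt i hi (fun hh => hi' (by cases hh; rfl)) hi' l).trans
            (hA _ hz i hi' l (hpt' i hi l)).symm)
        · have hq' : M (Pend.done i hi l) ≠ Pend.todo j₀ hj₀ := fun hh => by cases hh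
          exact (hq hq').trans ((hpd i hi l (fun hh => by cases hh)).trans (hA _ hz i (hmem i hi) l rfl).symm)
      · intro m
        exact inj ((hψ₀ m).trans (h₂ m).symm)

end NonunitalOperad

end

/-! ### Operads and the triple -/

section
variable {k : Type u} [CommRing k]

/-- The laws for the value `e` of the exceptional tree: it is a unit if the exceptional tree
belongs to `P`, and zero otherwise. -/
structure NonunitalOperad.UnitLaws (P : TreeClass) (S : NonunitalOperad k) (e : S.obj 1) :
    Prop where
  circ_unit : P.Mem RTree.leg → ∀ {m : ℕ} (i : Fin m) (f : S.obj m),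
    S.circ (m := m) (n := 1) rfl i f e = f
  unit_circ : P.Mem RTree.leg → ∀ {n : ℕ} (g : S.obj n), S.circ (Nat.add_comm 1 n) 0 e g = g
  eq_zero : ¬ P.Mem RTree.leg → e = 0

/-! ### The exceptional tree as a unit. -/

namespace DTree
variable {P : TreeClass} {E : SigmaMod k}

/-- One input replaces one input, so the shift of the later positions is zero and all labels are
preserved. -/
theorem graftAt_leg_right {m : ℕ} (i : Fin m) (D : DTree E (Fin m)) (z : Fin 1) :
    graftAt i (blockFun (m := m) (n := 1) rfl i) D (leg z) = D := by
  refine Eq.trans ?_ D.bind_leg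
  unfold graftAt
  congr 1
  funext x
  by_cases hx : x = i
  · subst hx
    rw [graftFun_self]
    refine congrArg leg (Fin.ext ?_)
    rw [blockFun_inr_val]
    omega
  · rw [graftFun_of_ne _ _ hx]
    refine congrArg leg (Fin.ext ?_)
    rcases blockFun_inl_val (n := 1) (p := m) rfl i x hx with h | h
    · exact h.2
    · exact h.2

theorem graftAt_leg_left {n : ℕ} (D : DTree E (Fin n)) (z : Fin 1) :
    graftAt 0 (blockFun (Nat.add_comm 1 n) 0) (leg z) D = D := by
  obtain rfl : z = 0 := Subsingleton.elim _ _
  change graftFun 0 _ D 0 = D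
  rw [graftFun_self]
  refine Eq.trans ?_ D.bind_leg
  unfold map
  congr 1
  funext l
  refine congrArg leg (Fin.ext ?_)
  rw [blockFun_inr_val]
  simp

theorem Good.isNode_or [hP : P.Full] {X : Type} {D : DTree E X} (h : D.Good P) :
    D.IsNode ∨ P.Mem RTree.leg ∧ ∃ x, D = leg x := by
  by_cases hD : D.IsNode
  · exact Or.inl hD
  · exact Or.inr ⟨((hP.mem_iff _).1 h.mem).resolve_right hD, exists_eq_leg hD⟩

theorem good_leg (h : P.Mem RTree.leg) {z : Fin 1} : (leg z : DTree E (Fin 1)).Good P :=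
  ⟨h, fun _ _ _ => rfl, fun _ => ⟨(), Subsingleton.elim _ _⟩⟩

theorem Good.eq_one {n : ℕ} {z : Fin n} (h : (leg z : DTree E (Fin n)).Good P) : n = 1 := by
  have := Nat.card_congr (Equiv.ofBijective _ h.bijective)
  rw [Nat.card_fin] at this
  rw [← this]
  exact Nat.card_unique (α := Unit)

theorem good_node [hP : P.Full] {X I : Type} [Finite I] (x : E.ext I) (c : I → DTree E X)
    (h : Function.Bijective (node I x c).lab) : (node I x c).Good P :=
  ⟨(hP.mem_iff _).2 (Or.inr (isNode_node I x c)), h⟩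

end DTree

open DTree

/-! ### Evaluation as a morphism of operads. -/

variable (P : TreeClass)

/-- The class of the exceptional tree, which is zero if it does not belong to `P`. -/
noncomputable def freeUnit (E : SigmaMod k) : ((treeFunctor P k).obj E).obj 1 :=
  (leg 0 : DTree E (Fin 1)).toObj P

variable {P}

theorem toObj_leg {E : SigmaMod k} (z : Fin 1) : (leg z : DTree E (Fin 1)).toObj P =
    freeUnit P E := by
  obtain rfl : z = 0 := Subsingleton.elim _ _
  rfl

theorem map_treeElem {E F : SigmaMod k} (g : E ⟶ F) {n : ℕ} (X : LTree P n)
    (d : RTree.Dec E X.tree) : ((treeFunctor P k).map g).app n (treeElem X d) =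
      treeElem X (fun v => SigmaMod.homExt g _ (d v)) := by
  have h := congrArg (fun φ => φ.hom (PiTensorProduct.tprod k d))
    (ι_colimMap (treeTensorMap P g n) X)
  refine h.trans (congrArg (colimit.ι (treeTensor P F n) X).hom ?_)
  exact PiTensorProduct.map_tprod _ d

theorem unitLaws_freeOperad [P.Full] (E : SigmaMod k) :
    (freeOperad P E).UnitLaws P (freeUnit P E) where
  circ_unit h m i f := by
    change freeCirc P E _ i f ((leg 0 : DTree E (Fin 1)).toObj P) = f
    apply toObj_ext (x := f)
    rotate_left
    iterate 2 (constructor <;> simp)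
    intro D hD
    rw [freeCirc_toObj _ _ hD (good_leg h), graftAt_leg_right]
  unit_circ h n g := by
    change freeCirc P E _ 0 ((leg 0 : DTree E (Fin 1)).toObj P) g = g
    apply toObj_ext (x := g)
    rotate_left
    iterate 2 (constructor <;> simp)
    intro D hD
    rw [freeCirc_toObj _ _ (good_leg h) hD, graftAt_leg_left]
  eq_zero h := by
    rw [freeUnit, toObj, cl_of_not_good (fun hD => h hD.mem)]
    rfl

/-- The evaluation of classes of trees decorated by operations of an operad. -/
noncomputable def evHom (P : TreeClass) (S : NonunitalOperad k) (e : S.obj 1) :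
    (treeFunctor P k).obj S.toSigmaMod ⟶ S.toSigmaMod where
  -- The value of a tree lies in S(leaves); the inverse of the labeling is the numbering that turns
  -- it into an element of S(n).
  app n := treeLift (fun X d => (S.ev e X.tree d).1 n X.label.symm)
    (fun X a b d d₁ d₂ v hv h₁ h₂ => by
      rw [S.ev_linear e a b v hv h₁ h₂]
      rfl)
    (fun X Y f d => by
      rw [← S.ev_push e f.1 d, SigmaMod.extMap_apply]
      refine congrArg _ (Equiv.ext fun i => ?_)
      rw [Equiv.trans_apply, Equiv.eq_symm_apply, Equiv.eq_symm_apply, f.2,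
        Equiv.apply_symm_apply])
  app_act {n} σ x := by
    apply treeElem_induction (x := x)
    · intro X d
      have h : ((treeFunctor P k).obj S.toSigmaMod).act σ (treeElem X d) =
        treeElem (X.relabel σ) d := congrArg (fun φ => φ.hom (PiTensorProduct.tprod k d))
          (ι_relabelMap P S.toSigmaMod σ X)
      rw [h]
      refine (treeLift_treeElem _ _ _ (X.relabel σ) d).trans ?_
      rw [treeLift_treeElem]
      exact (S.ev e X.tree d).2 n σ X.label.symm
    · simp
    · intro x y hx hy
      simp only [map_add, hx, hy]
    · intro a x hx
      simp only [map_smul, hx]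

variable {S : NonunitalOperad k} (e : S.obj 1)

theorem evHom_treeElem {n : ℕ} (X : LTree P n) (d : RTree.Dec S.toSigmaMod X.tree) :
    (evHom P S e).app n (treeElem X d) = (S.ev e X.tree d).1 n X.label.symm :=
  treeLift_treeElem _ _ _ X d

theorem evHom_toObj {n : ℕ} {D : DTree S.toSigmaMod (Fin n)} (hD : D.Good P) :
    (evHom P S e).app n (D.toObj P) =
      (S.evD e D).1 n (Equiv.ofBijective D.lab hD.bijective).symm := by
  rw [toObj, hD.cl_eq]
  exact evHom_treeElem e ⟨D.rep.tree, (Equiv.ofBijective D.lab hD.bijective).trans _, hD.mem⟩ _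

theorem evHom_freeUnit (h : S.UnitLaws P e) : (evHom P S e).app 1 (freeUnit P S.toSigmaMod) = e := by
  by_cases hl : P.Mem RTree.leg
  · rw [freeUnit, evHom_toObj e (good_leg hl)]
    refine Eq.trans ?_ (S.extEquiv_symm_apply RTree.legEquiv e)
    refine congrArg _ (Equiv.ext fun i => rfl)
  · rw [h.eq_zero hl, freeUnit, toObj, cl_of_not_good (fun hD => hl hD.mem)]
    exact map_zero _

/-- Combines `evD_bind_single`, at the leaf labeled `i`, with `compAt_apply` for the numberings of
the leaves given by their labels. -/
theorem evHom_graftAt_of_isNode [P.Full] {m n p : ℕ} (h : m + n = p + 1) (i : Fin m)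
    {D : DTree S.toSigmaMod (Fin m)} {D' : DTree S.toSigmaMod (Fin n)} (hD : D.Good P)
    (hD' : D'.Good P) (hn : D.IsNode) (hn' : D'.IsNode) :
    (evHom P S e).app p ((graftAt i (blockFun h i) D D').toObj P) =
      S.circ h i ((evHom P S e).app m (D.toObj P)) ((evHom P S e).app n (D'.toObj P)) := by
  have hG := hD.graftAt (blockFun_bijective h i) hD'
  rw [evHom_toObj e hD, evHom_toObj e hD', evHom_toObj e hG]
  obtain ⟨l₀, rfl⟩ := hD.bijective.2 i
  set i := D.lab l₀ with hi
  set f := graftFun i (blockFun h i) D' with hf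
  have hfi : f i = D'.map (fun j => blockFun h i (Sum.inr j)) := graftFun_self _ _ _
  have hne : ∀ l, l ≠ l₀ → ∀ hh, f (D.lab l) = leg (blockFun h i (Sum.inl ⟨D.lab l, hh⟩)) :=
    fun l hl hh => graftFun_of_ne _ _ _
  have hne' : ∀ l, l ≠ l₀ → ¬ (f (D.lab l)).IsNode := fun l hl => by
    rw [hne l hl (hD.bijective.1.ne hl)]
    exact not_isNode_leg _
  have hfn : (f i).IsNode := by
    rw [hfi]
    exact hn'.bind _
  obtain ⟨φ, h₁, h₂⟩ := exists_equiv_bind_single D f l₀ hne'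
  obtain ⟨ψ, hψ, hev⟩ : ∃ ψ : D'.Leaves ≃ (f i).Leaves,
      (∀ l, (f i).lab (ψ l) = blockFun h i (Sum.inr (D'.lab l))) ∧
        S.evD e (f i) = S.extMap ψ (S.evD e D') := by
    rw [hfi]
    obtain ⟨-, ψ, hψ, hev⟩ := S.exists_equiv_bind e D'
      (fun j => leg (blockFun h i (Sum.inr j))) (fun _ => not_isNode_leg _)
    exact ⟨ψ, fun l => hψ l (), hev⟩
  have key := S.evD_bind_single e D f l₀ hn hfn hne' hG.bijective.1 φ h₁ h₂
  refine (congrArg (fun φ : S.ext (D.bind f).Leaves => φ.1 p _) key).trans ?_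
  have hev₂ : (S.evD e D').1 n (Equiv.ofBijective D'.lab hD'.bijective).symm =
      (S.evD e (f i)).1 n ((Equiv.ofBijective D'.lab hD'.bijective).symm.trans ψ) := by
    rw [hev, SigmaMod.extMap_apply]
    refine congrArg _ (Equiv.ext fun j => ?_)
    simp
  rw [hev₂]
  have hinj := hG.bijective.1
  have hw : ∀ (z : Fin p) l, (graftAt i (blockFun h i) D D').lab l = z →
      (Equiv.ofBijective _ hG.bijective).symm z = l := by
    rintro _ l rfl
    exact (Equiv.symm_apply_eq _).2 rfl
  refine S.compAt_apply φ _ _ h _ _ i ((Equiv.symm_apply_eq _).2 rfl) _ ?_ ?_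
  · intro j hj hj'
    obtain ⟨l, rfl⟩ := hD.bijective.2 j
    have hl : l ≠ l₀ := fun hh => hj (by rw [hh])
    have hl' : (Equiv.ofBijective D.lab hD.bijective).symm (D.lab l) = l :=
      (Equiv.symm_apply_eq _).2 rfl
    refine hw _ _ ?_
    have m := RTree.onlyLeaf _ (hne' l hl)
    have e₁ : (⟨(Equiv.ofBijective D.lab hD.bijective).symm (D.lab l), hj'⟩ :
        {l // l ≠ l₀}) = ⟨l, hl⟩ := Subtype.ext hl'
    rw [e₁]
    exact (h₁ l hl m).trans (lab_of_eq_leg (hne l hl hj) m)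
  · intro j
    obtain ⟨l, rfl⟩ := hD'.bijective.2 j
    have hl' : (Equiv.ofBijective D'.lab hD'.bijective).symm (D'.lab l) = l :=
      (Equiv.symm_apply_eq _).2 rfl
    refine hw _ _ ?_
    rw [Equiv.trans_apply, hl', ← hψ]
    exact h₂ _

/-- By bilinearity only pairs of good trees matter. An exceptional tree is good only if it belongs
to `P`; in that case its value `e` is a unit, and grafting with it is trivial on both sides. -/
theorem evHom_freeCirc [P.Full] (he : S.UnitLaws P e) {m n p : ℕ} (h : m + n = p + 1) (i : Fin m)
    (f : ((treeFunctor P k).obj S.toSigmaMod).obj m)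
    (g : ((treeFunctor P k).obj S.toSigmaMod).obj n) :
    (evHom P S e).app p (freeCirc P S.toSigmaMod h i f g) =
      S.circ h i ((evHom P S e).app m f) ((evHom P S e).app n g) := by
  apply toObj_ext (x := f)
  rotate_left
  iterate 2 (constructor <;> simp)
  intro D hD
  apply toObj_ext (x := g)
  rotate_left
  iterate 2 (constructor <;> simp)
  intro D' hD'
  rw [freeCirc_toObj h i hD hD']
  rcases hD.isNode_or with hn | ⟨hl, z, rfl⟩
  · rcases hD'.isNode_or with hn' | ⟨hl, z, rfl⟩
    · exact evHom_graftAt_of_isNode e h i hD hD' hn hn'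
    · obtain rfl := hD'.eq_one
      obtain rfl : m = p := by omega
      rw [graftAt_leg_right, toObj_leg, evHom_freeUnit e he, he.circ_unit hl]
  · obtain rfl := hD.eq_one
    obtain rfl : n = p := by omega
    obtain rfl : i = 0 := Subsingleton.elim _ _
    rw [graftAt_leg_left, toObj_leg, evHom_freeUnit e he, he.unit_circ hl]

/-- The evaluation is a morphism of operads. -/
noncomputable def evMor (P : TreeClass) [P.Full] {S : NonunitalOperad k} {e : S.obj 1}
    (he : S.UnitLaws P e) : freeOperad P S.toSigmaMod ⟶ S where
  hom := evHom P S e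
  map_circ := evHom_freeCirc e he

/-- The evaluation is natural. -/
theorem map_evHom {S R : NonunitalOperad k} {e : S.obj 1} {e' : R.obj 1} (g : S ⟶ R)
    (hg : g.hom.app 1 e = e') :
    (treeFunctor P k).map g.hom ≫ evHom P R e' = evHom P S e ≫ g.hom := by
  apply SigmaMod.hom_ext
  intro n
  apply LinearMap.ext
  intro x
  apply treeElem_induction (x := x)
  · intro X d
    refine (congrArg ((evHom P R e').app n) (map_treeElem g.hom X d)).trans ?_
    rw [evHom_treeElem, ← NonunitalOperad.homExt_ev g e e' hg]
    exact (congrArg (g.hom.app n) (evHom_treeElem e X d)).symm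
  · rw [map_zero, map_zero]
  · intro x y hx hy
    rw [map_add, map_add, hx, hy]
  · intro a x hx
    rw [map_smul, map_smul, hx]

end

/-! ### The unit and the multiplication -/

section
variable {k : Type u} [CommRing k] {P : TreeClass} {E : SigmaMod k}

namespace DTree
variable {Z Z' : Type}

theorem map_ofDec : ∀ (T : RTree) (b : T.Leaves → Z) (d : RTree.Dec E T) (g : Z → Z'),
    (ofDec T b d).map g = ofDec T (fun l => g (b l)) d
  | RTree.leg, _, _, _ => rfl
  | RTree.node I c, b, d, g =>
    congrArg (node I d.root) (funext fun i => map_ofDec (c i) (fun l => b ⟨i, l⟩) (d.child i) g)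

/-- Identifies the recursive grafting on `DTree` with `RTree.graft` and its induced decoration. -/
theorem ofDec_bind : ∀ (t : RTree) (s : t.Leaves → RTree) (b : t.Leaves → Z)
    (f : Z → DTree E Z') (d : RTree.Dec E t) (d' : ∀ l, RTree.Dec E (s l))
    (lab : (t.graft s).Leaves → Z')
    (_ : ∀ l, f (b l) = ofDec (s l) (fun m => lab ((t.graftLeaves s).symm ⟨l, m⟩)) (d' l)),
    (ofDec t b d).bind f = ofDec (t.graft s) lab (t.graftDec s d d')
  | RTree.leg, s, b, f, d, d', lab, h => h ()
  | RTree.node I c, s, b, f, d, d', lab, h => by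
    refine (congrArg (node I d.root) (funext fun i =>
      ofDec_bind (c i) (fun l => s ⟨i, l⟩) (fun l => b ⟨i, l⟩) f (d.child i)
        (fun l => d' ⟨i, l⟩) (fun l => lab ⟨i, l⟩) (fun l => h ⟨i, l⟩))).trans ?_
    have h₀ : (RTree.graftDec (RTree.node I c) s d d').root = d.root := by
      unfold RTree.Dec.root
      rw [RTree.graftDec]
    have h₁ : ∀ i, RTree.Dec.child (c := fun i => (c i).graft fun l => s ⟨i, l⟩)
        (RTree.graftDec (RTree.node I c) s d d') i =
        (c i).graftDec (fun l => s ⟨i, l⟩) (d.child i) (fun l => d' ⟨i, l⟩) := by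
      intro i
      funext v
      unfold RTree.Dec.child
      rw [RTree.graftDec]
    change node I d.root _ = node I (RTree.graftDec (RTree.node I c) s d d').root _
    rw [h₀]
    exact congrArg (node I d.root) (funext fun i => by rw [h₁])

/-- Substitution of decorated trees for the vertices of a tree. -/
def subst : (T : RTree) → (∀ v, DTree E (T.inputs v)) → DTree E T.Leaves
  | RTree.leg, _ => leg ()
  | RTree.node _ c, D => (D none).bind (fun i =>
      (subst (c i) (fun v => D (some ⟨i, v⟩))).map (fun l => ⟨i, l⟩))

theorem subst_eq_leg : ∀ (T : RTree) (D : ∀ v, DTree E (T.inputs v)) (h : ¬ Nonempty T.Vert),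
    subst T D = leg (T.onlyLeaf h)
  | RTree.leg, _, _ => rfl
  | RTree.node _ _, _, h => (h ⟨none⟩).elim

/-- Connects the substitution on `DTree`, which suits induction, with `RTree.subst`, `substLeaves`
and `substDec`, in terms of which the multiplication is prescribed. -/
theorem subst_ofDec : ∀ (T : RTree) (t : T.Vert → RTree) (b : ∀ v, (t v).Leaves ≃ T.inputs v)
    (d : ∀ v, RTree.Dec E (t v)), subst T (fun v => ofDec (t v) (b v) (d v)) =
      ofDec (T.subst t b) (T.substLeaves t b) (T.substDec t b d)
  | RTree.leg, _, _, _ => rfl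
  | RTree.node I c, t, b, d => by
    refine ofDec_bind _ _ _ _ _ _ _ (fun l => ?_)
    refine (congrArg (map (fun l' => (⟨b none l, l'⟩ : Σ i, (c i).Leaves)))
      (subst_ofDec (c (b none l)) (fun v => t (some ⟨b none l, v⟩))
        (fun v => b (some ⟨b none l, v⟩)) (fun v => d (some ⟨b none l, v⟩)))).trans ?_
    rw [map_ofDec]
    refine congrArg (fun g => ofDec _ g _) (funext fun m => ?_)
    refine Eq.symm ?_
    change (Equiv.sigmaCongr (b none) _) (RTree.graftLeaves _ _ _) = _
    rw [Equiv.apply_symm_apply]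
    rfl

/-- The decorated corolla. -/
def corolla (I : Type) [Finite I] (x : E.ext I) : DTree E I := node I x leg

end DTree

theorem RTree.finite_inputs : ∀ (T : RTree) (v : T.Vert), Finite (T.inputs v)
  | node I _, none => inferInstanceAs (Finite I)
  | node _ c, some ⟨i, v⟩ => finite_inputs (c i) v

attribute [instance] RTree.finite_inputs

namespace DTree

theorem subst_corolla : ∀ (T : RTree) (d : RTree.Dec E T),
    subst T (fun v => corolla (T.inputs v) (d v)) = ofDec T id d
  | RTree.leg, _ => rfl
  | RTree.node I c, d => by
    change node I _ _ = node I _ _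
    congr 1
    funext i
    exact (congrArg (map _) (subst_corolla (c i) (d.child i))).trans (map_ofDec _ _ _ _)

theorem good_corolla [P.Full] {I : Type} [Finite I] (x : E.ext I) : (corolla I x).Good P :=
  good_node x _ ⟨fun a b h => by
    obtain ⟨i, _⟩ := a
    obtain ⟨j, _⟩ := b
    obtain rfl : i = j := h
    rfl, fun i => ⟨⟨i, ()⟩, rfl⟩⟩

theorem cl_corolla_extMap [P.Full] {I J : Type} [Finite I] [Finite J] (e : I ≃ J) (x : E.ext I) :
    (corolla J (E.extMap e x)).cl P = ((treeFunctor P k).obj E).extMap e ((corolla I x).cl P) := by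
  rw [extMap_cl]
  refine (Eqv.cl_eq_of_good ?_ ((good_map_iff _ e).2 (good_corolla x))).symm
  refine .node e x _ _ fun j => ?_
  change Eqv (leg (e (e.symm j))) (leg j)
  rw [Equiv.apply_symm_apply]
  exact .leg j

open Classical in
/-- The trees to be grafted onto the leaves with labels in `L`. -/
noncomputable def plug {I : Type} {J : I → Type} (R : ∀ i, DTree E (J i)) (L : List I) (i : I) :
    DTree E (Pend J L) :=
  if h : i ∈ L then (R i).map (Pend.done i h) else leg (Pend.todo i h)

theorem plug_of_mem {I : Type} {J : I → Type} (R : ∀ i, DTree E (J i)) {L : List I} {i : I}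
    (h : i ∈ L) : plug R L i = (R i).map (Pend.done i h) := dif_pos h

theorem plug_of_not_mem {I : Type} {J : I → Type} (R : ∀ i, DTree E (J i)) {L : List I} {i : I}
    (h : i ∉ L) : plug R L i = leg (Pend.todo i h) := dif_neg h

/-- In the free operad, plugging in operations one after another amounts to grafting all the trees
at once; each step of the induction is one application of `compAt_cl`. -/
theorem gamma_cl [P.Full] {I : Type} [Finite I] {J : I → Type} [∀ i, Finite (J i)]
    {D : DTree E I} (hD : D.Good P) (R : ∀ i, DTree E (J i)) (L : List I) (hL : L.Nodup)
    (hR : ∀ i ∈ L, (R i).Good P) : (D.bind (plug R L)).Good P ∧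
      (freeOperad P E).gamma (D.cl P) (fun i => (R i).cl P) L hL = (D.bind (plug R L)).cl P := by
  induction L with
  | nil =>
    have : D.bind (plug R []) = D.map Pend.nilEquiv :=
      congrArg D.bind (funext fun i => plug_of_not_mem R List.not_mem_nil)
    rw [this]
    exact ⟨(good_map_iff D _).2 hD, extMap_cl D Pend.nilEquiv⟩
  | cons i L ih =>
    obtain ⟨hi, hL'⟩ := List.nodup_cons.1 hL
    obtain ⟨h₁, h₂⟩ := ih hL' (fun j hj => hR j (List.mem_cons_of_mem i hj))
    have h₃ := hR i List.mem_cons_self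
    have key : D.bind (plug R (i :: L)) =
        graftAt (Pend.todo i hi) (Pend.consEquiv i hi) (D.bind (plug R L)) (R i) := by
      rw [graftAt, bind_assoc]
      congr 1
      funext x
      by_cases hx : x ∈ L
      · rw [plug_of_mem R (List.mem_cons_of_mem i hx), plug_of_mem R hx, map_bind]
        unfold map
        congr 1
        funext j
        rw [graftFun_of_ne _ _ (fun h => by cases h), Pend.consEquiv_done]
      · rw [plug_of_not_mem R hx]
        by_cases hxi : x = i
        · subst hxi
          rw [plug_of_mem R List.mem_cons_self]
          change _ = graftFun (Pend.todo x hi) _ (R x) (Pend.todo x hi)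
          exact (graftFun_self (Pend.todo x hi) (Pend.consEquiv x hi) (R x)).symm
        · rw [plug_of_not_mem R (by simp [hx, hxi])]
          have hne : (Pend.todo x hx : Pend J L) ≠ Pend.todo i hi := fun h => hxi (by injection h)
          change _ = graftFun _ _ _ (Pend.todo x hx)
          rw [graftFun_of_ne _ _ hne]
          rfl
    rw [key]
    refine ⟨h₁.graftAt (Equiv.bijective _) h₃, ?_⟩
    refine (NonunitalOperad.gamma_cons (S := freeOperad P E) (D.cl P) (fun i => (R i).cl P) i L hL
      hi hL').trans ?_
    refine Eq.trans ?_ (compAt_cl (Pend.consEquiv i hi) h₁ h₃)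
    rw [h₂]

/-- The composition of classes of trees is given by substitution. -/
theorem ev_cl [hP : P.Full] : ∀ (T : RTree) (D : ∀ v, DTree E (T.inputs v))
    (_ : ∀ v, (D v).Good P), (Nonempty T.Vert → (subst T D).Good P) ∧
      (freeOperad P E).ev (freeUnit P E) T (fun v => (D v).cl P) = (subst T D).cl P
  | RTree.leg, D, _ => by
    -- For the exceptional tree goodness may fail, but both sides are its class, which is zero if it
    -- does not belong to `P`.
    refine ⟨fun h => h.elim fun v => v.elim, ?_⟩
    apply SigmaMod.ext_inj _ RTree.legEquiv
    refine (SigmaMod.extEquiv_symm_apply _ _ _).trans ?_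
    exact (cl_apply (leg ()) RTree.legEquiv).symm
  | RTree.node I c, D, hD => by
    have ih := fun i => ev_cl (c i) (fun v => D (some ⟨i, v⟩)) (fun v => hD (some ⟨i, v⟩))
    set R := fun i => subst (c i) (fun v => D (some ⟨i, v⟩)) with hR
    obtain ⟨h₁, h₂⟩ := gamma_cl (I := I) (hD none) R (RTree.vertList c) (RTree.nodup_vertList c)
      (fun i hi => (ih i).1 ((RTree.mem_vertList c i).1 hi))
    -- Substitution also grafts the exceptional subtrees, which `plug` omits; they merely rename
    -- leaves, and this renaming is part of `pendEquiv`.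
    have key : subst (RTree.node I c) D = ((D none).bind (plug R (RTree.vertList c))).map
        (RTree.pendEquiv c (RTree.vertList c) (RTree.mem_vertList c)) := by
      refine Eq.trans ?_ (bind_map (Z := I) (D none) _ _).symm
      refine congrArg (bind (Z := I) (D none)) (funext fun (i : I) => ?_)
      by_cases hi : i ∈ RTree.vertList c
      · rw [plug_of_mem R hi, map_map]
        rfl
      · rw [plug_of_not_mem R hi]
        exact congrArg (map (fun l => (⟨i, l⟩ : Σ i, (c i).Leaves)))
          (subst_eq_leg (c i) _ (mt (RTree.mem_vertList c i).2 hi))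
    rw [key]
    refine ⟨fun _ => (good_map_iff _ _).2 h₁, ?_⟩
    refine Eq.trans ?_ (extMap_cl (bind (Z := I) (D none) (plug R (RTree.vertList c))) _)
    refine congrArg _ (Eq.trans ?_ h₂)
    refine congrArg (fun y => (freeOperad P E).gamma (cl (Z := I) P (D none)) y _ _)
      (funext fun i => ?_)
    exact (ih i).2

end DTree

/-! The unit. -/

theorem extMap_extEquiv_symm_refl {n : ℕ} (σ : Equiv.Perm (Fin n)) (x : E.obj n) :
    E.extMap σ.symm ((E.extEquiv (Equiv.refl (Fin n))).symm x) =
      (E.extEquiv (Equiv.refl (Fin n))).symm (E.act σ x) := by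
  apply E.ext_inj (Equiv.refl (Fin n))
  rw [SigmaMod.extEquiv_symm_apply, SigmaMod.extMap_apply]
  refine (((E.extEquiv (Equiv.refl (Fin n))).symm x).2 n σ (Equiv.refl _)).trans ?_
  rw [SigmaMod.extEquiv_symm_apply]

open DTree

theorem DTree.toObj_corolla {n : ℕ} (a b : k) (x y : E.ext (Fin n)) :
    (corolla (Fin n) (a • x + b • y)).toObj P =
      a • (corolla (Fin n) x).toObj P + b • (corolla (Fin n) y).toObj P :=
  (LinComb.root _ x y rfl leg).toObj_eq

/-- The unit of the triple. -/
noncomputable def corollaHom (P : TreeClass) [P.Full] (E : SigmaMod k) :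
    E ⟶ (treeFunctor P k).obj E where
  app n :=
    { toFun := fun x => (corolla (Fin n) ((E.extEquiv (Equiv.refl (Fin n))).symm x)).toObj P
      map_add' := fun x y => by
        have := toObj_corolla (P := P) (1 : k) 1 ((E.extEquiv (Equiv.refl (Fin n))).symm x)
          ((E.extEquiv (Equiv.refl (Fin n))).symm y)
        rwa [one_smul, one_smul, one_smul, one_smul, ← map_add] at this
      map_smul' := fun a x => by
        have := toObj_corolla (P := P) a 0 ((E.extEquiv (Equiv.refl (Fin n))).symm x) 0
        rwa [zero_smul, add_zero, zero_smul, add_zero, ← map_smul] at this }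
  app_act {n} σ x := by
    refine Eq.trans ?_ (((corolla (Fin n) ((E.extEquiv (Equiv.refl (Fin n))).symm x)).cl P).2 n σ
      (Equiv.refl (Fin n)))
    have h := cl_corolla_extMap (P := P) σ.symm ((E.extEquiv (Equiv.refl (Fin n))).symm x)
    rw [extMap_extEquiv_symm_refl] at h
    exact congrArg (fun φ => φ.1 n (Equiv.refl (Fin n))) h

theorem corollaHom_app [P.Full] {n : ℕ} (x : E.obj n) :
    (corollaHom P E).app n x = treeElem (corollaTree P n) (corollaDec x) :=
  toObj_ofDec (corollaTree P n) (corollaDec x)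

theorem homExt_corollaHom [P.Full] {I : Type} [Finite I] (x : E.ext I) :
    SigmaMod.homExt (corollaHom P E) I x = (corolla I x).cl P := by
  obtain ⟨n, ⟨a⟩⟩ := Finite.exists_equiv_fin I
  apply SigmaMod.ext_inj _ a.symm
  have h := cl_corolla_extMap (P := P) a x
  refine Eq.trans ?_ (congrArg (fun φ => φ.1 n (Equiv.refl (Fin n))) h)
  have : E.extMap a x = (E.extEquiv (Equiv.refl (Fin n))).symm (x.1 n a.symm) := by
    rw [LinearEquiv.eq_symm_apply]
    rfl
  rw [this]
  rfl

theorem corollaHom_naturality [P.Full] {F : SigmaMod k} (g : E ⟶ F) :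
    g ≫ corollaHom P F = corollaHom P E ≫ (treeFunctor P k).map g := by
  apply SigmaMod.hom_ext
  intro n
  apply LinearMap.ext
  intro x
  refine (corollaHom_app (P := P) (g.app n x)).trans ?_
  refine Eq.trans ?_ (congrArg (((treeFunctor P k).map g).app n) (corollaHom_app (P := P) x)).symm
  refine Eq.trans ?_ (map_treeElem g (corollaTree P n) (corollaDec x)).symm
  refine congrArg (treeElem (corollaTree P n)) (funext fun v => ?_)
  rcases v with _ | ⟨_, v⟩
  · apply F.ext_inj (Equiv.refl (Fin n))
    refine (F.extEquiv_symm_apply _ _).trans ?_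
    exact congrArg (g.app n) (E.extEquiv_symm_apply (Equiv.refl (Fin n)) x).symm
  · exact v.elim

/-- All subtrees of a corolla are exceptional, so the iterated composition runs over the empty list
and returns the decoration. This is both the unit law for algebras and a unit law of the monad. -/
theorem corollaHom_evHom [P.Full] (S : NonunitalOperad k) (e : S.obj 1) :
    corollaHom P S.toSigmaMod ≫ evHom P S e = 𝟙 S.toSigmaMod := by
  apply SigmaMod.hom_ext
  intro n
  apply LinearMap.ext
  intro x
  refine (congrArg ((evHom P S e).app n) (corollaHom_app (P := P) x)).trans ?_
  refine (evHom_treeElem e (corollaTree P n) (corollaDec x)).trans ?_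
  have hL : ∀ i : Fin n, i ∈ [] ↔ Nonempty RTree.leg.Vert := fun i =>
    ⟨fun h => absurd h List.not_mem_nil, fun h => h.elim fun v => Empty.elim v⟩
  refine (congrArg (fun φ => φ.1 n (corollaTree P n).label.symm)
    (S.ev_node e _ (corollaDec x) [] hL List.nodup_nil)).trans ?_
  rw [NonunitalOperad.gamma_nil]
  refine Eq.trans (congrArg (((S.extEquiv (Equiv.refl (Fin n))).symm x).1 n)
    (Equiv.ext fun i => ?_)) (S.extEquiv_symm_apply (Equiv.refl (Fin n)) x)
  have h : (RTree.pendEquiv (fun _ : Fin n => RTree.leg) [] hL).symm ⟨i, ()⟩ =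
      Pend.todo i List.not_mem_nil := (Equiv.symm_apply_eq _).2 rfl
  exact congrArg Pend.nilEquiv.symm h

/-- The multiplication of the triple. -/
noncomputable def braceHom (P : TreeClass) [P.Full] (E : SigmaMod k) :
    (treeFunctor P k).obj ((treeFunctor P k).obj E) ⟶ (treeFunctor P k).obj E :=
  evHom P (freeOperad P E) (freeUnit P E)

/-! ### Functoriality in the Σ-module, and the monad laws. -/

namespace DTree

/-- The decorated tree obtained by applying a morphism to the decorations. -/
def mapDec {E F : SigmaMod k} (g : E ⟶ F) {Z : Type} : DTree E Z → DTree F Z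
  | leg z => leg z
  | node I x c => node I (SigmaMod.homExt g I x) (fun i => mapDec g (c i))

variable {F : SigmaMod k} (g : E ⟶ F) {Z Z' X J Y : Type}

theorem mapDec_bind (D : DTree E Z) (f : Z → DTree E Z') :
    (D.bind f).mapDec g = (D.mapDec g).bind (fun z => (f z).mapDec g) := by
  induction D with
  | leg z => rfl
  | node I x c ih => exact congrArg (node I _) (funext ih)

theorem mapDec_graftAt (i : X) (w : {x : X // x ≠ i} ⊕ J → Y) (D : DTree E X) (D' : DTree E J) :
    (graftAt i w D D').mapDec g = graftAt i w (D.mapDec g) (D'.mapDec g) := by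
  refine (mapDec_bind g D _).trans (congrArg _ (funext fun x => ?_))
  by_cases hx : x = i
  · subst hx
    rw [graftFun_self, graftFun_self]
    exact mapDec_bind g D' _
  · rw [graftFun_of_ne w _ hx, graftFun_of_ne w _ hx]
    rfl

theorem mapDec_ofDec : ∀ (T : RTree) (b : T.Leaves → Z) (d : RTree.Dec E T),
    (ofDec T b d).mapDec g = ofDec T b (fun v => SigmaMod.homExt g _ (d v))
  | RTree.leg, _, _ => rfl
  | RTree.node I c, b, d => congrArg (node I _) (funext fun i =>
      mapDec_ofDec (c i) (fun l => b ⟨i, l⟩) (d.child i))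

theorem Good.mapDec {D : DTree E Z} (hD : D.Good P) : (D.mapDec g).Good P := by
  obtain ⟨T, hT, b, d, rfl⟩ := hD.exists_ofDec
  rw [mapDec_ofDec]
  exact good_ofDec hT b _

theorem map_toObj {n : ℕ} {D : DTree E (Fin n)} (hD : D.Good P) :
    ((treeFunctor P k).map g).app n (D.toObj P) = (D.mapDec g).toObj P := by
  obtain ⟨T, hT, b, d, rfl⟩ := hD.exists_ofDec
  rw [mapDec_ofDec, toObj_ofDec ⟨T, b, hT⟩, map_treeElem]
  exact (toObj_ofDec ⟨T, b, hT⟩ _).symm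

end DTree

theorem map_freeCirc [P.Full] {F : SigmaMod k} (g : E ⟶ F) {m n p : ℕ} (h : m + n = p + 1)
    (i : Fin m) (x : ((treeFunctor P k).obj E).obj m) (y : ((treeFunctor P k).obj E).obj n) :
    ((treeFunctor P k).map g).app p (freeCirc P E h i x y) =
      freeCirc P F h i (((treeFunctor P k).map g).app m x)
        (((treeFunctor P k).map g).app n y) := by
  apply toObj_ext (x := x)
  rotate_left
  iterate 2 (constructor <;> simp)
  intro D hD
  apply toObj_ext (x := y)
  rotate_left
  iterate 2 (constructor <;> simp)
  intro D' hD'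
  rw [freeCirc_toObj h i hD hD', map_toObj g hD, map_toObj g hD',
    map_toObj g (hD.graftAt (blockFun_bijective h i) hD'),
    freeCirc_toObj h i (hD.mapDec g) (hD'.mapDec g), mapDec_graftAt]

/-- The free operad is functorial. -/
noncomputable def freeOperadMap (P : TreeClass) [P.Full] {E F : SigmaMod k} (g : E ⟶ F) :
    freeOperad P E ⟶ freeOperad P F where
  hom := (treeFunctor P k).map g
  map_circ := map_freeCirc g

theorem map_freeUnit {F : SigmaMod k} (g : E ⟶ F) :
    ((treeFunctor P k).map g).app 1 (freeUnit P E) = freeUnit P F := by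
  by_cases h : P.Mem RTree.leg
  · exact map_toObj g (good_leg h)
  · have h₀ : ∀ E : SigmaMod k, freeUnit P E = 0 := fun E => by
      rw [freeUnit, toObj, cl_of_not_good (fun hD => h hD.mem)]
      rfl
    rw [h₀, h₀, map_zero]

theorem braceHom_naturality [P.Full] {F : SigmaMod k} (g : E ⟶ F) :
    (treeFunctor P k).map ((treeFunctor P k).map g) ≫ braceHom P F =
      braceHom P E ≫ (treeFunctor P k).map g :=
  map_evHom (freeOperadMap P g) (map_freeUnit g)

/-- The multiplication is a morphism from the free operad on Γ(E) to the free operad on E, hence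
evaluation is natural along it. -/
theorem braceHom_assoc [P.Full] : (treeFunctor P k).map (braceHom P E) ≫ braceHom P E =
    braceHom P ((treeFunctor P k).obj E) ≫ braceHom P E :=
  map_evHom (evMor P (unitLaws_freeOperad E)) (evHom_freeUnit _ (unitLaws_freeOperad E))

/-- On a decorated tree the composite substitutes a corolla for every vertex, which gives back the
tree. -/
theorem map_corollaHom_braceHom [P.Full] :
    (treeFunctor P k).map (corollaHom P E) ≫ braceHom P E = 𝟙 _ := by
  apply SigmaMod.hom_ext
  intro n
  apply LinearMap.ext
  intro x
  apply treeElem_induction (x := x)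
  · intro X d
    refine (congrArg ((braceHom P E).app n) (map_treeElem (corollaHom P E) X d)).trans ?_
    refine (evHom_treeElem _ X _).trans ?_
    simp only [homExt_corollaHom]
    have h := (ev_cl (P := P) X.tree (fun v => corolla (X.tree.inputs v) (d v))
      (fun v => good_corolla _)).2
    rw [subst_corolla] at h
    exact congrArg (fun φ => φ.1 n X.label.symm) (h.trans (cl_ofDec X.mem (Equiv.refl _) d))
  · rw [map_zero, map_zero]
  · intro x y hx hy
    rw [map_add, map_add, hx, hy]
  · intro a x hx
    rw [map_smul, map_smul, hx]

/-- The triple given by the trees in the class `P`. -/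
noncomputable def treeTriple (P : TreeClass) [P.Full] (k : Type u) [CommRing k] :
    TreeTriple P k where
  η := { app := fun E => corollaHom P E, naturality := fun _ _ g => corollaHom_naturality g }
  μ := { app := fun E => braceHom P E, naturality := fun _ _ g => braceHom_naturality g }
  isCorollaUnit E n x := corollaHom_app x
  erasesBraces E n X t ht b d := by
    refine (evHom_treeElem _ X _).trans ?_
    have h := (ev_cl (P := P) X.tree (fun v => ofDec (t v) (b v) (d v))
      (fun v => good_ofDec (ht v) (b v) (d v))).2
    rw [subst_ofDec, cl_ofDec (P.mem_subst X.tree t b X.mem ht)] at h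
    simp only [cl_ofDec (ht _)] at h
    exact congrArg (fun φ => φ.1 n X.label.symm) h
  assoc E := braceHom_assoc
  left_unit E := corollaHom_evHom _ _
  right_unit E := map_corollaHom_braceHom

end

/-! ### Algebras over the triple -/

section
variable {k : Type u} [CommRing k]

/-- Operads that are unital if the exceptional tree belongs to `P`, and non-unital otherwise. -/
structure POperad (P : TreeClass) (k : Type u) [CommRing k] extends NonunitalOperad k where
  unit : obj 1
  laws : toNonunitalOperad.UnitLaws P unit

/-- Morphisms preserve the compositions and the units. -/
@[ext]
structure POperad.Hom {P : TreeClass} (S R : POperad P k) where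
  hom : S.toNonunitalOperad ⟶ R.toNonunitalOperad
  map_unit : hom.hom.app 1 S.unit = R.unit

instance {P : TreeClass} : Category (POperad P k) where
  Hom S R := POperad.Hom S R
  id S := ⟨𝟙 S.toNonunitalOperad, rfl⟩
  comp f g := ⟨f.hom ≫ g.hom, (congrArg (g.hom.hom.app 1) f.map_unit).trans g.map_unit⟩

/-- The forgetful functor to `Σ`-modules. -/
def POperad.forget (P : TreeClass) (k : Type u) [CommRing k] : POperad P k ⥤ SigmaMod k where
  obj S := S.toSigmaMod
  map f := f.hom.hom

instance {P : TreeClass} : (POperad.forget P k).Faithful where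
  map_injective h := POperad.Hom.ext (NonunitalOperad.Hom.ext h)

theorem POperad.eq_of_circ_eq {P : TreeClass} {S R : POperad P k}
    (hA : S.toSigmaMod = R.toSigmaMod)
    (h : ∀ {m n p : ℕ} (h : m + n = p + 1) (i : Fin m) (x : S.obj m) (y : S.obj n),
      hA ▸ S.circ h i x y = R.circ h i (hA ▸ x) (hA ▸ y)) (he : hA ▸ S.unit = R.unit) : S = R := by
  obtain ⟨⟨A, c, h₁, h₂, h₃, h₄⟩, e, _⟩ := S
  obtain ⟨⟨B, c', _, _, _, _⟩, e', _⟩ := R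
  obtain rfl : A = B := hA
  obtain rfl : e = e' := he
  have : @c = @c' := by
    funext m n p hm i
    exact LinearMap.ext fun x => LinearMap.ext fun y => h hm i x y
  subst this
  rfl

/-- Functors agree if they agree on objects and after composition with a faithful functor. -/
theorem functor_eq_of_comp_eq {A B C : Type*} [Category A] [Category B] [Category C] (V : B ⥤ C)
    [V.Faithful] {F G : A ⥤ B} (h : ∀ X, F.obj X = G.obj X) (hV : F ⋙ V = G ⋙ V) : F = G := by
  refine CategoryTheory.Functor.ext h fun X Y f => V.map_injective ?_
  have := CategoryTheory.Functor.congr_hom hV f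
  simpa [eqToHom_map] using this

theorem IsomorphicOver.trans {A B C D : Type*} [Category A] [Category B] [Category C] [Category D]
    {U : A ⥤ D} {V : B ⥤ D} {W : C ⥤ D} (h : IsomorphicOver U V) (h' : IsomorphicOver V W) :
    IsomorphicOver U W := by
  obtain ⟨F, G, h₁, h₂, h₃, h₄⟩ := h
  obtain ⟨F', G', h₁', h₂', h₃', h₄'⟩ := h'
  refine ⟨F ⋙ F', G' ⋙ G, ?_, ?_, ?_, ?_⟩
  · calc (F ⋙ F') ⋙ G' ⋙ G = F ⋙ (F' ⋙ G') ⋙ G := rfl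
      _ = F ⋙ 𝟭 B ⋙ G := by rw [h₁']
      _ = F ⋙ G := rfl
      _ = 𝟭 A := h₁
  · calc (G' ⋙ G) ⋙ F ⋙ F' = G' ⋙ (G ⋙ F) ⋙ F' := rfl
      _ = G' ⋙ 𝟭 B ⋙ F' := by rw [h₂]
      _ = G' ⋙ F' := rfl
      _ = 𝟭 C := h₂'
  · rw [Functor.assoc, h₃', h₃]
  · rw [Functor.assoc, h₄, h₄']

/-! #### The operad given by an algebra -/

section
variable {P : TreeClass} [P.Full] {A B : SigmaMod k} (α : (treeFunctor P k).obj A ⟶ A)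

/-- The partial compositions of an algebra. -/
noncomputable def algCirc {m n p : ℕ} (h : m + n = p + 1) (i : Fin m) :
    A.obj m →ₗ[k] A.obj n →ₗ[k] A.obj p :=
  ((freeCirc P A h i).compr₂ (α.app p)).compl₁₂ ((corollaHom P A).app m) ((corollaHom P A).app n)

theorem algCirc_apply {m n p : ℕ} (h : m + n = p + 1) (i : Fin m) (x : A.obj m) (y : A.obj n) :
    algCirc α h i x y =
      α.app p (freeCirc P A h i ((corollaHom P A).app m x) ((corollaHom P A).app n y)) := rfl

variable {α}

theorem SigmaMod.app_eq_of_comp_eq {A B C D : SigmaMod k} {f : A ⟶ B} {g : B ⟶ D} {f' : A ⟶ C}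
    {g' : C ⟶ D} (h : f ≫ g = f' ≫ g') {n : ℕ} (x : A.obj n) :
    g.app n (f.app n x) = g'.app n (f'.app n x) :=
  congrArg (fun f : A ⟶ D => f.app n x) h

theorem SigmaMod.app_eq_of_comp_eq_id {A B : SigmaMod k} {f : A ⟶ B} {g : B ⟶ A}
    (h : f ≫ g = 𝟙 A) {n : ℕ} (x : A.obj n) : g.app n (f.app n x) = x :=
  congrArg (fun f : A ⟶ A => f.app n x) h

theorem alg_corollaHom (hu : corollaHom P A ≫ α = 𝟙 A) {n : ℕ} (x : A.obj n) :
    α.app n ((corollaHom P A).app n x) = x :=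
  SigmaMod.app_eq_of_comp_eq_id hu x

theorem braceHom_freeCirc {m n p : ℕ} (h : m + n = p + 1) (i : Fin m)
    (x : ((treeFunctor P k).obj ((treeFunctor P k).obj A)).obj m)
    (y : ((treeFunctor P k).obj ((treeFunctor P k).obj A)).obj n) :
    (braceHom P A).app p (freeCirc P _ h i x y) =
      freeCirc P A h i ((braceHom P A).app m x) ((braceHom P A).app n y) :=
  (evMor P (unitLaws_freeOperad (P := P) A)).map_circ h i x y

theorem braceHom_corollaHom {n : ℕ} (x : ((treeFunctor P k).obj A).obj n) :
    (braceHom P A).app n ((corollaHom P ((treeFunctor P k).obj A)).app n x) = x :=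
  SigmaMod.app_eq_of_comp_eq_id (corollaHom_evHom (freeOperad P A) (freeUnit P A)) x

theorem corollaHom_app_app {n : ℕ} (f : A ⟶ B) (x : A.obj n) : (corollaHom P B).app n (f.app n x) =
    ((treeFunctor P k).map f).app n ((corollaHom P A).app n x) :=
  SigmaMod.app_eq_of_comp_eq (corollaHom_naturality (P := P) f) x

/-- By naturality of η and of grafting, the left side is α ∘ Γ(α) applied to a composite of
corollas. The algebra law replaces Γ(α) by the multiplication, which respects grafting and undoes
the corollas. -/
theorem algCirc_app (ha : braceHom P A ≫ α = (treeFunctor P k).map α ≫ α)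
    {m n p : ℕ} (h : m + n = p + 1) (i : Fin m) (x : ((treeFunctor P k).obj A).obj m)
    (y : ((treeFunctor P k).obj A).obj n) :
    algCirc α h i (α.app m x) (α.app n y) = α.app p (freeCirc P A h i x y) := by
  refine (algCirc_apply α h i _ _).trans ?_
  refine (congrArg₂ (fun a b => α.app p (freeCirc P A h i a b)) (corollaHom_app_app α x)
    (corollaHom_app_app α y)).trans ?_
  refine (congrArg (α.app p) (map_freeCirc α h i _ _)).symm.trans ?_
  refine (SigmaMod.app_eq_of_comp_eq ha _).symm.trans (congrArg (α.app p) ?_)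
  exact (braceHom_freeCirc h i _ _).trans
    (congrArg₂ (fun a b => freeCirc P A h i a b) (braceHom_corollaHom x) (braceHom_corollaHom y))

/-- The operad given by an algebra. -/
noncomputable def algOperad (hu : corollaHom P A ≫ α = 𝟙 A)
    (ha : braceHom P A ≫ α = (treeFunctor P k).map α ≫ α) : NonunitalOperad k where
  toSigmaMod := A
  circ := algCirc α
  assoc_before hab hpc hac hrb j i hi f g h := by
    -- Every operation is α of its corolla, and α respects compositions; thus the axiom is the image
    -- under α of the axiom in the free operad.
    rw [← alg_corollaHom hu f, ← alg_corollaHom hu g, ← alg_corollaHom hu h]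
    simp only [algCirc_app ha]
    exact congrArg (α.app _) ((freeOperad P A).assoc_before hab hpc hac hrb j i hi _ _ _)
  assoc_inside hab hpc hbc has j i hi hi' f g h := by
    rw [← alg_corollaHom hu f, ← alg_corollaHom hu g, ← alg_corollaHom hu h]
    simp only [algCirc_app ha]
    exact congrArg (α.app _) ((freeOperad P A).assoc_inside hab hpc hbc has j i hi hi' _ _ _)
  assoc_after hab hpc hac hrb j i hi hi' f g h := by
    rw [← alg_corollaHom hu f, ← alg_corollaHom hu g, ← alg_corollaHom hu h]
    simp only [algCirc_app ha]
    exact congrArg (α.app _) ((freeOperad P A).assoc_after hab hpc hac hrb j i hi hi' _ _ _)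
  equivariance hmn i τ σ f g := by
    rw [← alg_corollaHom hu f, ← alg_corollaHom hu g, ← α.app_act, ← α.app_act]
    simp only [algCirc_app ha]
    rw [← α.app_act]
    exact congrArg (α.app _) ((freeOperad P A).equivariance hmn i τ σ _ _)

theorem unitLaws_algOperad (hu : corollaHom P A ≫ α = 𝟙 A)
    (ha : braceHom P A ≫ α = (treeFunctor P k).map α ≫ α) :
    (algOperad hu ha).UnitLaws P (α.app 1 (freeUnit P A)) where
  circ_unit h m i f := by
    change algCirc α _ i f _ = f
    conv_lhs => rw [← alg_corollaHom hu f, algCirc_app ha]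
    refine (congrArg (α.app m) ((unitLaws_freeOperad A).circ_unit h i _)).trans ?_
    exact alg_corollaHom hu f
  unit_circ h n g := by
    change algCirc α _ 0 _ g = g
    conv_lhs => rw [← alg_corollaHom hu g, algCirc_app ha]
    refine (congrArg (α.app n) ((unitLaws_freeOperad A).unit_circ h _)).trans ?_
    exact alg_corollaHom hu g
  eq_zero h := by
    rw [(unitLaws_freeOperad A).eq_zero h]
    exact map_zero _

/-- The structure map of an algebra is a morphism of operads. -/
noncomputable def algMor (hu : corollaHom P A ≫ α = 𝟙 A)
    (ha : braceHom P A ≫ α = (treeFunctor P k).map α ≫ α) :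
    freeOperad P A ⟶ algOperad hu ha where
  hom := α
  map_circ h i x y := (algCirc_app ha h i x y).symm

/-- The map α is a morphism of operads from Γ(A) to the operad it defines, so naturality gives ev ∘
Γ(α) = α ∘ μ. Precomposing with Γ(η) turns Γ(α) and μ into identities. -/
theorem evHom_algOperad (hu : corollaHom P A ≫ α = 𝟙 A)
    (ha : braceHom P A ≫ α = (treeFunctor P k).map α ≫ α) :
    evHom P (algOperad hu ha) (α.app 1 (freeUnit P A)) = α := by
  have h := map_evHom (P := P) (S := freeOperad P A) (e := freeUnit P A) (algMor hu ha)
    (e' := (α.app 1 (freeUnit P A) : A.obj 1)) rfl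
  have h₁ : (treeFunctor P k).map (corollaHom P A) ≫ (treeFunctor P k).map α = 𝟙 _ := by
    exact ((treeFunctor P k).map_comp _ _).symm.trans
      ((congrArg _ hu).trans ((treeFunctor P k).map_id A))
  have h₂ := map_corollaHom_braceHom (P := P) (E := A)
  have h₃ := congrArg (fun f => (treeFunctor P k).map (corollaHom P A) ≫ f) h
  have h₄ : ((treeFunctor P k).map (corollaHom P A) ≫ (treeFunctor P k).map α) ≫
      evHom P (algOperad hu ha) (α.app 1 (freeUnit P A)) =
        ((treeFunctor P k).map (corollaHom P A) ≫ braceHom P A) ≫ α := h₃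
  rw [h₁, h₂] at h₄
  exact h₄

theorem map_algCirc {β : (treeFunctor P k).obj B ⟶ B} (f : A ⟶ B)
    (hf : (treeFunctor P k).map f ≫ β = α ≫ f) {m n p : ℕ} (h : m + n = p + 1) (i : Fin m)
    (x : A.obj m) (y : A.obj n) :
    f.app p (algCirc α h i x y) = algCirc β h i (f.app m x) (f.app n y) := by
  rw [algCirc_apply, algCirc_apply, corollaHom_app_app, corollaHom_app_app, ← map_freeCirc]
  exact (SigmaMod.app_eq_of_comp_eq hf _).symm

end

/-! ### The isomorphisms of categories. -/

variable (k) (P : TreeClass) [P.Full]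

/-- The algebra given by an operad. -/
noncomputable def operadToAlgebra : POperad P k ⥤ (treeTriple P k).monad.Algebra where
  obj S :=
    { A := S.toSigmaMod
      a := evHom P S.toNonunitalOperad S.unit
      unit := corollaHom_evHom _ _
      assoc := (map_evHom (evMor P S.laws) (evHom_freeUnit _ S.laws)).symm }
  map g :=
    { f := g.hom.hom
      h := map_evHom g.hom g.map_unit }

/-- The operad given by an algebra. -/
noncomputable def algebraToOperad : (treeTriple P k).monad.Algebra ⥤ POperad P k where
  obj X :=
    { toNonunitalOperad := algOperad X.unit X.assoc
      unit := X.a.app 1 (freeUnit P X.A)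
      laws := unitLaws_algOperad X.unit X.assoc }
  map {X Y} f :=
    { hom := ⟨f.f, map_algCirc f.f f.h⟩
      map_unit := by
        have h := congrArg (fun g : (treeFunctor P k).obj X.A ⟶ Y.A => g.app 1 (freeUnit P X.A)) f.h
        refine h.symm.trans (congrArg (Y.a.app 1) (map_freeUnit f.f)) }

theorem isomorphicOver_algebra :
    IsomorphicOver (treeTriple P k).monad.forget (POperad.forget P k) := by
  refine ⟨algebraToOperad k P, operadToAlgebra k P, ?_, ?_, rfl, rfl⟩
  · refine functor_eq_of_comp_eq (treeTriple P k).monad.forget (fun X => ?_) rfl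
    have h := evHom_algOperad (P := P) X.unit X.assoc
    have key : ∀ (A : SigmaMod k) (a a' : (treeFunctor P k).obj A ⟶ A) (h : a = a') h₁ h₂ h₃ h₄,
        (⟨A, a, h₁, h₂⟩ : (treeTriple P k).monad.Algebra) = ⟨A, a', h₃, h₄⟩ := by
      rintro A a _ rfl _ _ _ _
      rfl
    exact key _ _ _ h _ _ _ _
  · refine functor_eq_of_comp_eq (POperad.forget P k) (fun S => ?_) rfl
    have hc : ∀ {n : ℕ} (x : S.obj n), (evHom P S.toNonunitalOperad S.unit).app n
        ((corollaHom P S.toSigmaMod).app n x) = x := fun x =>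
      SigmaMod.app_eq_of_comp_eq_id (corollaHom_evHom _ _) x
    -- Two corollas grafted together evaluate to the composition of their decorations, so the
    -- original compositions return.
    refine POperad.eq_of_circ_eq rfl (fun {m n p} h i x y => ?_) (evHom_freeUnit _ S.laws)
    exact (evHom_freeCirc S.unit S.laws h i _ _).trans
      (congrArg₂ (fun a b => S.circ h i a b) (hc x) (hc y))

/-- For ordinary trees the laws force the distinguished element to be zero, so it is no additional
datum, and every morphism preserves it. -/
theorem isomorphicOver_nonunitalOperad :
    IsomorphicOver (POperad.forget ordinaryTrees k) (NonunitalOperad.forget k) := by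
  have hleg : ¬ ordinaryTrees.Mem RTree.leg := fun h => h.elim fun v => v.elim
  refine ⟨{ obj := fun S => S.toNonunitalOperad, map := fun f => f.hom },
    { obj := fun S => ⟨S, 0, fun h => absurd h hleg, fun h => absurd h hleg, fun _ => rfl⟩
      map := fun f => ⟨f, map_zero _⟩ }, ?_, rfl, rfl, rfl⟩
  refine functor_eq_of_comp_eq (POperad.forget _ k) (fun S => ?_) rfl
  exact POperad.eq_of_circ_eq rfl (fun _ _ _ _ => rfl) (S.laws.eq_zero hleg).symm

/-- With the exceptional tree in the class, the laws are the two unit axioms, and the condition on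
the absence of that tree is vacuous. -/
theorem isomorphicOver_operad :
    IsomorphicOver (POperad.forget allTrees k) (Operad.forget k) :=
  ⟨{ obj := fun S => ⟨S.toNonunitalOperad, S.unit, S.laws.circ_unit trivial,
        S.laws.unit_circ trivial⟩
     map := fun f => ⟨f.hom, f.map_unit⟩ },
    { obj := fun S => ⟨S.toNonunitalOperad, S.unit, fun _ => S.circ_unit, fun _ => S.unit_circ,
        fun h => absurd trivial h⟩
      map := fun f => ⟨f.hom, f.map_unit⟩ }, rfl, rfl, rfl, rfl⟩

end

end TreeOperads

theorem mainTheorem6 (k : Type u) [CommRing k] :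
    (∃ Ψ : TreeOperads.TreeTriple TreeOperads.ordinaryTrees k,
      TreeOperads.IsomorphicOver Ψ.monad.forget (TreeOperads.NonunitalOperad.forget k)) ∧
    (∃ Γ : TreeOperads.TreeTriple TreeOperads.allTrees k,
      TreeOperads.IsomorphicOver Γ.monad.forget (TreeOperads.Operad.forget k)) := by
  exact ⟨⟨TreeOperads.treeTriple _ k, (TreeOperads.isomorphicOver_algebra k _).trans
      (TreeOperads.isomorphicOver_nonunitalOperad k)⟩,
    ⟨TreeOperads.treeTriple _ k, (TreeOperads.isomorphicOver_algebra k _).trans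
      (TreeOperads.isomorphicOver_operad k)⟩⟩
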